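/- Let $\Bbbk$ be a field, $n\ge 2$, and $q\in\Bbbk$ a primitive $2n$-th root of unity. Let $u_q(\mathfrak{sl}_2)$ be the Hopf algebra generated by $K,E,F$ with relations $KE=q^2EK$, $KF=q^{-2}FK$, $K^n=1$, $E^n=F^n=0$, $EF-FE=\frac{K-K^{-1}}{q-q^{-1}}$, and $\Delta K=K\otimes K$, $\Delta E=1\otimes E+E\otimes K$, $\Delta F=K^{-1}\otimes F+F\otimes 1$. An action on an algebra $A$ is a left module structure with $h\cdot(pr)=\sum(h_1\cdot p)(h_2\cdot r)$ and $h\cdot 1=\varepsilon(h)1$. Paths in a path algebra $\Bbbk Q$ are composed from left to right, $e_v$ is the trivial path at $v$, and actions on path algebras are assumed to preserve the path length filtration. **(0) Vertices.** Let $u_q(\mathfrak{sl}_2)$ act on the path algebra of the arrowless quiver with vertices $1,\dots,m$ so that $K\cdot e_i=e_{i+1}$ (indices modulo $m$). (i) If $m<n$, then $m=1$ or $m=2$, and the action factors through $u_q(\mathfrak{sl}_2)/\langle E,F\rangle$. (ii) If $m=n$, then there are $\gamma^E,\gamma^F\in\Bbbk$ with $$E\cdot e_i=\gamma^Eq^{-2i}(e_i-q^{-2}e_{i+1}),\qquad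 F\cdot e_i=\gamma^Fq^{2i}(e_{i-1}-q^2e_i),$$ and, if $n\ge3$, $$-\gamma^E\gamma^Fq^{-1}(q^2-1)^2=1.\qquad(*)$$ Conversely, all $\gamma^E,\gamma^F$ (satisfying $(*)$ if $n\ge 3$) arise from exactly one such action. From now on let $n\ge3$ and take all indices modulo $n$. **(A)** Let $Q$ be a subquiver, stable under adding $1$ to all indices, of the complete quiver $K_n$ (vertices $1,\dots,n$, one arrow $a^i_j$ from $i$ to $j$ for all $i\ne j$; put $a^i_i=e_i$). For any action of $u_q(\mathfrak{sl}_2)$ on $\Bbbk Q$ with $K\cdot e_i=e_{i+1}$, there are $\mu_{i,j}\in\Bbbk^\times$ with $K\cdot a^i_j=\mu_{i,j}a^{i+1}_{j+1}$, $\mu_{i,i}=1$ and $\prod_{\ell=0}^{n-1}\mu_{i+\ell,j+\ell}=1$, and the arrows can be rescaled by nonzero scalars so that all $\mu_{i,j}=1$. Whenever the (possibly rescaled) arrows are such that all $\mu_{i,j}=1$, there are scalars $\gamma^E,\gamma^F,\lambda^E_{i,j},\lambda^F_{i,j}\in\Bbbk$ such that, for all $a^i_j$ in $Q$, $$E\cdot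 a^i_j=\gamma^E(q^{-2j}a^i_j-q^{-2i-2}a^{i+1}_{j+1})+\lambda^E_{i,j}a^i_{j+1},\qquad F\cdot a^i_j=\gamma^F(q^{2j}a^{i-1}_{j-1}-q^{2i+2}a^i_j)+\lambda^F_{i,j}a^{i-1}_j,$$ subject to $(*)$ and - $\lambda^E_{i,j}=0$ if $i=j$ or $a^i_{j+1}$ is not in $Q$; $\lambda^F_{i,j}=0$ if $i=j$ or $a^{i-1}_j$ is not in $Q$ (trivial paths $a^l_l=e_l$ count as being in $Q$ when the vertex $l$ is); - $\lambda^E_{i+1,j+1}=q^{-2}\lambda^E_{i,j}$, $\lambda^F_{i+1,j+1}=q^2\lambda^F_{i,j}$, $\lambda^F_{i,j}\lambda^E_{i-1,j}=\lambda^E_{i,j}\lambda^F_{i,j+1}$. Conversely, for every rescaling of the arrows, all scalars with these properties define exactly one action of $u_q(\mathfrak{sl}_2)$ on $\Bbbk Q$ with $K\cdot a^i_j=a^{i+1}_{j+1}$ for the rescaled arrows (and for trivial paths) and with $E$, $F$ given by these formulas. **(B)** Let $Q$ be a subquiver, stable under adding $1$ to all indices, of the complete bipartite quiver $K_{n,n}$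 (vertices $i_+$, $j_-$, one arrow $b^i_j$ from $i_+$ to $j_-$ for all $i,j$). For any action of $u_q(\mathfrak{sl}_2)$ on $\Bbbk Q$ with $K\cdot e_{i_\pm}=e_{(i+1)_\pm}$, there are $\mu_{i,j}\in\Bbbk^\times$ with $K\cdot b^i_j=\mu_{i,j}b^{i+1}_{j+1}$ and $\prod_{\ell=0}^{n-1}\mu_{i+\ell,j+\ell}=1$, and the arrows can be rescaled so that all $\mu_{i,j}=1$. Whenever the (possibly rescaled) arrows are such that all $\mu_{i,j}=1$, there are scalars $\gamma^E_\pm,\gamma^F_\pm,\lambda^E_{i,j},\lambda^F_{i,j}\in\Bbbk$ such that $E,F$ act on $e_{i_\pm}$ by the formulas of (0)(ii) with $\gamma^E_\pm,\gamma^F_\pm$, and, for all $b^i_j$ in $Q$, $$E\cdot b^i_j=\gamma^E_-q^{-2j}b^i_j-\gamma^E_+q^{-2i-2}b^{i+1}_{j+1}+\lambda^E_{i,j}b^i_{j+1},\qquad F\cdot b^i_j=\gamma^F_-q^{2j}b^{i-1}_{j-1}-\gamma^F_+q^{2i+2}b^i_j+\lambda^F_{i,j}b^{i-1}_j,$$ where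 $(\gamma^E_+,\gamma^F_+)$ and $(\gamma^E_-,\gamma^F_-)$ satisfy $(*)$ and, for all $b^i_j$ in $Q$, - $\lambda^E_{i,j}=0$ if $b^i_{j+1}$ is not in $Q$; $\lambda^F_{i,j}=0$ if $b^{i-1}_j$ is not in $Q$; - $\lambda^E_{i+1,j+1}=q^{-2}\lambda^E_{i,j}$, $\lambda^F_{i+1,j+1}=q^2\lambda^F_{i,j}$, $\lambda^F_{i,j}\lambda^E_{i-1,j}=\lambda^E_{i,j}\lambda^F_{i,j+1}$; - $(\gamma^E_+)^n=(\gamma^E_-)^n+\prod_{\ell=0}^{n-1}\lambda^E_{i,j+\ell}$ and $(\gamma^F_+)^n=(\gamma^F_-)^n+\prod_{\ell=0}^{n-1}\lambda^F_{i,j+\ell}$. Conversely, for every rescaling of the arrows, all scalars with these properties define exactly one action of $u_q(\mathfrak{sl}_2)$ on $\Bbbk Q$ with $K\cdot e_{i_\pm}=e_{(i+1)_\pm}$, $K\cdot b^i_j=b^{i+1}_{j+1}$ for the rescaled arrows, and with $E$, $F$ given by these formulas. -/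

import Mathlib

open scoped TensorProduct

/-! ## The small quantum group -/

/-- Gaussian binomial coefficients, through the Pascal rule. -/
def gaussBinomial {k : Type*} [Field k] (c : k) : ℕ → ℕ → k
  | _, 0 => 1
  | 0, _ + 1 => 0
  | m + 1, i + 1 => gaussBinomial c m i + c ^ (i + 1) * gaussBinomial c m (i + 1)

theorem gaussBinomial_zero_right {k : Type*} [Field k] (c : k) (m : ℕ) :
    gaussBinomial c m 0 = 1 := by
  cases m <;> rfl

theorem gaussBinomial_eq_zero {k : Type*} [Field k] (c : k) (m : ℕ) :
    ∀ i, m < i → gaussBinomial c m i = 0 := by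
  induction m with
  | zero => intro i hi; cases i with
    | zero => omega
    | succ i => rfl
  | succ m ih =>
    intro i hi
    cases i with
    | zero => omega
    | succ i => simp [gaussBinomial, ih i (by omega), ih (i + 1) (by omega)]

theorem gaussBinomial_self {k : Type*} [Field k] (c : k) (m : ℕ) :
    gaussBinomial c m m = 1 := by
  induction m with
  | zero => rfl
  | succ m ih => simp [gaussBinomial, ih, gaussBinomial_eq_zero c m (m + 1) (by omega)]

theorem gaussBinomial_absorb {k : Type*} [Field k] (c : k) (m : ℕ) :
    ∀ i, (1 - c ^ (i + 1)) * gaussBinomial c (m + 1) (i + 1)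
      = (1 - c ^ (m + 1)) * gaussBinomial c m i := by
  induction m with
  | zero =>
    intro i
    cases i with
    | zero => simp [gaussBinomial]
    | succ i => simp [gaussBinomial]
  | succ m ih =>
    intro i
    have h1 := ih i
    rw [show gaussBinomial c (m + 1 + 1) (i + 1) = gaussBinomial c (m + 1) i
      + c ^ (i + 1) * gaussBinomial c (m + 1) (i + 1) from rfl]
    cases i with
    | zero =>
      simp only [gaussBinomial_zero_right] at h1 ⊢
      linear_combination c * h1
    | succ i =>
      have h2 := ih i
      have h3 : gaussBinomial c (m + 1) (i + 1) = gaussBinomial c m i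
        + c ^ (i + 1) * gaussBinomial c m (i + 1) := rfl
      linear_combination c ^ (i + 2) * h1 + c * h2 - c * (1 - c ^ (m + 1)) * h3

theorem add_pow_of_qcomm {k A : Type*} [Field k] [Ring A] [Algebra k A] (c : k) (x y : A)
    (h : y * x = c • (x * y)) (m : ℕ) :
    (x + y) ^ m =
      ∑ i ∈ Finset.range (m + 1), gaussBinomial c m i • (x ^ i * y ^ (m - i)) := by
  have hyx : ∀ i : ℕ, y * x ^ i = c ^ i • (x ^ i * y) := by
    intro i
    induction i with
    | zero => simp
    | succ i ih =>
      rw [pow_succ, ← mul_assoc, ih, smul_mul_assoc, mul_assoc, h, mul_smul_comm, smul_smul,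
        pow_succ, ← mul_assoc]
  induction m with
  | zero => simp [gaussBinomial]
  | succ m ih =>
    rw [pow_succ', ih, add_mul, Finset.mul_sum, Finset.mul_sum, Finset.sum_range_succ' _ (m + 1)]
    have e1 : ∀ i ∈ Finset.range (m + 1),
        x * (gaussBinomial c m i • (x ^ i * y ^ (m - i)))
          = gaussBinomial c m i • (x ^ (i + 1) * y ^ (m - i)) := by
      intro i _
      rw [mul_smul_comm, ← mul_assoc, ← pow_succ']
    have e2 : ∀ i ∈ Finset.range (m + 1),
        y * (gaussBinomial c m i • (x ^ i * y ^ (m - i)))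
          = (c ^ i * gaussBinomial c m i) • (x ^ i * y ^ (m + 1 - i)) := by
      intro i hi
      have hi' : i ≤ m := by simpa [Nat.lt_succ_iff] using hi
      rw [mul_smul_comm, ← mul_assoc, hyx, smul_mul_assoc, mul_assoc, ← pow_succ', smul_smul,
        mul_comm, Nat.sub_add_comm hi']
    rw [Finset.sum_congr rfl e1, Finset.sum_congr rfl e2]
    have e3 : ∑ i ∈ Finset.range (m + 1),
        (c ^ i * gaussBinomial c m i) • (x ^ i * y ^ (m + 1 - i))
        = ∑ i ∈ Finset.range (m + 1),
          (c ^ (i + 1) * gaussBinomial c m (i + 1)) • (x ^ (i + 1) * y ^ (m - i))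
          + y ^ (m + 1) := by
      have := Finset.sum_range_succ
        (fun i => (c ^ i * gaussBinomial c m i) • (x ^ i * y ^ (m + 1 - i))) (m + 1)
      rw [gaussBinomial_eq_zero c m (m + 1) (by omega), mul_zero, zero_smul, add_zero] at this
      rw [← this, Finset.sum_range_succ']
      simp [gaussBinomial_zero_right]
    rw [e3, ← add_assoc, ← Finset.sum_add_distrib]
    congr 1
    · refine Finset.sum_congr rfl fun i _ => ?_
      rw [← add_smul, Nat.add_sub_add_right]
      rfl
    · simp [gaussBinomial_zero_right]

theorem add_pow_of_qcomm_primitive {k A : Type*} [Field k] [Ring A] [Algebra k A] {n : ℕ}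
    [NeZero n] (c : k) (hc : IsPrimitiveRoot c n) (x y : A) (h : y * x = c • (x * y)) :
    (x + y) ^ n = x ^ n + y ^ n := by
  obtain ⟨m, rfl⟩ : ∃ m, n = m + 1 := ⟨n - 1, by have := NeZero.ne n; omega⟩
  rw [add_pow_of_qcomm c x y h, Finset.sum_range_succ, Finset.sum_range_succ',
    Finset.sum_eq_zero]
  · simp [gaussBinomial_zero_right, gaussBinomial_self, add_comm]
  · intro i hi
    have hi' : i < m := by simpa using hi
    have h1 := gaussBinomial_absorb c m i
    rw [hc.pow_eq_one, sub_self, zero_mul] at h1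
    have h2 : (1 : k) - c ^ (i + 1) ≠ 0 := by
      intro h0
      exact hc.pow_ne_one_of_pos_of_lt (by omega) (by omega : i + 1 < m + 1)
        (sub_eq_zero.mp h0).symm
    rw [(mul_eq_zero.mp h1).resolve_left h2, zero_smul]

/-- The three generators. -/
inductive UqGen : Type
  | E
  | F
  | K

/-- The defining relations. Since `K ^ n = 1`, the inverse of `K` is `K ^ (n - 1)`. -/
inductive UqRel {k : Type*} [Field k] (n : ℕ) (q : k) :
    FreeAlgebra k UqGen → FreeAlgebra k UqGen → Prop
  | KE : UqRel n q (FreeAlgebra.ι k UqGen.K * FreeAlgebra.ι k UqGen.E)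
      (q ^ 2 • (FreeAlgebra.ι k UqGen.E * FreeAlgebra.ι k UqGen.K))
  | KF : UqRel n q (FreeAlgebra.ι k UqGen.K * FreeAlgebra.ι k UqGen.F)
      ((q ^ 2)⁻¹ • (FreeAlgebra.ι k UqGen.F * FreeAlgebra.ι k UqGen.K))
  | Kn : UqRel n q (FreeAlgebra.ι k UqGen.K ^ n) 1
  | En : UqRel n q (FreeAlgebra.ι k UqGen.E ^ n) 0
  | Fn : UqRel n q (FreeAlgebra.ι k UqGen.F ^ n) 0
  | EF : UqRel n q
      (FreeAlgebra.ι k UqGen.E * FreeAlgebra.ι k UqGen.F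
        - FreeAlgebra.ι k UqGen.F * FreeAlgebra.ι k UqGen.E)
      ((q - q⁻¹)⁻¹ • (FreeAlgebra.ι k UqGen.K - FreeAlgebra.ι k UqGen.K ^ (n - 1)))

/-- The Frobenius-Lusztig kernel `u_q(sl_2)`, as an algebra. -/
def Uq {k : Type*} [Field k] (n : ℕ) (q : k) : Type _ := RingQuot (UqRel n q)

namespace Uq

section
variable {k : Type*} [Field k] (n : ℕ) (q : k)

noncomputable instance : Ring (Uq n q) := inferInstanceAs (Ring (RingQuot (UqRel n q)))
noncomputable instance : Algebra k (Uq n q) :=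
  inferInstanceAs (Algebra k (RingQuot (UqRel n q)))

/-- The quotient map of the presentation. -/
noncomputable def mk : FreeAlgebra k UqGen →ₐ[k] Uq n q := RingQuot.mkAlgHom k (UqRel n q)

variable {n q} in
theorem mk_rel {x y : FreeAlgebra k UqGen} (h : UqRel n q x y) : mk n q x = mk n q y :=
  RingQuot.mkAlgHom_rel k h

noncomputable def gen (x : UqGen) : Uq n q := mk n q (FreeAlgebra.ι k x)

noncomputable def E : Uq n q := gen n q UqGen.E
noncomputable def F : Uq n q := gen n q UqGen.F
noncomputable def K : Uq n q := gen n q UqGen.K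
/-- The inverse of `K`. -/
noncomputable def Kinv : Uq n q := K n q ^ (n - 1)

theorem K_mul_E : K n q * E n q = q ^ 2 • (E n q * K n q) := by
  have := mk_rel (UqRel.KE (n := n) (q := q))
  simpa only [E, F, K, Kinv, gen, map_mul, map_smul] using this

theorem K_mul_F : K n q * F n q = (q ^ 2)⁻¹ • (F n q * K n q) := by
  have := mk_rel (UqRel.KF (n := n) (q := q))
  simpa only [E, F, K, Kinv, gen, map_mul, map_smul] using this

theorem K_pow : K n q ^ n = 1 := by
  have := mk_rel (UqRel.Kn (n := n) (q := q))
  simpa only [E, F, K, Kinv, gen, map_pow, map_one] using this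

theorem E_pow : E n q ^ n = 0 := by
  have := mk_rel (UqRel.En (n := n) (q := q))
  simpa only [E, F, K, Kinv, gen, map_pow, map_zero] using this

theorem F_pow : F n q ^ n = 0 := by
  have := mk_rel (UqRel.Fn (n := n) (q := q))
  simpa only [E, F, K, Kinv, gen, map_pow, map_zero] using this

theorem EF_sub_FE :
    E n q * F n q - F n q * E n q = (q - q⁻¹)⁻¹ • (K n q - Kinv n q) := by
  have := mk_rel (UqRel.EF (n := n) (q := q))
  simpa only [E, F, K, Kinv, gen, map_mul, map_sub, map_smul, map_pow] using this

theorem K_mul_Kinv [NeZero n] : K n q * Kinv n q = 1 := by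
  rw [Kinv, ← pow_succ', Nat.sub_add_cancel (Nat.one_le_iff_ne_zero.mpr (NeZero.ne n)), K_pow]

theorem Kinv_mul_K [NeZero n] : Kinv n q * K n q = 1 := by
  rw [Kinv, ← pow_succ, Nat.sub_add_cancel (Nat.one_le_iff_ne_zero.mpr (NeZero.ne n)), K_pow]

/-- The universal property of the presentation. -/
noncomputable def lift {A : Type*} [Ring A] [Algebra k A] (e f κ : A)
    (hKE : κ * e = q ^ 2 • (e * κ)) (hKF : κ * f = (q ^ 2)⁻¹ • (f * κ))
    (hK : κ ^ n = 1) (hE : e ^ n = 0) (hF : f ^ n = 0)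
    (hEF : e * f - f * e = (q - q⁻¹)⁻¹ • (κ - κ ^ (n - 1))) : Uq n q →ₐ[k] A :=
  RingQuot.liftAlgHom k ⟨FreeAlgebra.lift k (fun x => match x with
    | UqGen.E => e
    | UqGen.F => f
    | UqGen.K => κ), by
      intro x y h
      cases h <;> simpa only [map_mul, map_sub, map_smul, map_pow, map_one, map_zero,
        FreeAlgebra.lift_ι_apply]⟩

section
variable {A : Type*} [Ring A] [Algebra k A] {e f κ : A}
    (hKE : κ * e = q ^ 2 • (e * κ)) (hKF : κ * f = (q ^ 2)⁻¹ • (f * κ))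
    (hK : κ ^ n = 1) (hE : e ^ n = 0) (hF : f ^ n = 0)
    (hEF : e * f - f * e = (q - q⁻¹)⁻¹ • (κ - κ ^ (n - 1)))

theorem lift_E : lift n q e f κ hKE hKF hK hE hF hEF (E n q) = e := by
  simp only [lift, E, gen, mk]
  erw [RingQuot.liftAlgHom_mkAlgHom_apply]
  simp

theorem lift_F : lift n q e f κ hKE hKF hK hE hF hEF (F n q) = f := by
  simp only [lift, F, gen, mk]
  erw [RingQuot.liftAlgHom_mkAlgHom_apply]
  simp

theorem lift_K : lift n q e f κ hKE hKF hK hE hF hEF (K n q) = κ := by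
  simp only [lift, K, gen, mk]
  erw [RingQuot.liftAlgHom_mkAlgHom_apply]
  simp
end

variable {n q} in
theorem algHom_ext {A : Type*} [Semiring A] [Algebra k A] {φ ψ : Uq n q →ₐ[k] A}
    (hE : φ (E n q) = ψ (E n q)) (hF : φ (F n q) = ψ (F n q)) (hK : φ (K n q) = ψ (K n q)) :
    φ = ψ := by
  apply RingQuot.ringQuot_ext'
  apply FreeAlgebra.hom_ext
  funext x
  cases x
  · exact hE
  · exact hF
  · exact hK

theorem induction {p : Uq n q → Prop} (hE : p (E n q)) (hF : p (F n q)) (hK : p (K n q))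
    (halg : ∀ c : k, p (algebraMap k _ c)) (hadd : ∀ a b, p a → p b → p (a + b))
    (hmul : ∀ a b, p a → p b → p (a * b)) (a : Uq n q) : p a := by
  obtain ⟨x, rfl⟩ : ∃ x, mk n q x = a := RingQuot.mkAlgHom_surjective k (UqRel n q) a
  induction x using FreeAlgebra.induction with
  | grade0 c => simpa only [AlgHom.commutes] using halg c
  | grade1 x =>
    cases x
    · exact hE
    · exact hF
    · exact hK
  | mul a b ha hb => rw [map_mul]; exact hmul _ _ ha hb
  | add a b ha hb => rw [map_add]; exact hadd _ _ ha hb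

theorem mul_Kinv_cancel_right [NeZero n] (a : Uq n q) : a * K n q * Kinv n q = a := by
  rw [mul_assoc, K_mul_Kinv, mul_one]

theorem Kinv_mul_cancel_left [NeZero n] (a : Uq n q) : Kinv n q * (K n q * a) = a := by
  rw [← mul_assoc, Kinv_mul_K, one_mul]

end

section Hopf
variable {k : Type*} [Field k] {n : ℕ} [NeZero n] {q : k}

theorem q_ne_zero (hq : IsPrimitiveRoot q (2 * n)) : q ≠ 0 :=
  hq.ne_zero (mul_ne_zero two_ne_zero (NeZero.ne n))

theorem q_sq_primitive (hq : IsPrimitiveRoot q (2 * n)) : IsPrimitiveRoot (q ^ 2) n :=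
  hq.pow (Nat.pos_of_ne_zero (mul_ne_zero two_ne_zero (NeZero.ne n))) rfl

theorem F_mul_K (hq : IsPrimitiveRoot q (2 * n)) :
    F n q * K n q = q ^ 2 • (K n q * F n q) := by
  rw [K_mul_F, smul_smul, mul_inv_cancel₀ (pow_ne_zero _ (q_ne_zero hq)), one_smul]

theorem E_mul_K (hq : IsPrimitiveRoot q (2 * n)) :
    E n q * K n q = (q ^ 2)⁻¹ • (K n q * E n q) := by
  rw [K_mul_E, smul_smul, inv_mul_cancel₀ (pow_ne_zero _ (q_ne_zero hq)), one_smul]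

theorem Kinv_mul_F (hq : IsPrimitiveRoot q (2 * n)) :
    Kinv n q * F n q = q ^ 2 • (F n q * Kinv n q) := by
  have h := congrArg (fun z => Kinv n q * z * Kinv n q) (F_mul_K (n := n) hq)
  simpa only [mul_smul_comm, smul_mul_assoc, Kinv_mul_cancel_left, ← mul_assoc,
    mul_Kinv_cancel_right, Kinv_mul_K, one_mul] using h

theorem Kinv_mul_E (hq : IsPrimitiveRoot q (2 * n)) :
    Kinv n q * E n q = (q ^ 2)⁻¹ • (E n q * Kinv n q) := by
  have h := congrArg (fun z => Kinv n q * z * Kinv n q) (E_mul_K (n := n) hq)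
  simpa only [mul_smul_comm, smul_mul_assoc, Kinv_mul_cancel_left, ← mul_assoc,
    mul_Kinv_cancel_right, Kinv_mul_K, one_mul] using h

theorem Kinv_pow : Kinv n q ^ n = 1 := by
  rw [Kinv, ← pow_mul, mul_comm, pow_mul, K_pow, one_pow]

theorem Kinv_pow_pred : Kinv n q ^ (n - 1) = K n q := by
  have h : Kinv n q ^ (n - 1) * Kinv n q = 1 := by
    rw [← pow_succ, Nat.sub_add_cancel (Nat.one_le_iff_ne_zero.mpr (NeZero.ne n)), Kinv_pow]
  calc Kinv n q ^ (n - 1) = Kinv n q ^ (n - 1) * (Kinv n q * K n q) := by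
        rw [Kinv_mul_K, mul_one]
    _ = K n q := by rw [← mul_assoc, h, one_mul]

/-- The comultiplication: `K` is grouplike, `Δ E = 1 ⊗ E + E ⊗ K`,
`Δ F = K⁻¹ ⊗ F + F ⊗ 1`. -/
noncomputable def comulHom (hq : IsPrimitiveRoot q (2 * n)) :
    Uq n q →ₐ[k] Uq n q ⊗[k] Uq n q :=
  lift n q (1 ⊗ₜ E n q + E n q ⊗ₜ K n q) (Kinv n q ⊗ₜ F n q + F n q ⊗ₜ 1) (K n q ⊗ₜ K n q)
    (by
      simp only [mul_add, add_mul, Algebra.TensorProduct.tmul_mul_tmul, mul_one, one_mul,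
        K_mul_E, TensorProduct.tmul_smul, smul_add, TensorProduct.smul_tmul'])
    (by
      simp only [mul_add, add_mul, Algebra.TensorProduct.tmul_mul_tmul, mul_one, one_mul,
        K_mul_F, TensorProduct.tmul_smul, smul_add, TensorProduct.smul_tmul', K_mul_Kinv,
        Kinv_mul_K])
    (by rw [Algebra.TensorProduct.tmul_pow, K_pow, Algebra.TensorProduct.one_def])
    (by
      rw [add_pow_of_qcomm_primitive (q ^ 2) (q_sq_primitive hq), Algebra.TensorProduct.tmul_pow,
        Algebra.TensorProduct.tmul_pow, E_pow, TensorProduct.tmul_zero, TensorProduct.zero_tmul,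
        add_zero]
      simp only [Algebra.TensorProduct.tmul_mul_tmul, mul_one, one_mul, K_mul_E,
        TensorProduct.tmul_smul])
    (by
      rw [add_pow_of_qcomm_primitive (q ^ 2)⁻¹ (q_sq_primitive hq).inv,
        Algebra.TensorProduct.tmul_pow,
        Algebra.TensorProduct.tmul_pow, F_pow, TensorProduct.tmul_zero, TensorProduct.zero_tmul,
        add_zero]
      simp only [Algebra.TensorProduct.tmul_mul_tmul, mul_one, one_mul, Kinv_mul_F hq,
        ← TensorProduct.smul_tmul', smul_smul,
        inv_mul_cancel₀ (pow_ne_zero 2 (q_ne_zero hq)), one_smul])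
    (by
      have h : (E n q * Kinv n q) ⊗ₜ[k] (K n q * F n q)
          = (Kinv n q * E n q) ⊗ₜ[k] (F n q * K n q) := by
        rw [Kinv_mul_E hq, F_mul_K hq, TensorProduct.smul_tmul, smul_smul,
          inv_mul_cancel₀ (pow_ne_zero 2 (q_ne_zero hq)), one_smul]
      rw [Algebra.TensorProduct.tmul_pow]
      change _ = (q - q⁻¹)⁻¹ • (K n q ⊗ₜ[k] K n q - Kinv n q ⊗ₜ[k] Kinv n q)
      simp only [mul_add, add_mul, Algebra.TensorProduct.tmul_mul_tmul, mul_one, one_mul, h]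
      have e := EF_sub_FE n q
      have e1 : (E n q * F n q) = F n q * E n q + (q - q⁻¹)⁻¹ • (K n q - Kinv n q) := by
        rw [← e]; abel
      rw [e1]
      simp only [TensorProduct.tmul_add, TensorProduct.add_tmul, TensorProduct.tmul_smul,
        ← TensorProduct.smul_tmul', TensorProduct.tmul_sub, TensorProduct.sub_tmul, smul_sub]
      abel)

/-- The counit. -/
noncomputable def counitHom (hq : IsPrimitiveRoot q (2 * n)) : Uq n q →ₐ[k] k :=
  lift n q 0 0 1 (by simp) (by simp) (by simp) (by simp [NeZero.ne n]) (by simp [NeZero.ne n])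
    (by simp)

section values
variable (hq : IsPrimitiveRoot q (2 * n))

theorem comulHom_E : comulHom hq (E n q) = 1 ⊗ₜ E n q + E n q ⊗ₜ K n q := lift_E ..
theorem comulHom_F : comulHom hq (F n q) = Kinv n q ⊗ₜ F n q + F n q ⊗ₜ 1 := lift_F ..
theorem comulHom_K : comulHom hq (K n q) = K n q ⊗ₜ K n q := lift_K ..
theorem comulHom_Kinv : comulHom hq (Kinv n q) = Kinv n q ⊗ₜ Kinv n q := by
  rw [Kinv, map_pow, comulHom_K, Algebra.TensorProduct.tmul_pow]
theorem counitHom_E : counitHom hq (E n q) = 0 := lift_E ..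
theorem counitHom_F : counitHom hq (F n q) = 0 := lift_F ..
theorem counitHom_K : counitHom hq (K n q) = 1 := lift_K ..
theorem counitHom_Kinv : counitHom hq (Kinv n q) = 1 := by
  rw [Kinv, map_pow, counitHom_K, one_pow]

end values

noncomputable instance [hq : Fact (IsPrimitiveRoot q (2 * n))] : Bialgebra k (Uq n q) :=
  Bialgebra.ofAlgHom (comulHom hq.out) (counitHom hq.out)
    (by
      apply algHom_ext <;>
      simp [comulHom_E, comulHom_F, comulHom_K, comulHom_Kinv,
          TensorProduct.tmul_add, TensorProduct.add_tmul,
          Algebra.TensorProduct.one_def, add_assoc])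
    (by
      apply algHom_ext <;>
      simp [comulHom_E, comulHom_F, comulHom_K,
          counitHom_E, counitHom_F, counitHom_K, counitHom_Kinv])
    (by
      apply algHom_ext <;>
      simp [comulHom_E, comulHom_F, comulHom_K,
          counitHom_E, counitHom_F, counitHom_K])

theorem E_mul_Kinv_pow_smul (hq : IsPrimitiveRoot q (2 * n)) (m : ℕ) :
    ∃ c : k, (E n q * Kinv n q) ^ m = c • (E n q ^ m * Kinv n q ^ m) := by
  have h : ∀ j : ℕ, ∃ c : k, Kinv n q ^ j * E n q = c • (E n q * Kinv n q ^ j) := by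
    intro j
    induction j with
    | zero => exact ⟨1, by simp⟩
    | succ j ih =>
      obtain ⟨c, hc⟩ := ih
      refine ⟨(q ^ 2)⁻¹ * c, ?_⟩
      rw [pow_succ, mul_assoc, Kinv_mul_E hq, mul_smul_comm, ← mul_assoc, hc, smul_mul_assoc,
        smul_smul, mul_assoc]
  induction m with
  | zero => exact ⟨1, by simp⟩
  | succ m ih =>
    obtain ⟨c, hc⟩ := ih
    obtain ⟨d, hd⟩ := h m
    refine ⟨c * d, ?_⟩
    rw [pow_succ, hc, smul_mul_assoc, mul_assoc, ← mul_assoc (Kinv n q ^ m), hd, smul_mul_assoc,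
      mul_smul_comm, smul_smul, pow_succ, pow_succ]
    simp only [mul_assoc]

theorem K_mul_F_pow_smul (m : ℕ) :
    ∃ c : k, (K n q * F n q) ^ m = c • (F n q ^ m * K n q ^ m) := by
  have h : ∀ j : ℕ, ∃ c : k, K n q * F n q ^ j = c • (F n q ^ j * K n q) := by
    intro j
    induction j with
    | zero => exact ⟨1, by simp⟩
    | succ j ih =>
      obtain ⟨c, hc⟩ := ih
      refine ⟨c * (q ^ 2)⁻¹, ?_⟩
      rw [pow_succ, ← mul_assoc, hc, smul_mul_assoc, mul_assoc, K_mul_F, mul_smul_comm,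
        smul_smul, mul_assoc]
  induction m with
  | zero => exact ⟨1, by simp⟩
  | succ m ih =>
    obtain ⟨c, hc⟩ := ih
    obtain ⟨d, hd⟩ := h (m + 1)
    refine ⟨c * d, ?_⟩
    rw [pow_succ', hc, mul_smul_comm, mul_assoc, ← mul_assoc (F n q), ← pow_succ', ← mul_assoc,
      hd, smul_mul_assoc, smul_smul, mul_assoc, ← pow_succ']

open MulOpposite in
/-- The antipode, as an algebra map to the opposite algebra:
`S K = K⁻¹`, `S E = - E K⁻¹`, `S F = - K F`. -/
noncomputable def antipodeHom (hq : IsPrimitiveRoot q (2 * n)) :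
    Uq n q →ₐ[k] (Uq n q)ᵐᵒᵖ :=
  lift n q (op (-(E n q * Kinv n q))) (op (-(K n q * F n q))) (op (Kinv n q))
    (by
      rw [← op_mul, ← op_mul, ← op_smul]
      congr 1
      have h := congrArg (fun z => q ^ 2 • (z * Kinv n q)) (Kinv_mul_E (n := n) hq)
      simp only [smul_mul_assoc, smul_smul, mul_inv_cancel₀ (pow_ne_zero 2 (q_ne_zero hq)),
        one_smul] at h
      simp only [neg_mul, mul_neg, smul_neg, ← mul_assoc, h])
    (by
      rw [← op_mul, ← op_mul, ← op_smul]
      congr 1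
      simp only [neg_mul, mul_neg, smul_neg, Kinv_mul_cancel_left]
      rw [K_mul_F, smul_mul_assoc, mul_Kinv_cancel_right])
    (by rw [← op_pow, Kinv_pow, op_one])
    (by
      obtain ⟨c, hc⟩ := E_mul_Kinv_pow_smul (n := n) hq n
      rw [← op_pow, neg_pow, hc, E_pow]; simp)
    (by
      obtain ⟨c, hc⟩ := K_mul_F_pow_smul (n := n) (q := q) n
      rw [← op_pow, neg_pow, hc, F_pow]; simp)
    (by
      rw [← op_mul, ← op_mul, ← op_pow, ← op_sub, ← op_sub, ← op_smul, Kinv_pow_pred]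
      congr 1
      have h : K n q * F n q * (E n q * Kinv n q) = F n q * E n q := by
        rw [K_mul_F, smul_mul_assoc, mul_assoc, ← mul_assoc (K n q), K_mul_E, smul_mul_assoc,
          mul_Kinv_cancel_right, mul_smul_comm, smul_smul,
          inv_mul_cancel₀ (pow_ne_zero 2 (q_ne_zero hq)), one_smul]
      have h' : E n q * Kinv n q * (K n q * F n q) = E n q * F n q := by
        rw [mul_assoc, Kinv_mul_cancel_left]
      rw [neg_mul_neg, neg_mul_neg, h, h', ← neg_sub, EF_sub_FE, ← smul_neg, neg_sub])

noncomputable instance [hq : Fact (IsPrimitiveRoot q (2 * n))] :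
    HopfAlgebraStruct k (Uq n q) where
  antipode := (MulOpposite.opLinearEquiv k).symm.toLinearMap ∘ₗ (antipodeHom hq.out).toLinearMap

section antipode
variable [hq : Fact (IsPrimitiveRoot q (2 * n))]

theorem comul_E :
    Coalgebra.comul (R := k) (E n q) = 1 ⊗ₜ E n q + E n q ⊗ₜ K n q := comulHom_E hq.out
theorem comul_F :
    Coalgebra.comul (R := k) (F n q) = Kinv n q ⊗ₜ F n q + F n q ⊗ₜ 1 := comulHom_F hq.out
theorem comul_K : Coalgebra.comul (R := k) (K n q) = K n q ⊗ₜ K n q := comulHom_K hq.out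
theorem counit_E : Coalgebra.counit (R := k) (E n q) = 0 := counitHom_E hq.out
theorem counit_F : Coalgebra.counit (R := k) (F n q) = 0 := counitHom_F hq.out
theorem counit_K : Coalgebra.counit (R := k) (K n q) = 1 := counitHom_K hq.out

theorem antipode_E : HopfAlgebra.antipode k (E n q) = -(E n q * Kinv n q) :=
  congrArg MulOpposite.unop (lift_E ..)
theorem antipode_F : HopfAlgebra.antipode k (F n q) = -(K n q * F n q) :=
  congrArg MulOpposite.unop (lift_F ..)
theorem antipode_K : HopfAlgebra.antipode k (K n q) = Kinv n q :=
  congrArg MulOpposite.unop (lift_K ..)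
theorem antipode_mul' (a b : Uq n q) :
    HopfAlgebra.antipode k (a * b) = HopfAlgebra.antipode k b * HopfAlgebra.antipode k a :=
  congrArg MulOpposite.unop (map_mul (antipodeHom hq.out) a b)
theorem antipode_one' : HopfAlgebra.antipode k (1 : Uq n q) = 1 :=
  congrArg MulOpposite.unop (map_one (antipodeHom hq.out))
theorem antipode_Kinv : HopfAlgebra.antipode k (Kinv n q) = K n q := by
  have h : antipodeHom hq.out (Kinv n q) = MulOpposite.op (K n q) := by
    rw [Kinv, map_pow]
    rw [show antipodeHom hq.out (K n q) = MulOpposite.op (Kinv n q) from lift_K ..,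
      ← MulOpposite.op_pow, Kinv_pow_pred]
  exact congrArg MulOpposite.unop h

theorem antipode_left (a : Uq n q) :
    LinearMap.mul' k (Uq n q) ((HopfAlgebra.antipode k).rTensor (Uq n q)
      (Coalgebra.comul (R := k) a)) = algebraMap k (Uq n q) (Coalgebra.counit (R := k) a) := by
  induction a using Uq.induction with
  | hE => simp [comul_E, counit_E, antipode_E, antipode_one', mul_assoc, Kinv_mul_K]
  | hF => simp [comul_F, counit_F, antipode_F, antipode_Kinv]
  | hK => simp [comul_K, counit_K, antipode_K, Kinv_mul_K]
  | halg c =>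
    simp [Algebra.algebraMap_eq_smul_one, Algebra.TensorProduct.one_def, antipode_one']
  | hadd a b ha hb => simp only [map_add, ha, hb]
  | hmul a b ha hb =>
    have key : ∀ x y : Uq n q ⊗[k] Uq n q,
        LinearMap.mul' k (Uq n q) ((HopfAlgebra.antipode k).rTensor (Uq n q) x)
          = algebraMap k (Uq n q) (Coalgebra.counit (R := k) a) →
        LinearMap.mul' k (Uq n q) ((HopfAlgebra.antipode k).rTensor (Uq n q) (x * y))
          = (Coalgebra.counit (R := k) a) •
            LinearMap.mul' k (Uq n q) ((HopfAlgebra.antipode k).rTensor (Uq n q) y) := by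
      intro x y hx
      induction y using TensorProduct.induction_on with
      | zero => simp
      | add y z hy hz => simp only [mul_add, map_add, hy, hz, smul_add]
      | tmul c d =>
        have h : ∀ x : Uq n q ⊗[k] Uq n q,
            LinearMap.mul' k (Uq n q)
              ((HopfAlgebra.antipode k).rTensor (Uq n q) (x * c ⊗ₜ d))
            = HopfAlgebra.antipode k c * LinearMap.mul' k (Uq n q)
              ((HopfAlgebra.antipode k).rTensor (Uq n q) x) * d := by
          intro x
          induction x using TensorProduct.induction_on with
          | zero => simp
          | add x z hx hz => simp only [add_mul, mul_add, map_add, hx, hz]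
          | tmul u v => simp [antipode_mul', mul_assoc]
        rw [h, hx, ← Algebra.commutes, mul_assoc, ← Algebra.smul_def]
        simp
    rw [Bialgebra.comul_mul, key _ _ ha, hb, Bialgebra.counit_mul, map_mul, Algebra.smul_def]

theorem antipode_right (a : Uq n q) :
    LinearMap.mul' k (Uq n q) ((HopfAlgebra.antipode k).lTensor (Uq n q)
      (Coalgebra.comul (R := k) a)) = algebraMap k (Uq n q) (Coalgebra.counit (R := k) a) := by
  induction a using Uq.induction with
  | hE => simp [comul_E, counit_E, antipode_E, antipode_K]
  | hF =>
    simp [comul_F, counit_F, antipode_F, antipode_one', ← mul_assoc, Kinv_mul_K]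
  | hK => simp [comul_K, counit_K, antipode_K, K_mul_Kinv]
  | halg c =>
    simp [Algebra.algebraMap_eq_smul_one, Algebra.TensorProduct.one_def, antipode_one']
  | hadd a b ha hb => simp only [map_add, ha, hb]
  | hmul a b ha hb =>
    have key : ∀ x y : Uq n q ⊗[k] Uq n q,
        LinearMap.mul' k (Uq n q) ((HopfAlgebra.antipode k).lTensor (Uq n q) y)
          = algebraMap k (Uq n q) (Coalgebra.counit (R := k) b) →
        LinearMap.mul' k (Uq n q) ((HopfAlgebra.antipode k).lTensor (Uq n q) (x * y))
          = (Coalgebra.counit (R := k) b) •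
            LinearMap.mul' k (Uq n q) ((HopfAlgebra.antipode k).lTensor (Uq n q) x) := by
      intro x y hy
      induction x using TensorProduct.induction_on with
      | zero => simp
      | add x z hx hz => simp only [add_mul, map_add, hx, hz, smul_add]
      | tmul c d =>
        have h : ∀ y : Uq n q ⊗[k] Uq n q,
            LinearMap.mul' k (Uq n q)
              ((HopfAlgebra.antipode k).lTensor (Uq n q) (c ⊗ₜ d * y))
            = c * LinearMap.mul' k (Uq n q)
              ((HopfAlgebra.antipode k).lTensor (Uq n q) y) * HopfAlgebra.antipode k d := by
          intro y
          induction y using TensorProduct.induction_on with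
          | zero => simp
          | add x z hx hz => simp only [add_mul, mul_add, map_add, hx, hz]
          | tmul u v => simp [antipode_mul', mul_assoc]
        rw [h, hy, ← Algebra.commutes, mul_assoc, ← Algebra.smul_def]
        simp
    rw [Bialgebra.comul_mul, key _ _ hb, ha, Bialgebra.counit_mul, map_mul, Algebra.smul_def,
      Algebra.commutes]

noncomputable instance : HopfAlgebra k (Uq n q) where
  mul_antipode_rTensor_comul := LinearMap.ext antipode_left
  mul_antipode_lTensor_comul := LinearMap.ext antipode_right

end antipode

end Hopf

end Uq

/-! ## Actions of Hopf algebras on algebras -/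

/-- An action of a Hopf algebra `H` on an algebra `A`: a left `H`-module structure on `A` with
`h · (p r) = ∑ (h₁ · p) (h₂ · r)` and `h · 1 = ε(h) 1`. -/
structure HopfAction (k H A : Type*) [Field k] [Ring H] [HopfAlgebra k H] [Ring A]
    [Algebra k A] where
  act : H →ₐ[k] Module.End k A
  act_mul : ∀ (h : H) (p r : A), act h (p * r) =
    TensorProduct.lift ((LinearMap.mul k A).compl₁₂ (act.toLinearMap.flip p)
      (act.toLinearMap.flip r)) (Coalgebra.comul (R := k) h)
  act_one : ∀ h : H, act h 1 = Coalgebra.counit (R := k) h • (1 : A)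

/-! ## Quivers and path algebras -/

/-- A quiver with finitely many vertices. -/
structure Quiv where
  V : Type
  A : Type
  s : A → V
  t : A → V
  [finV : Fintype V]

attribute [instance] Quiv.finV

/-- The relations of the path algebra, on the free algebra on vertices and arrows. -/
inductive PathRel (k : Type*) [Field k] (Q : Quiv) :
    FreeAlgebra k (Q.V ⊕ Q.A) → FreeAlgebra k (Q.V ⊕ Q.A) → Prop
  | sum : PathRel k Q (∑ v : Q.V, FreeAlgebra.ι k (Sum.inl v)) 1
  | idem (v : Q.V) : PathRel k Q
      (FreeAlgebra.ι k (Sum.inl v) * FreeAlgebra.ι k (Sum.inl v)) (FreeAlgebra.ι k (Sum.inl v))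
  | orth (v w : Q.V) (h : v ≠ w) : PathRel k Q
      (FreeAlgebra.ι k (Sum.inl v) * FreeAlgebra.ι k (Sum.inl w)) 0
  | src (a : Q.A) : PathRel k Q
      (FreeAlgebra.ι k (Sum.inl (Q.s a)) * FreeAlgebra.ι k (Sum.inr a))
      (FreeAlgebra.ι k (Sum.inr a))
  | tgt (a : Q.A) : PathRel k Q
      (FreeAlgebra.ι k (Sum.inr a) * FreeAlgebra.ι k (Sum.inl (Q.t a)))
      (FreeAlgebra.ι k (Sum.inr a))

/-- The path algebra; paths are composed from left to right. -/
def PathAlgebra (k : Type*) [Field k] (Q : Quiv) : Type _ := RingQuot (PathRel k Q)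

namespace PathAlgebra
variable (k : Type*) [Field k] {Q : Quiv}

noncomputable instance : Ring (PathAlgebra k Q) := inferInstanceAs (Ring (RingQuot (PathRel k Q)))
noncomputable instance : Algebra k (PathAlgebra k Q) :=
  inferInstanceAs (Algebra k (RingQuot (PathRel k Q)))

/-- The trivial path at `v`. -/
noncomputable def e (v : Q.V) : PathAlgebra k Q :=
  RingQuot.mkAlgHom k (PathRel k Q) (FreeAlgebra.ι k (Sum.inl v))

/-- The arrow `a` as a path of length one. -/
noncomputable def arr (a : Q.A) : PathAlgebra k Q :=
  RingQuot.mkAlgHom k (PathRel k Q) (FreeAlgebra.ι k (Sum.inr a))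

variable (Q) in
/-- The span of the paths of length at most `d`. -/
noncomputable def filt (d : ℕ) : Submodule k (PathAlgebra k Q) :=
  Submodule.span k (Set.range (e k) ∪
    {x | ∃ l : List Q.A, l ≠ [] ∧ l.IsChain (fun a b => Q.t a = Q.s b) ∧ l.length ≤ d ∧
      x = (l.map (arr k)).prod})

end PathAlgebra

/-- The action preserves the path length filtration. -/
def HopfAction.Filtered {k H : Type*} [Field k] [Ring H] [HopfAlgebra k H] {Q : Quiv}
    (α : HopfAction k H (PathAlgebra k Q)) : Prop :=
  ∀ (h : H) (d : ℕ), ∀ x ∈ PathAlgebra.filt k Q d, α.act h x ∈ PathAlgebra.filt k Q d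

/-- Subquivers. -/
structure Quiv.Sub (Q : Quiv) where
  verts : Set Q.V
  arrows : Set Q.A
  src_mem : ∀ a ∈ arrows, Q.s a ∈ verts
  tgt_mem : ∀ a ∈ arrows, Q.t a ∈ verts

noncomputable def Quiv.Sub.toQuiv {Q : Quiv} (P : Q.Sub) : Quiv where
  V := P.verts
  A := P.arrows
  s a := ⟨Q.s a.1, P.src_mem a.1 a.2⟩
  t a := ⟨Q.t a.1, P.tgt_mem a.1 a.2⟩
  finV := Fintype.ofFinite _

/-- The quiver with vertices `1, ..., m` (indices modulo `m`) and no arrows. -/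
def discreteQuiver (m : ℕ) [NeZero m] : Quiv where
  V := ZMod m
  A := Empty
  s := Empty.elim
  t := Empty.elim
  finV := ZMod.fintype m

/-- The complete quiver `K_n`: one arrow from `i` to `j` for all `i ≠ j`. -/
def completeQuiver (n : ℕ) [NeZero n] : Quiv where
  V := ZMod n
  A := {x : ZMod n × ZMod n // x.1 ≠ x.2}
  s a := a.1.1
  t a := a.1.2
  finV := ZMod.fintype n

/-- The complete bipartite quiver `K_{n,n}`: top row `Sum.inl i` (that is, `i_+`), bottom row
`Sum.inr j` (that is, `j_-`), one arrow from `i_+` to `j_-` for all `i, j`. -/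
def bipartiteQuiver (n : ℕ) [NeZero n] : Quiv where
  V := ZMod n ⊕ ZMod n
  A := ZMod n × ZMod n
  s a := Sum.inl a.1
  t a := Sum.inr a.2
  finV := @instFintypeSum _ _ (ZMod.fintype n) (ZMod.fintype n)

/-- Restriction on the scalars of an orbit of vertices. -/
def GammaCond {k : Type*} [Field k] (q γE γF : k) : Prop :=
  -γE * γF * q⁻¹ * (q ^ 2 - 1) ^ 2 = 1

/-! ## Type A -/

section TypeA
variable {n : ℕ} [NeZero n]

/-- Stable under the generator of `ℤ_n`, which adds one to all indices. -/
def StableA (P : (completeQuiver n).Sub) : Prop :=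
  (∀ i : ZMod n, i ∈ P.verts → i + 1 ∈ P.verts) ∧
  ∀ (i j : ZMod n) (h : i ≠ j), (⟨(i, j), h⟩ : {x : ZMod n × ZMod n // x.1 ≠ x.2}) ∈ P.arrows →
    (⟨(i + 1, j + 1), fun h' => h (add_right_cancel h')⟩ :
      {x : ZMod n × ZMod n // x.1 ≠ x.2}) ∈ P.arrows

/-- `a i j` exists in the subquiver, where `a i i` is the trivial path at `i`. -/
def ExA (P : (completeQuiver n).Sub) (i j : ZMod n) : Prop :=
  (i = j ∧ i ∈ P.verts) ∨
    ∃ h : i ≠ j, (⟨(i, j), h⟩ : {x : ZMod n × ZMod n // x.1 ≠ x.2}) ∈ P.arrows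

open Classical in
/-- The arrow `a i j` for `i ≠ j`, the trivial path at `i` for `i = j`, and zero if it does not
exist in the subquiver. -/
noncomputable def pathA (k : Type*) [Field k] (P : (completeQuiver n).Sub) (i j : ZMod n) :
    PathAlgebra k P.toQuiv :=
  if h : i = j then
    if hi : i ∈ P.verts then PathAlgebra.e k (Q := P.toQuiv) ⟨i, hi⟩ else 0
  else
    if ha : (⟨(i, j), h⟩ : {x : ZMod n × ZMod n // x.1 ≠ x.2}) ∈ P.arrows then
      PathAlgebra.arr k (Q := P.toQuiv) ⟨⟨(i, j), h⟩, ha⟩ else 0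

/-- The scalars `γ^E, γ^F, λ^E_{i,j}, λ^F_{i,j}`. -/
structure ParamsA (k : Type*) (n : ℕ) where
  γE : k
  γF : k
  lE : ZMod n → ZMod n → k
  lF : ZMod n → ZMod n → k

structure ParamsA.Admissible {k : Type*} [Field k] (q : k) (P : (completeQuiver n).Sub)
    (p : ParamsA k n) : Prop where
  gamma : GammaCond q p.γE p.γF
  lE_zero : ∀ i j, ExA P i j → (i = j ∨ ¬ ExA P i (j + 1)) → p.lE i j = 0
  lF_zero : ∀ i j, ExA P i j → (i = j ∨ ¬ ExA P (i - 1) j) → p.lF i j = 0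
  lE_shift : ∀ i j, ExA P i j → p.lE (i + 1) (j + 1) = (q ^ 2)⁻¹ * p.lE i j
  lF_shift : ∀ i j, ExA P i j → p.lF (i + 1) (j + 1) = q ^ 2 * p.lF i j
  comm : ∀ i j, ExA P i j → p.lF i j * p.lE (i - 1) j = p.lE i j * p.lF i (j + 1)

variable {k : Type*} [Field k] {q : k} [Fact (IsPrimitiveRoot q (2 * n))]

/-- `K` adds one to the indices of the family `a`. -/
def KShiftsA {P : (completeQuiver n).Sub} (α : HopfAction k (Uq n q) (PathAlgebra k P.toQuiv))
    (a : ZMod n → ZMod n → PathAlgebra k P.toQuiv) : Prop :=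
  ∀ i j, ExA P i j → α.act (Uq.K n q) (a i j) = a (i + 1) (j + 1)

/-- The formulas for `E` and `F` on the family `a`. -/
def FormulasA {P : (completeQuiver n).Sub} (α : HopfAction k (Uq n q) (PathAlgebra k P.toQuiv))
    (a : ZMod n → ZMod n → PathAlgebra k P.toQuiv) (p : ParamsA k n) : Prop :=
  ∀ i j, ExA P i j →
    α.act (Uq.E n q) (a i j) =
      p.γE • (q ^ (-2 * (j.val : ℤ)) • a i j
        - q ^ (-2 * (i.val : ℤ) - 2) • a (i + 1) (j + 1))
      + p.lE i j • a i (j + 1) ∧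
    α.act (Uq.F n q) (a i j) =
      p.γF • (q ^ (2 * (j.val : ℤ)) • a (i - 1) (j - 1)
        - q ^ (2 * (i.val : ℤ) + 2) • a i j)
      + p.lF i j • a (i - 1) j

end TypeA

/-! ## Type B -/

section TypeB
variable {n : ℕ} [NeZero n]

/-- Stable under the generator of `ℤ_n`, which adds one to all indices. -/
def StableB (P : (bipartiteQuiver n).Sub) : Prop :=
  (∀ i : ZMod n, (Sum.inl i : ZMod n ⊕ ZMod n) ∈ P.verts →
    (Sum.inl (i + 1) : ZMod n ⊕ ZMod n) ∈ P.verts) ∧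
  (∀ j : ZMod n, (Sum.inr j : ZMod n ⊕ ZMod n) ∈ P.verts →
    (Sum.inr (j + 1) : ZMod n ⊕ ZMod n) ∈ P.verts) ∧
  ∀ i j : ZMod n, ((i, j) : ZMod n × ZMod n) ∈ P.arrows →
    ((i + 1, j + 1) : ZMod n × ZMod n) ∈ P.arrows

/-- The arrow `b i j` exists in the subquiver. -/
def ExB (P : (bipartiteQuiver n).Sub) (i j : ZMod n) : Prop :=
  ((i, j) : ZMod n × ZMod n) ∈ P.arrows

open Classical in
/-- The trivial path at `v`, and zero if `v` is not in the subquiver. -/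
noncomputable def vertB (k : Type*) [Field k] (P : (bipartiteQuiver n).Sub)
    (v : ZMod n ⊕ ZMod n) : PathAlgebra k P.toQuiv :=
  if hv : v ∈ P.verts then PathAlgebra.e k (Q := P.toQuiv) ⟨v, hv⟩ else 0

open Classical in
/-- The arrow `b i j`, and zero if it is not in the subquiver. -/
noncomputable def arrB (k : Type*) [Field k] (P : (bipartiteQuiver n).Sub)
    (i j : ZMod n) : PathAlgebra k P.toQuiv :=
  if ha : ((i, j) : ZMod n × ZMod n) ∈ P.arrows then
    PathAlgebra.arr k (Q := P.toQuiv) ⟨(i, j), ha⟩ else 0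

/-- The scalars `γ^E_+, γ^E_-, γ^F_+, γ^F_-, λ^E_{i,j}, λ^F_{i,j}`. -/
structure ParamsB (k : Type*) (n : ℕ) where
  γEp : k
  γEm : k
  γFp : k
  γFm : k
  lE : ZMod n → ZMod n → k
  lF : ZMod n → ZMod n → k

structure ParamsB.Admissible {k : Type*} [Field k] (q : k) (P : (bipartiteQuiver n).Sub)
    (p : ParamsB k n) : Prop where
  gamma_plus : GammaCond q p.γEp p.γFp
  gamma_minus : GammaCond q p.γEm p.γFm
  lE_zero : ∀ i j, ExB P i j → ¬ ExB P i (j + 1) → p.lE i j = 0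
  lF_zero : ∀ i j, ExB P i j → ¬ ExB P (i - 1) j → p.lF i j = 0
  lE_shift : ∀ i j, ExB P i j → p.lE (i + 1) (j + 1) = (q ^ 2)⁻¹ * p.lE i j
  lF_shift : ∀ i j, ExB P i j → p.lF (i + 1) (j + 1) = q ^ 2 * p.lF i j
  comm : ∀ i j, ExB P i j → p.lF i j * p.lE (i - 1) j = p.lE i j * p.lF i (j + 1)
  powE : ∀ i j, ExB P i j →
    p.γEp ^ n = p.γEm ^ n + ∏ l ∈ Finset.range n, p.lE i (j + (l : ZMod n))
  powF : ∀ i j, ExB P i j →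
    p.γFp ^ n = p.γFm ^ n + ∏ l ∈ Finset.range n, p.lF i (j + (l : ZMod n))

variable {k : Type*} [Field k] {q : k} [Fact (IsPrimitiveRoot q (2 * n))]

/-- `K` adds one to the indices of the trivial paths. -/
def KShiftsVertB {P : (bipartiteQuiver n).Sub}
    (α : HopfAction k (Uq n q) (PathAlgebra k P.toQuiv)) : Prop :=
  (∀ i : ZMod n, (Sum.inl i : ZMod n ⊕ ZMod n) ∈ P.verts →
    α.act (Uq.K n q) (vertB k P (Sum.inl i)) = vertB k P (Sum.inl (i + 1))) ∧
  (∀ j : ZMod n, (Sum.inr j : ZMod n ⊕ ZMod n) ∈ P.verts →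
    α.act (Uq.K n q) (vertB k P (Sum.inr j)) = vertB k P (Sum.inr (j + 1)))

/-- `K` adds one to the indices of the family `b`. -/
def KShiftsB {P : (bipartiteQuiver n).Sub} (α : HopfAction k (Uq n q) (PathAlgebra k P.toQuiv))
    (b : ZMod n → ZMod n → PathAlgebra k P.toQuiv) : Prop :=
  ∀ i j, ExB P i j → α.act (Uq.K n q) (b i j) = b (i + 1) (j + 1)

/-- The formulas for `E` and `F` on an orbit `v` of trivial paths. -/
def FormulasVert {Q : Quiv} (α : HopfAction k (Uq n q) (PathAlgebra k Q))
    (v : ZMod n → PathAlgebra k Q) (γE γF : k) (i : ZMod n) : Prop :=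
  α.act (Uq.E n q) (v i) =
    (γE * q ^ (-2 * (i.val : ℤ))) • (v i - (q ^ 2)⁻¹ • v (i + 1)) ∧
  α.act (Uq.F n q) (v i) =
    (γF * q ^ (2 * (i.val : ℤ))) • (v (i - 1) - q ^ 2 • v i)

/-- The formulas for `E` and `F` on the trivial paths and on the family `b`. -/
def FormulasB {P : (bipartiteQuiver n).Sub} (α : HopfAction k (Uq n q) (PathAlgebra k P.toQuiv))
    (b : ZMod n → ZMod n → PathAlgebra k P.toQuiv) (p : ParamsB k n) : Prop :=
  (∀ i : ZMod n, (Sum.inl i : ZMod n ⊕ ZMod n) ∈ P.verts →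
    FormulasVert α (fun l => vertB k P (Sum.inl l)) p.γEp p.γFp i) ∧
  (∀ j : ZMod n, (Sum.inr j : ZMod n ⊕ ZMod n) ∈ P.verts →
    FormulasVert α (fun l => vertB k P (Sum.inr l)) p.γEm p.γFm j) ∧
  ∀ i j, ExB P i j →
    α.act (Uq.E n q) (b i j) =
      (p.γEm * q ^ (-2 * (j.val : ℤ))) • b i j
      - (p.γEp * q ^ (-2 * (i.val : ℤ) - 2)) • b (i + 1) (j + 1)
      + p.lE i j • b i (j + 1) ∧
    α.act (Uq.F n q) (b i j) =
      (p.γFm * q ^ (2 * (j.val : ℤ))) • b (i - 1) (j - 1)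
      - (p.γFp * q ^ (2 * (i.val : ℤ) + 2)) • b i j
      + p.lF i j • b (i - 1) j

end TypeB

/-! ## Path algebras: presentation, generators and filtration -/

namespace PathAlgebra
variable {k : Type*} [Field k] {Q : Quiv}

/-! An action of `u_q(sl_2)` amounts to three operators: `K` acts by an algebra automorphism, `E` by
a skew derivation twisted by `K` on the right, and `F` by a skew derivation twisted by `K⁻¹` on the
left. Such operators are determined by their values on trivial paths and arrows. Conversely,
compatible values on generators extend, because a skew derivation is the off-diagonal entry of an
algebra map into upper triangular matrices (`PathAlgebra.exists_skew`). The defining relations also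
need checking only on generators (`HopfAction.exists_of_gens`): for `E ^ n` and `F ^ n` this is the
q-binomial theorem applied to the two q-commuting summands of the comultiplication.

Necessity for vertices. Applying `E` to `e_i e_i = e_i` and `e_{i+1} e_i = 0` leaves one scalar per
vertex, and `KE = q²EK` makes these scalars a geometric progression around the orbit. An orbit of
length `m` with `2 ≤ m < n` cannot close up unless they vanish, since `(q²)^m ≠ 1`. An orbit of
length `n` leaves one free scalar for `E` and one for `F`, and comparing coefficients in `EF - FE`
gives (*) as soon as `e_{i+1}` and `e_{i-1}` differ, that is for `n ≥ 3`.

Necessity for arrows. For an arrow `b` with source `s` and target `t`, the product rule on `b = s b`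
and on `b = b t` determines `E b` up to its component from the source of `b` to the shifted target.
That component of the filtration is at most one-dimensional and gives `λ^E`; likewise for `F`. The
relations then become conditions on the scalars (`HopfAction.exists_gridFamily`).

The conditions on `n`-th powers come from `GridFamily.E_pow` and `GridFamily.F_pow`: on a grid of
arrows `E` is a sum of three pairwise q²-commuting weighted shifts, so `E ^ n` is the sum of their
`n`-th powers, and each of these is a scalar. In the complete quiver the condition is automatic:
source and target lie in the same orbit, so the `γ` terms cancel, and the product of the `λ` along a
row contains the factor `λ_{i,i} = 0`.

The same computations prove sufficiency, once missing arrows are read as zero and the scalars are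
extended by zero. Rescaling arrows to make `K` a pure shift is possible because `K ^ n = 1` makes
the product of the scalars around each orbit equal to one (`exists_rescaling`). -/

theorem mk_rel {x y : FreeAlgebra k (Q.V ⊕ Q.A)} (h : PathRel k Q x y) :
    RingQuot.mkAlgHom k (PathRel k Q) x = RingQuot.mkAlgHom k (PathRel k Q) y :=
  RingQuot.mkAlgHom_rel k h

theorem sum_e : ∑ v : Q.V, e k v = 1 := by
  have := mk_rel (PathRel.sum (k := k) (Q := Q))
  rw [map_sum, map_one] at this
  exact this

theorem e_mul_self (v : Q.V) : e k v * e k v = e k v := by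
  have := mk_rel (PathRel.idem (k := k) (Q := Q) v)
  rw [map_mul] at this
  exact this

theorem e_mul_e_of_ne {v w : Q.V} (h : v ≠ w) : e k v * e k w = 0 := by
  have := mk_rel (PathRel.orth (k := k) (Q := Q) v w h)
  rw [map_mul, map_zero] at this
  exact this

theorem e_src_mul_arr (a : Q.A) : e k (Q.s a) * arr k a = arr k a := by
  have := mk_rel (PathRel.src (k := k) (Q := Q) a)
  rw [map_mul] at this
  exact this

theorem arr_mul_e_tgt (a : Q.A) : arr k a * e k (Q.t a) = arr k a := by
  have := mk_rel (PathRel.tgt (k := k) (Q := Q) a)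
  rw [map_mul] at this
  exact this

theorem e_mul_arr_of_ne {v : Q.V} {a : Q.A} (h : v ≠ Q.s a) : e k v * arr k a = 0 := by
  rw [← e_src_mul_arr, ← mul_assoc, e_mul_e_of_ne h, zero_mul]

theorem arr_mul_e_of_ne {v : Q.V} {a : Q.A} (h : Q.t a ≠ v) : arr k a * e k v = 0 := by
  rw [← arr_mul_e_tgt, mul_assoc, e_mul_e_of_ne h, mul_zero]

section lift
variable {B : Type*} [Ring B] [Algebra k B] (v : Q.V → B) (a : Q.A → B)
  (hsum : ∑ x, v x = 1) (hidem : ∀ x, v x * v x = v x)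
  (horth : ∀ x y, x ≠ y → v x * v y = 0)
  (hsrc : ∀ x, v (Q.s x) * a x = a x) (htgt : ∀ x, a x * v (Q.t x) = a x)

/-- The universal property of the path algebra. -/
noncomputable def lift : PathAlgebra k Q →ₐ[k] B :=
  RingQuot.liftAlgHom k ⟨FreeAlgebra.lift k (Sum.elim v a), by
    intro x y h
    cases h with
    | sum => simpa using hsum
    | idem w => simpa using hidem w
    | orth w w' h => simpa using horth w w' h
    | src b => simpa using hsrc b
    | tgt b => simpa using htgt b⟩

theorem lift_e (x : Q.V) : lift v a hsum hidem horth hsrc htgt (e k x) = v x := by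
  simp only [lift, e]
  erw [RingQuot.liftAlgHom_mkAlgHom_apply]
  simp

theorem lift_arr (x : Q.A) : lift v a hsum hidem horth hsrc htgt (arr k x) = a x := by
  simp only [lift, arr]
  erw [RingQuot.liftAlgHom_mkAlgHom_apply]
  simp

end lift

variable (k Q) in
/-- The trivial paths and the arrows. -/
def gens : Set (PathAlgebra k Q) := Set.range (e k) ∪ Set.range (arr k)

theorem induction {p : PathAlgebra k Q → Prop} (hgen : ∀ x ∈ gens k Q, p x)
    (halg : ∀ c : k, p (algebraMap k _ c)) (hadd : ∀ a b, p a → p b → p (a + b))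
    (hmul : ∀ a b, p a → p b → p (a * b)) (a : PathAlgebra k Q) : p a := by
  obtain ⟨x, rfl⟩ : ∃ x, RingQuot.mkAlgHom k (PathRel k Q) x = a :=
    RingQuot.mkAlgHom_surjective k (PathRel k Q) a
  induction x using FreeAlgebra.induction with
  | grade0 c => rw [AlgHom.commutes]; exact halg c
  | grade1 x =>
    cases x with
    | inl v => exact hgen _ (Or.inl ⟨v, rfl⟩)
    | inr b => exact hgen _ (Or.inr ⟨b, rfl⟩)
  | mul a b ha hb => rw [map_mul]; exact hmul _ _ ha hb
  | add a b ha hb => rw [map_add]; exact hadd _ _ ha hb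

/-- A linear map vanishes if it vanishes on generators and its kernel is closed under products. -/
theorem linearMap_eq_zero {M : Type*} [AddCommGroup M] [Module k M] (R : PathAlgebra k Q →ₗ[k] M)
    (hmul : ∀ a b, R a = 0 → R b = 0 → R (a * b) = 0) (hgen : ∀ x ∈ gens k Q, R x = 0) :
    R = 0 := by
  -- The unit is the sum of the trivial paths, so scalars need no hypothesis of their own.
  have h1 : R 1 = 0 := by
    rw [← sum_e, map_sum]
    exact Finset.sum_eq_zero fun v _ => hgen _ (Or.inl ⟨v, rfl⟩)
  ext x
  induction x using induction with
  | hgen x hx => exact hgen x hx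
  | halg c => rw [Algebra.algebraMap_eq_smul_one, map_smul, h1, smul_zero, LinearMap.zero_apply]
  | hadd a b ha hb => rw [map_add, ha, hb, LinearMap.zero_apply]; simp
  | hmul a b ha hb => exact hmul a b ha hb

/-! ### The filtration -/

theorem e_mem_filt (v : Q.V) (d : ℕ) : e k v ∈ filt k Q d :=
  Submodule.subset_span (Or.inl ⟨v, rfl⟩)

theorem arr_mem_filt (a : Q.A) {d : ℕ} (hd : 1 ≤ d) : arr k a ∈ filt k Q d :=
  Submodule.subset_span (Or.inr ⟨[a], by simp, by simp, by simpa using hd, by simp⟩)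

theorem filt_mono {d d' : ℕ} (h : d ≤ d') : filt k Q d ≤ filt k Q d' := by
  refine Submodule.span_mono ?_
  rintro x (hx | ⟨l, h1, h2, h3, h4⟩)
  · exact Or.inl hx
  · exact Or.inr ⟨l, h1, h2, h3.trans h, h4⟩

theorem one_mem_filt (d : ℕ) : (1 : PathAlgebra k Q) ∈ filt k Q d := by
  rw [← sum_e]
  exact Submodule.sum_mem _ fun v _ => e_mem_filt v d

theorem filt_zero : filt k Q 0 = Submodule.span k (Set.range (e k)) := by
  refine le_antisymm (Submodule.span_le.mpr ?_) (Submodule.span_mono Set.subset_union_left)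
  rintro x (hx | ⟨l, h1, -, h3, -⟩)
  · exact Submodule.subset_span hx
  · exact absurd (List.length_eq_zero_iff.mp (Nat.le_zero.mp h3)) h1

theorem filt_one : filt k Q 1 = Submodule.span k (gens k Q) := by
  refine le_antisymm (Submodule.span_le.mpr ?_) (Submodule.span_le.mpr ?_)
  · rintro x (hx | ⟨l, h1, -, h3, rfl⟩)
    · exact Submodule.subset_span (Or.inl hx)
    · match l, h1, h3 with
      | [a], _, _ => exact Submodule.subset_span (Or.inr ⟨a, by simp⟩)
  · rintro x (⟨v, rfl⟩ | ⟨a, rfl⟩)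
    · exact e_mem_filt v 1
    · exact arr_mem_filt a le_rfl

/-- Multiplying a path by an arrow. -/
theorem arr_mul_mem_filt (a : Q.A) {d : ℕ} {x : PathAlgebra k Q} (hx : x ∈ filt k Q d) :
    arr k a * x ∈ filt k Q (d + 1) := by
  induction hx using Submodule.span_induction with
  | mem x hx =>
    rcases hx with ⟨v, rfl⟩ | ⟨l, h1, h2, h3, rfl⟩
    · by_cases h : Q.t a = v
      · rw [← h, arr_mul_e_tgt]
        exact arr_mem_filt a (by omega)
      · rw [arr_mul_e_of_ne h]
        exact Submodule.zero_mem _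
    · match l, h1 with
      | b :: l, _ =>
        by_cases h : Q.t a = Q.s b
        · exact Submodule.subset_span (Or.inr ⟨a :: b :: l, by simp,
            List.isChain_cons_cons.mpr ⟨h, h2⟩, by simpa using h3, by simp⟩)
        · rw [List.map_cons, List.prod_cons, ← mul_assoc, ← e_src_mul_arr b, ← mul_assoc,
            arr_mul_e_of_ne h, zero_mul, zero_mul]
          exact Submodule.zero_mem _
  | zero => rw [mul_zero]; exact Submodule.zero_mem _
  | add x y _ _ hx hy => rw [mul_add]; exact Submodule.add_mem _ hx hy
  | smul c x _ hx => rw [mul_smul_comm]; exact Submodule.smul_mem _ _ hx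

theorem e_mul_mem_filt (v : Q.V) {d : ℕ} {x : PathAlgebra k Q} (hx : x ∈ filt k Q d) :
    e k v * x ∈ filt k Q d := by
  induction hx using Submodule.span_induction with
  | mem x hx =>
    rcases hx with ⟨w, rfl⟩ | ⟨l, h1, h2, h3, rfl⟩
    · by_cases h : v = w
      · rw [h, e_mul_self]
        exact e_mem_filt w d
      · rw [e_mul_e_of_ne h]
        exact Submodule.zero_mem _
    · match l, h1 with
      | b :: l, _ =>
        by_cases h : v = Q.s b
        · rw [List.map_cons, List.prod_cons, ← mul_assoc, h, e_src_mul_arr]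
          exact Submodule.subset_span (Or.inr ⟨b :: l, by simp, h2, h3, by simp⟩)
        · rw [List.map_cons, List.prod_cons, ← mul_assoc, e_mul_arr_of_ne h, zero_mul]
          exact Submodule.zero_mem _
  | zero => rw [mul_zero]; exact Submodule.zero_mem _
  | add x y _ _ hx hy => rw [mul_add]; exact Submodule.add_mem _ hx hy
  | smul c x _ hx => rw [mul_smul_comm]; exact Submodule.smul_mem _ _ hx

theorem path_mul_mem_filt (l : List Q.A) {d : ℕ} {x : PathAlgebra k Q} (hx : x ∈ filt k Q d) :
    (l.map (arr k)).prod * x ∈ filt k Q (l.length + d) := by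
  induction l with
  | nil => simpa using hx
  | cons a l ih =>
    rw [List.map_cons, List.prod_cons, mul_assoc, List.length_cons,
      show l.length + 1 + d = l.length + d + 1 by ring]
    exact arr_mul_mem_filt a ih

theorem mul_mem_filt {d d' : ℕ} {x y : PathAlgebra k Q} (hx : x ∈ filt k Q d)
    (hy : y ∈ filt k Q d') : x * y ∈ filt k Q (d + d') := by
  induction hx using Submodule.span_induction with
  | mem x hx =>
    rcases hx with ⟨w, rfl⟩ | ⟨l, -, -, h3, rfl⟩
    · exact filt_mono (by omega) (e_mul_mem_filt w hy)
    · exact filt_mono (by omega) (path_mul_mem_filt l hy)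
  | zero => rw [zero_mul]; exact Submodule.zero_mem _
  | add x y _ _ hx hy => rw [add_mul]; exact Submodule.add_mem _ hx hy
  | smul c x _ hx => rw [smul_mul_assoc]; exact Submodule.smul_mem _ _ hx

/-- A skew derivation preserves the filtration as soon as this holds on the generators. -/
theorem skew_mem_filt {φ ψ : PathAlgebra k Q →ₗ[k] PathAlgebra k Q}
    {D : PathAlgebra k Q →ₗ[k] PathAlgebra k Q}
    (hD : ∀ a b, D (a * b) = φ a * D b + D a * ψ b)
    (he : ∀ v, D (e k v) ∈ filt k Q 0) (ha : ∀ a, D (arr k a) ∈ filt k Q 1)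
    (hφ : ∀ a, φ (arr k a) ∈ filt k Q 1)
    (hψ : ∀ d, ∀ x ∈ filt k Q d, ψ x ∈ filt k Q d)
    (d : ℕ) (x : PathAlgebra k Q) (hx : x ∈ filt k Q d) : D x ∈ filt k Q d := by
  -- Composability of the arrows plays no role: the filtration is multiplicative on arbitrary
  -- products, since non-composable ones vanish. The nonempty lists are enough because the
  -- filtration lists trivial paths separately.
  have key : ∀ l : List Q.A, l ≠ [] → D ((l.map (arr k)).prod) ∈ filt k Q l.length ∧
      (l.map (arr k)).prod ∈ filt k Q l.length := by
    intro l hl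
    induction l with
    | nil => exact absurd rfl hl
    | cons a l ih =>
      by_cases hl' : l = []
      · subst hl'
        simpa using ⟨ha a, arr_mem_filt a le_rfl⟩
      · obtain ⟨h1, h2⟩ := ih hl'
        rw [List.map_cons, List.prod_cons, hD, List.length_cons, add_comm l.length]
        exact ⟨Submodule.add_mem _ (mul_mem_filt (hφ a) h1) (mul_mem_filt (ha a) (hψ _ _ h2)),
          mul_mem_filt (arr_mem_filt a le_rfl) h2⟩
  induction hx using Submodule.span_induction with
  | mem x hx =>
    rcases hx with ⟨w, rfl⟩ | ⟨l, h1, -, h3, rfl⟩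
    · exact filt_mono (Nat.zero_le d) (he w)
    · exact filt_mono h3 (key l h1).1
  | zero => rw [map_zero]; exact Submodule.zero_mem _
  | add x y _ _ hx hy => rw [map_add]; exact Submodule.add_mem _ hx hy
  | smul c x _ hx => rw [map_smul]; exact Submodule.smul_mem _ _ hx

/-- An algebra map is a skew derivation whose left twist is the map itself and whose right twist is
zero. -/
theorem algHom_mem_filt {φ : PathAlgebra k Q →ₐ[k] PathAlgebra k Q}
    (he : ∀ v, φ (e k v) ∈ filt k Q 0) (ha : ∀ a, φ (arr k a) ∈ filt k Q 1)
    (d : ℕ) (x : PathAlgebra k Q) (hx : x ∈ filt k Q d) : φ x ∈ filt k Q d :=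
  skew_mem_filt (φ := φ.toLinearMap) (ψ := 0) (D := φ.toLinearMap) (by simp) he ha ha
    (fun d x _ => by simp) d x hx

/-! ### Skew derivations -/

/-- Skew derivations of the path algebra are determined by compatible values on generators. -/
theorem exists_skew {B : Type*} [Ring B] [Algebra k B] (φ ψ : PathAlgebra k Q →ₐ[k] B)
    (dv : Q.V → B) (da : Q.A → B)
    (hsum : ∑ v, dv v = 0)
    (hidem : ∀ v, φ (e k v) * dv v + dv v * ψ (e k v) = dv v)
    (horth : ∀ v w, v ≠ w → φ (e k v) * dv w + dv v * ψ (e k w) = 0)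
    (hsrc : ∀ a, φ (e k (Q.s a)) * da a + dv (Q.s a) * ψ (arr k a) = da a)
    (htgt : ∀ a, φ (arr k a) * dv (Q.t a) + da a * ψ (e k (Q.t a)) = da a) :
    ∃ D : PathAlgebra k Q →ₗ[k] B, (∀ a b, D (a * b) = φ a * D b + D a * ψ b) ∧
      (∀ v, D (e k v) = dv v) ∧ ∀ a, D (arr k a) = da a := by
  -- The product rule is the multiplication rule for the upper right entry of a triangular matrix
  -- with diagonal `φ`, `ψ`. The five hypotheses are exactly the path algebra relations read in that
  -- entry.
  let Φ : PathAlgebra k Q →ₐ[k] Matrix (Fin 2) (Fin 2) B :=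
    lift (fun v => !![φ (e k v), dv v; 0, ψ (e k v)])
      (fun a => !![φ (arr k a), da a; 0, ψ (arr k a)])
      (by
        have h : ∀ χ : PathAlgebra k Q →ₐ[k] B, ∑ v, χ (e k v) = 1 := fun χ => by
          rw [← map_sum, sum_e, map_one]
        ext i j
        rw [Matrix.sum_apply]
        fin_cases i <;> fin_cases j <;> simp [h, hsum])
      (fun v => by simp [hidem, ← map_mul, e_mul_self])
      (fun v w hvw => by
        rw [Matrix.mul_fin_two, ← map_mul, e_mul_e_of_ne hvw, horth v w hvw, mul_zero, zero_mul,
          zero_mul, mul_zero, ← map_mul, e_mul_e_of_ne hvw]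
        ext i j
        fin_cases i <;> fin_cases j <;> simp)
      (fun a => by simp [hsrc, ← map_mul, e_src_mul_arr])
      (fun a => by simp [htgt, ← map_mul, arr_mul_e_tgt])
  have hΦe : ∀ v, Φ (e k v) = !![φ (e k v), dv v; 0, ψ (e k v)] := fun v => lift_e ..
  have hΦa : ∀ a, Φ (arr k a) = !![φ (arr k a), da a; 0, ψ (arr k a)] := fun a => lift_arr ..
  have hent : ∀ x, Φ x 0 0 = φ x ∧ Φ x 1 0 = 0 ∧ Φ x 1 1 = ψ x := by
    intro x
    induction x using induction with
    | hgen x hx =>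
      rcases hx with ⟨v, rfl⟩ | ⟨a, rfl⟩
      · simp [hΦe]
      · simp [hΦa]
    | halg c => simp [Matrix.algebraMap_matrix_apply]
    | hadd a b ha hb => simp [ha, hb]
    | hmul a b ha hb => simp [Matrix.mul_apply, ha, hb]
  refine ⟨{ toFun := fun x => Φ x 0 1
            map_add' := fun x y => by simp
            map_smul' := fun c x => by simp }, ?_, ?_, ?_⟩
  · intro a b
    simp [Matrix.mul_apply, hent]
  · intro v
    simp [hΦe]
  · intro a
    simp [hΦa]

end PathAlgebra

/-! ## Actions of `u_q(sl_2)` through three operators -/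

namespace HopfAction
section
variable {k : Type*} [Field k] {n : ℕ} [NeZero n] {q : k} [hq : Fact (IsPrimitiveRoot q (2 * n))]
  {A : Type*} [Ring A] [Algebra k A]

theorem act_K_mul (α : HopfAction k (Uq n q) A) (x y : A) :
    α.act (Uq.K n q) (x * y) = α.act (Uq.K n q) x * α.act (Uq.K n q) y := by
  rw [α.act_mul, Uq.comul_K]
  simp

theorem act_E_mul (α : HopfAction k (Uq n q) A) (x y : A) :
    α.act (Uq.E n q) (x * y)
      = x * α.act (Uq.E n q) y + α.act (Uq.E n q) x * α.act (Uq.K n q) y := by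
  rw [α.act_mul, Uq.comul_E]
  simp

theorem act_F_mul (α : HopfAction k (Uq n q) A) (x y : A) :
    α.act (Uq.F n q) (x * y)
      = α.act (Uq.Kinv n q) x * α.act (Uq.F n q) y + α.act (Uq.F n q) x * y := by
  rw [α.act_mul, Uq.comul_F]
  simp

theorem act_K_one (α : HopfAction k (Uq n q) A) : α.act (Uq.K n q) 1 = 1 := by
  rw [α.act_one, Uq.counit_K, one_smul]

theorem act_E_one (α : HopfAction k (Uq n q) A) : α.act (Uq.E n q) 1 = 0 := by
  rw [α.act_one, Uq.counit_E, zero_smul]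

theorem act_F_one (α : HopfAction k (Uq n q) A) : α.act (Uq.F n q) 1 = 0 := by
  rw [α.act_one, Uq.counit_F, zero_smul]

theorem act_K_act_E (α : HopfAction k (Uq n q) A) (x : A) :
    α.act (Uq.K n q) (α.act (Uq.E n q) x)
      = q ^ 2 • α.act (Uq.E n q) (α.act (Uq.K n q) x) := by
  simpa using congrArg (fun h => α.act h x) (Uq.K_mul_E n q)

theorem act_K_act_F (α : HopfAction k (Uq n q) A) (x : A) :
    α.act (Uq.K n q) (α.act (Uq.F n q) x)
      = (q ^ 2)⁻¹ • α.act (Uq.F n q) (α.act (Uq.K n q) x) := by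
  simpa using congrArg (fun h => α.act h x) (Uq.K_mul_F n q)

theorem act_EF_sub_FE (α : HopfAction k (Uq n q) A) (x : A) :
    α.act (Uq.E n q) (α.act (Uq.F n q) x) - α.act (Uq.F n q) (α.act (Uq.E n q) x)
      = (q - q⁻¹)⁻¹ • (α.act (Uq.K n q) x - α.act (Uq.Kinv n q) x) := by
  simpa using congrArg (fun h => α.act h x) (Uq.EF_sub_FE n q)

theorem act_Kinv_act_K (α : HopfAction k (Uq n q) A) (x : A) :
    α.act (Uq.Kinv n q) (α.act (Uq.K n q) x) = x := by
  simpa using congrArg (fun h => α.act h x) (Uq.Kinv_mul_K n q)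

theorem ext_act {α β : HopfAction k (Uq n q) A}
    (hE : α.act (Uq.E n q) = β.act (Uq.E n q)) (hF : α.act (Uq.F n q) = β.act (Uq.F n q))
    (hK : α.act (Uq.K n q) = β.act (Uq.K n q)) : α = β := by
  have h : α.act = β.act := Uq.algHom_ext hE hF hK
  cases α
  cases β
  simp only at h
  subst h
  rfl

/-- Turns a power of an operator on the algebra into a power of an operator on the tensor square,
where the q-binomial theorem applies. -/
theorem pow_comp_mul' {e : Module.End k A} {D : Module.End k (A ⊗[k] A)}
    (h : e ∘ₗ LinearMap.mul' k A = LinearMap.mul' k A ∘ₗ D) (m : ℕ) :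
    (e ^ m) ∘ₗ LinearMap.mul' k A = LinearMap.mul' k A ∘ₗ D ^ m := by
  induction m with
  | zero => rfl
  | succ m ih =>
    rw [pow_succ, pow_succ', Module.End.mul_eq_comp, Module.End.mul_eq_comp, LinearMap.comp_assoc,
      h, ← LinearMap.comp_assoc, ih, LinearMap.comp_assoc, ← Module.End.mul_eq_comp,
      ← Module.End.mul_eq_comp, ← pow_succ, ← pow_succ']

/-- Three operators that satisfy the relations and the product rules define an action. -/
theorem exists_of_operators (κ : A →ₐ[k] A) (e f : Module.End k A)
    (hKE : κ.toLinearMap * e = q ^ 2 • (e * κ.toLinearMap))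
    (hKF : κ.toLinearMap * f = (q ^ 2)⁻¹ • (f * κ.toLinearMap))
    (hK : κ.toLinearMap ^ n = 1) (hE : e ^ n = 0) (hF : f ^ n = 0)
    (hEF : e * f - f * e = (q - q⁻¹)⁻¹ • (κ.toLinearMap - κ.toLinearMap ^ (n - 1)))
    (he : ∀ a b, e (a * b) = a * e b + e a * κ b)
    (hf : ∀ a b, f (a * b) = (κ.toLinearMap ^ (n - 1)) a * f b + f a * b) :
    ∃ α : HopfAction k (Uq n q) A, α.act (Uq.K n q) = κ.toLinearMap ∧
      α.act (Uq.E n q) = e ∧ α.act (Uq.F n q) = f := by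
  let act : Uq n q →ₐ[k] Module.End k A := Uq.lift n q e f κ.toLinearMap hKE hKF hK hE hF hEF
  have aE : act (Uq.E n q) = e := Uq.lift_E ..
  have aF : act (Uq.F n q) = f := Uq.lift_F ..
  have aK : act (Uq.K n q) = κ.toLinearMap := Uq.lift_K ..
  have aKi : act (Uq.Kinv n q) = κ.toLinearMap ^ (n - 1) := by rw [Uq.Kinv, map_pow, aK]
  let act2 : Uq n q ⊗[k] Uq n q →ₐ[k] Module.End k (A ⊗[k] A) :=
    (Module.endTensorEndAlgHom (R := k) (S := k) (A := k) (M := A) (N := A)).comp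
      (Algebra.TensorProduct.map act act)
  have act2_tmul : ∀ x y p r, act2 (x ⊗ₜ y) (p ⊗ₜ r) = act x p ⊗ₜ act y r := by
    intro x y p r
    simp only [act2, AlgHom.comp_apply, Algebra.TensorProduct.map_tmul]
    rfl
  -- Phrased as multiplication intertwining two actions of the Hopf algebra, the product rule is
  -- closed under products of Hopf algebra elements, so generators suffice.
  have key : ∀ h, act h ∘ₗ LinearMap.mul' k A
      = LinearMap.mul' k A ∘ₗ act2 (Coalgebra.comul (R := k) h) := by
    intro h
    induction h using Uq.induction with
    | hE => ext p r; simp [Uq.comul_E, act2_tmul, aE, aK, he]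
    | hF => ext p r; simp [Uq.comul_F, act2_tmul, aF, aKi, hf]
    | hK => ext p r; simp [Uq.comul_K, act2_tmul, aK]
    | halg c =>
      ext p r
      simp [Algebra.algebraMap_eq_smul_one]
    | hadd a b ha hb =>
      rw [map_add, map_add, map_add, LinearMap.add_comp, LinearMap.comp_add, ha, hb]
    | hmul a b ha hb =>
      rw [Bialgebra.comul_mul, map_mul, map_mul, Module.End.mul_eq_comp, Module.End.mul_eq_comp,
        LinearMap.comp_assoc, hb, ← LinearMap.comp_assoc, ha, LinearMap.comp_assoc]
  have e1 : e 1 = 0 := by simpa using he 1 1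
  have f1 : f 1 = 0 := by
    have h := hf 1 1
    have h' : (κ.toLinearMap ^ (n - 1)) (1 : A) = 1 := by
      rw [Module.End.coe_pow]
      exact Function.iterate_fixed (map_one κ) _
    rw [h'] at h
    simpa using h
  refine ⟨⟨act, fun h p r => ?_, fun h => ?_⟩, aK, aE, aF⟩
  · have h1 := LinearMap.congr_fun (key h) (p ⊗ₜ r)
    rw [LinearMap.comp_apply, LinearMap.mul'_apply] at h1
    rw [h1]
    induction (Coalgebra.comul (R := k) h : Uq n q ⊗[k] Uq n q) using
      TensorProduct.induction_on with
    | zero => simp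
    | tmul x y => simp [act2_tmul]
    | add x y hx hy => simp only [map_add, LinearMap.add_apply, LinearMap.comp_apply,
        LinearMap.comp_add] at hx hy ⊢; rw [hx, hy]
  · induction h using Uq.induction with
    | hE => simp [aE, e1, Uq.counit_E]
    | hF => simp [aF, f1, Uq.counit_F]
    | hK => simp [aK, Uq.counit_K]
    | halg c => rw [AlgHom.commutes, Bialgebra.counit_algebraMap, Module.algebraMap_end_apply]
    | hadd a b ha hb => simp [ha, hb, add_smul]
    | hmul a b ha hb =>
      rw [map_mul, Module.End.mul_apply, hb, map_smul, ha, Bialgebra.counit_mul, smul_smul,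
        mul_comm]

end

section PathAlgebra
variable {k : Type*} [Field k] {n : ℕ} [NeZero n] {q : k} [hq : Fact (IsPrimitiveRoot q (2 * n))]
  {Q : Quiv}

/-- An action on a path algebra is determined by the values of `E`, `F`, `K` on generators. -/
theorem ext_gens {α β : HopfAction k (Uq n q) (PathAlgebra k Q)}
    (h : ∀ x ∈ PathAlgebra.gens k Q, α.act (Uq.K n q) x = β.act (Uq.K n q) x ∧
      α.act (Uq.E n q) x = β.act (Uq.E n q) x ∧ α.act (Uq.F n q) x = β.act (Uq.F n q) x) :
    α = β := by
  have hK : α.act (Uq.K n q) = β.act (Uq.K n q) := by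
    rw [← sub_eq_zero]
    refine PathAlgebra.linearMap_eq_zero _ (fun a b ha hb => ?_) fun x hx => ?_
    · rw [LinearMap.sub_apply, sub_eq_zero] at ha hb ⊢
      rw [act_K_mul, act_K_mul, ha, hb]
    · rw [LinearMap.sub_apply, (h x hx).1, sub_self]
  have hKi : α.act (Uq.Kinv n q) = β.act (Uq.Kinv n q) := by
    rw [Uq.Kinv, map_pow, map_pow, hK]
  refine ext_act ?_ ?_ hK
  · rw [← sub_eq_zero]
    refine PathAlgebra.linearMap_eq_zero _ (fun a b ha hb => ?_) fun x hx => ?_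
    · rw [LinearMap.sub_apply, sub_eq_zero] at ha hb ⊢
      rw [act_E_mul, act_E_mul, ha, hb, hK]
    · rw [LinearMap.sub_apply, (h x hx).2.1, sub_self]
  · rw [← sub_eq_zero]
    refine PathAlgebra.linearMap_eq_zero _ (fun a b ha hb => ?_) fun x hx => ?_
    · rw [LinearMap.sub_apply, sub_eq_zero] at ha hb ⊢
      rw [act_F_mul, act_F_mul, ha, hb, hKi]
    · rw [LinearMap.sub_apply, (h x hx).2.2, sub_self]

/-- Operators on a path algebra that satisfy the product rules define an action as soon as the
relations hold on the generators. -/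
theorem exists_of_gens (κ : PathAlgebra k Q →ₐ[k] PathAlgebra k Q)
    (e f : Module.End k (PathAlgebra k Q))
    (he : ∀ a b, e (a * b) = a * e b + e a * κ b)
    (hf : ∀ a b, f (a * b) = (κ.toLinearMap ^ (n - 1)) a * f b + f a * b)
    (hK : ∀ x ∈ PathAlgebra.gens k Q, (κ.toLinearMap ^ n) x = x)
    (hKE : ∀ x ∈ PathAlgebra.gens k Q, κ (e x) = q ^ 2 • e (κ x))
    (hKF : ∀ x ∈ PathAlgebra.gens k Q, κ (f x) = (q ^ 2)⁻¹ • f (κ x))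
    (hE : ∀ x ∈ PathAlgebra.gens k Q, (e ^ n) x = 0)
    (hF : ∀ x ∈ PathAlgebra.gens k Q, (f ^ n) x = 0)
    (hEF : ∀ x ∈ PathAlgebra.gens k Q,
      e (f x) - f (e x) = (q - q⁻¹)⁻¹ • (κ x - (κ.toLinearMap ^ (n - 1)) x)) :
    ∃ α : HopfAction k (Uq n q) (PathAlgebra k Q), α.act (Uq.K n q) = κ.toLinearMap ∧
      α.act (Uq.E n q) = e ∧ α.act (Uq.F n q) = f := by
  have hq0 : (q ^ 2) ≠ 0 := pow_ne_zero 2 (Uq.q_ne_zero hq.out)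
  have hcp := Uq.q_sq_primitive hq.out
  set κi : Module.End k (PathAlgebra k Q) := κ.toLinearMap ^ (n - 1) with hκi
  have powmul : ∀ m a b, (κ.toLinearMap ^ m) (a * b)
      = (κ.toLinearMap ^ m) a * (κ.toLinearMap ^ m) b := by
    intro m a b
    induction m with
    | zero => simp
    | succ m ih => rw [pow_succ', Module.End.mul_apply, ih]; simp
  have hKn : κ.toLinearMap ^ n = 1 := by
    rw [← sub_eq_zero]
    refine PathAlgebra.linearMap_eq_zero _ (fun a b ha hb => ?_) fun x hx => ?_
    · rw [LinearMap.sub_apply, sub_eq_zero] at ha hb ⊢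
      rw [powmul, ha, hb]
      simp
    · rw [LinearMap.sub_apply, hK x hx, Module.End.one_apply, sub_self]
  have h1n : n - 1 + 1 = n := Nat.sub_add_cancel (Nat.one_le_iff_ne_zero.mpr (NeZero.ne n))
  have hκκi : κ.toLinearMap * κi = 1 := by rw [hκi, ← pow_succ', h1n, hKn]
  have hκiκ : κi * κ.toLinearMap = 1 := by rw [hκi, ← pow_succ, h1n, hKn]
  have hKE' : κ.toLinearMap * e = q ^ 2 • (e * κ.toLinearMap) := by
    rw [← sub_eq_zero]
    refine PathAlgebra.linearMap_eq_zero _ (fun a b ha hb => ?_) fun x hx => ?_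
    · simp only [LinearMap.sub_apply, sub_eq_zero, Module.End.mul_apply, LinearMap.smul_apply,
        AlgHom.toLinearMap_apply] at ha hb ⊢
      simp only [he, map_add, map_mul, ha, hb, smul_add, mul_smul_comm, smul_mul_assoc]
    · simp [hKE x hx]
  have hKF' : κ.toLinearMap * f = (q ^ 2)⁻¹ • (f * κ.toLinearMap) := by
    have hc : ∀ x, κ (κi x) = κi (κ x) := fun x => by
      have := LinearMap.congr_fun (hκκi.trans hκiκ.symm) x
      simpa using this
    rw [← sub_eq_zero]
    refine PathAlgebra.linearMap_eq_zero _ (fun a b ha hb => ?_) fun x hx => ?_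
    · simp only [LinearMap.sub_apply, sub_eq_zero, Module.End.mul_apply, LinearMap.smul_apply,
        AlgHom.toLinearMap_apply] at ha hb ⊢
      simp only [hf, map_add, map_mul, ha, hb, smul_add, mul_smul_comm, smul_mul_assoc, hc]
    · simp [hKF x hx]
  have hfK : f * κ.toLinearMap = q ^ 2 • (κ.toLinearMap * f) := by
    rw [hKF', smul_smul, mul_inv_cancel₀ hq0, one_smul]
  have hKiF : κi * f = q ^ 2 • (f * κi) := by
    have h := congrArg (fun z => κi * z * κi) hfK
    simp only [mul_smul_comm, smul_mul_assoc] at h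
    rw [← mul_assoc, mul_assoc _ _ κi, hκκi, mul_one, ← mul_assoc κi, hκiκ, one_mul] at h
    exact h
  have hKiE : κi * e = (q ^ 2)⁻¹ • (e * κi) := by
    have h := congrArg (fun z => (q ^ 2)⁻¹ • (κi * z * κi)) hKE'
    simp only [mul_smul_comm, smul_mul_assoc] at h
    rw [← mul_assoc, hκiκ, one_mul, smul_smul, inv_mul_cancel₀ hq0, one_smul, ← mul_assoc,
      mul_assoc _ _ κi, hκκi, mul_one] at h
    exact h.symm
  refine exists_of_operators κ e f hKE' hKF' hKn ?_ ?_ ?_ he hf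
  rotate_left 2
  · rw [← hκi, ← sub_eq_zero]
    refine PathAlgebra.linearMap_eq_zero _ (fun a b ha hb => ?_) fun x hx => ?_
    · have h1 : κi (e a) = (q ^ 2)⁻¹ • e (κi a) := by simpa using LinearMap.congr_fun hKiE a
      have h2 : f (κ b) = q ^ 2 • κ (f b) := by simpa using LinearMap.congr_fun hfK b
      simp only [LinearMap.sub_apply, sub_eq_zero, Module.End.mul_apply, LinearMap.smul_apply,
        AlgHom.toLinearMap_apply] at ha hb ⊢
      have ha' : e (f a) = f (e a) + (q - q⁻¹)⁻¹ • (κ a - κi a) := by rw [← ha]; abel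
      have hb' : e (f b) = f (e b) + (q - q⁻¹)⁻¹ • (κ b - κi b) := by rw [← hb]; abel
      have hκm : κi (a * b) = κi a * κi b := powmul _ a b
      simp only [he, hf, map_add, map_mul, ha', hb', h1, h2, hκm, smul_mul_assoc, mul_smul_comm,
        smul_smul, mul_inv_cancel₀ hq0, one_smul, mul_add, add_mul, mul_sub,
        sub_mul, smul_sub]
      abel
    · simp [hEF x hx]
  -- The two summands q²-commute, so with `κ ^ n = 1` the `n`-th power of `e` is an ordinary
  -- derivation; it vanishes on a product when it vanishes on both factors.
  · have h0 : e ∘ₗ LinearMap.mul' k _ = LinearMap.mul' k _ ∘ₗ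
        (TensorProduct.map 1 e + TensorProduct.map e κ.toLinearMap) := by
      ext a b
      simp [he]
    have h1 := pow_comp_mul' h0 n
    rw [add_pow_of_qcomm_primitive (q ^ 2) hcp, TensorProduct.map_pow, TensorProduct.map_pow,
      one_pow, hKn] at h1
    · refine PathAlgebra.linearMap_eq_zero _ (fun a b ha hb => ?_) hE
      simpa [ha, hb] using LinearMap.congr_fun h1 (a ⊗ₜ b)
    · rw [← TensorProduct.map_mul, ← TensorProduct.map_mul, hKE', TensorProduct.map_smul_right,
        mul_one, one_mul]
  -- The summands are listed in this order so that the commutation constant is `q²` and not its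
  -- inverse.
  · have h0 : f ∘ₗ LinearMap.mul' k _ = LinearMap.mul' k _ ∘ₗ
        (TensorProduct.map f 1 + TensorProduct.map κi f) := by
      ext a b
      simp [hf, add_comm]
    have h1 := pow_comp_mul' h0 n
    rw [add_pow_of_qcomm_primitive (q ^ 2) hcp, TensorProduct.map_pow, TensorProduct.map_pow,
      one_pow] at h1
    · refine PathAlgebra.linearMap_eq_zero _ (fun a b ha hb => ?_) hF
      simpa [ha, hb] using LinearMap.congr_fun h1 (a ⊗ₜ b)
    · rw [← TensorProduct.map_mul, ← TensorProduct.map_mul, hKiF, TensorProduct.map_smul_left,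
        mul_one, one_mul]

open PathAlgebra in
/-- An action preserves the filtration if `E`, `F`, `K` preserve it on generators. -/
theorem filtered_of_gens {α : HopfAction k (Uq n q) (PathAlgebra k Q)}
    (hKe : ∀ v, α.act (Uq.K n q) (e k v) ∈ filt k Q 0)
    (hKa : ∀ a, α.act (Uq.K n q) (arr k a) ∈ filt k Q 1)
    (hEe : ∀ v, α.act (Uq.E n q) (e k v) ∈ filt k Q 0)
    (hEa : ∀ a, α.act (Uq.E n q) (arr k a) ∈ filt k Q 1)
    (hFe : ∀ v, α.act (Uq.F n q) (e k v) ∈ filt k Q 0)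
    (hFa : ∀ a, α.act (Uq.F n q) (arr k a) ∈ filt k Q 1) : α.Filtered := by
  have hK : ∀ d, ∀ x ∈ filt k Q d, α.act (Uq.K n q) x ∈ filt k Q d :=
    fun d x hx => algHom_mem_filt
      (φ := AlgHom.ofLinearMap (α.act (Uq.K n q)) α.act_K_one α.act_K_mul) hKe hKa d x hx
  have hKi : ∀ d, ∀ x ∈ filt k Q d, α.act (Uq.Kinv n q) x ∈ filt k Q d := by
    intro d x hx
    have h : ∀ m, (α.act (Uq.K n q) ^ m) x ∈ filt k Q d := by
      intro m
      induction m with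
      | zero => exact hx
      | succ m ih => rw [pow_succ', Module.End.mul_apply]; exact hK d _ ih
    rw [Uq.Kinv, map_pow]
    exact h _
  intro h
  induction h using Uq.induction with
  | hE => exact skew_mem_filt (φ := LinearMap.id) (ψ := α.act (Uq.K n q)) α.act_E_mul
            hEe hEa (fun a => arr_mem_filt a le_rfl) hK
  | hF => exact skew_mem_filt (φ := α.act (Uq.Kinv n q)) (ψ := LinearMap.id) α.act_F_mul
            hFe hFa (fun a => hKi _ _ (arr_mem_filt a le_rfl)) (fun _ _ hx => hx)
  | hK => exact hK
  | halg c =>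
    intro d x hx
    rw [AlgHom.commutes, Module.algebraMap_end_apply]
    exact Submodule.smul_mem _ _ hx
  | hadd a b ha hb =>
    intro d x hx
    rw [map_add, LinearMap.add_apply]
    exact Submodule.add_mem _ (ha d x hx) (hb d x hx)
  | hmul a b ha hb =>
    intro d x hx
    rw [map_mul, Module.End.mul_apply]
    exact ha d _ (hb d x hx)

end PathAlgebra
end HopfAction

/-! ## Powers of `q` indexed by residues -/

section qpow
variable {k : Type*} [Field k] {n : ℕ} [NeZero n] {q : k}

/-- The character `i ↦ q ^ (2 i)` of `ℤ / n`. -/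
def qpow (q : k) (i : ZMod n) : k := (q ^ 2) ^ i.val

theorem pow_half_order (hq : IsPrimitiveRoot q (2 * n)) : q ^ n = -1 := by
  have h1 : q ^ n * q ^ n = 1 := by rw [← pow_add, ← two_mul, hq.pow_eq_one]
  refine (mul_self_eq_one_iff.mp h1).resolve_left fun h => ?_
  have := NeZero.pos n
  exact hq.pow_ne_one_of_pos_of_lt (NeZero.ne n) (by omega) h

theorem qpow_add_natCast (hq : IsPrimitiveRoot q (2 * n)) (i : ZMod n) (l : ℕ) :
    qpow q (i + (l : ZMod n)) = qpow q i * (q ^ 2) ^ l := by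
  have h : (q ^ 2) ^ n = 1 := (Uq.q_sq_primitive hq).pow_eq_one
  rw [qpow, qpow, ZMod.val_add, ZMod.val_natCast, Nat.add_mod_mod, ← pow_eq_pow_mod _ h, pow_add]

theorem qpow_add_one (hq : IsPrimitiveRoot q (2 * n)) (i : ZMod n) :
    qpow q (i + 1) = q ^ 2 * qpow q i := by
  have := qpow_add_natCast hq i 1
  rw [Nat.cast_one, pow_one] at this
  rw [this, mul_comm]

theorem qpow_sub_one (hq : IsPrimitiveRoot q (2 * n)) (i : ZMod n) :
    qpow q (i - 1) = (q ^ 2)⁻¹ * qpow q i := by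
  have h := qpow_add_one hq (i - 1)
  rw [sub_add_cancel] at h
  rw [h, ← mul_assoc, inv_mul_cancel₀ (pow_ne_zero 2 (Uq.q_ne_zero hq)), one_mul]

theorem qpow_ne_zero (hq : IsPrimitiveRoot q (2 * n)) (i : ZMod n) : qpow q i ≠ 0 :=
  pow_ne_zero _ (pow_ne_zero _ (Uq.q_ne_zero hq))

theorem qpow_pow (hq : IsPrimitiveRoot q (2 * n)) (i : ZMod n) : qpow q i ^ n = 1 := by
  rw [qpow, ← pow_mul, mul_comm, pow_mul, (Uq.q_sq_primitive hq).pow_eq_one, one_pow]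

/-- The total exponent of `q` is `2 (0 + ... + (n - 1)) = n (n - 1)`, and `q ^ n = -1`. -/
theorem prod_range_pow (hq : IsPrimitiveRoot q (2 * n)) :
    ∏ l ∈ Finset.range n, (q ^ 2) ^ l = (-1) ^ (n - 1) := by
  rw [Finset.prod_pow_eq_pow_sum, ← pow_mul, mul_comm, Finset.sum_range_id_mul_two, pow_mul,
    pow_half_order hq]

theorem prod_qpow_add (hq : IsPrimitiveRoot q (2 * n)) (i : ZMod n) :
    ∏ l ∈ Finset.range n, qpow q (i + (l : ZMod n)) = (-1) ^ (n - 1) := by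
  simp_rw [qpow_add_natCast hq]
  rw [Finset.prod_mul_distrib, Finset.prod_const, Finset.card_range, qpow_pow hq, one_mul,
    prod_range_pow hq]

omit [NeZero n] in
theorem zpow_two_mul_val (i : ZMod n) : q ^ (2 * (i.val : ℤ)) = qpow q i := by
  rw [qpow, zpow_mul, zpow_natCast]
  norm_cast

omit [NeZero n] in
theorem zpow_neg_two_mul_val (i : ZMod n) : q ^ (-2 * (i.val : ℤ)) = (qpow q i)⁻¹ := by
  rw [neg_mul, zpow_neg, zpow_two_mul_val]

omit [NeZero n] in
theorem zpow_two_mul_val_add (hq0 : q ≠ 0) (i : ZMod n) :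
    q ^ (2 * (i.val : ℤ) + 2) = qpow q i * q ^ 2 := by
  rw [zpow_add₀ hq0, zpow_two_mul_val]
  norm_cast

omit [NeZero n] in
theorem zpow_neg_two_mul_val_sub (hq0 : q ≠ 0) (i : ZMod n) :
    q ^ (-2 * (i.val : ℤ) - 2) = (qpow q i)⁻¹ * (q ^ 2)⁻¹ := by
  rw [zpow_sub₀ hq0, zpow_neg_two_mul_val, div_eq_mul_inv]
  norm_cast

theorem sq_sub_one_ne_zero (hn : 2 ≤ n) (hq : IsPrimitiveRoot q (2 * n)) : q ^ 2 - 1 ≠ 0 :=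
  sub_ne_zero.mpr ((Uq.q_sq_primitive hq).ne_one (by omega))

theorem sub_inv_eq (hq : IsPrimitiveRoot q (2 * n)) : q - q⁻¹ = q⁻¹ * (q ^ 2 - 1) := by
  have := Uq.q_ne_zero hq
  field_simp

/-- This is the shape in which (*) appears in the commutator of `E` and `F`: there the product of
the two scalars is accompanied by one factor `q ^ 2 - 1`. -/
theorem gammaCond_iff (hn : 2 ≤ n) (hq : IsPrimitiveRoot q (2 * n)) (x y : k) :
    GammaCond q x y ↔ x * y * (q ^ 2 - 1) = -(q - q⁻¹)⁻¹ := by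
  have h0 := Uq.q_ne_zero hq
  have h1 := sq_sub_one_ne_zero hn hq
  rw [GammaCond, sub_inv_eq hq]
  field_simp
  constructor <;> intro h <;> linear_combination -h

/-- Supplies scalars for an orbit of vertices that is absent from the subquiver, where the action
imposes nothing but (*) is still demanded. -/
theorem exists_gammaCond (hn : 2 ≤ n) (hq : IsPrimitiveRoot q (2 * n)) :
    ∃ x y : k, GammaCond q x y := by
  have h1 := sq_sub_one_ne_zero hn hq
  refine ⟨1, -(q - q⁻¹)⁻¹ * (q ^ 2 - 1)⁻¹, (gammaCond_iff hn hq _ _).mpr ?_⟩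
  rw [one_mul, mul_assoc, inv_mul_cancel₀ h1, mul_one]

end qpow

/-- Since `y` q-commutes with `x` and with `z` by the same constant, it q-commutes with `x + z`; the
two-term formula then applies twice. -/
theorem add_add_pow_of_qcomm_primitive {k A : Type*} [Field k] [Ring A] [Algebra k A] {n : ℕ}
    [NeZero n] (c : k) (hc : IsPrimitiveRoot c n) (x z y : A) (hzx : z * x = c • (x * z))
    (hyx : y * x = c • (x * y)) (hyz : y * z = c • (z * y)) :
    (x + z + y) ^ n = x ^ n + z ^ n + y ^ n := by
  rw [add_pow_of_qcomm_primitive c hc, add_pow_of_qcomm_primitive c hc x z hzx]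
  rw [mul_add, add_mul, smul_add, hyx, hyz]

/-! ## Weighted shifts -/

section WeightedShift
variable {k : Type*} [Field k] {ι : Type*}

/-- The operator that sends the basis vector at `p` to `w p` times the basis vector at `g p`. -/
noncomputable def weightedShift (w : ι → k) (g : ι → ι) : Module.End k (ι →₀ k) :=
  Finsupp.linearCombination k fun p => w p • Finsupp.single (g p) (1 : k)

theorem weightedShift_single (w : ι → k) (g : ι → ι) (p : ι) :
    weightedShift w g (Finsupp.single p 1) = w p • Finsupp.single (g p) 1 := by
  rw [weightedShift, Finsupp.linearCombination_single, one_smul]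

theorem finsupp_end_ext {M : Type*} [AddCommGroup M] [Module k M] {x y : (ι →₀ k) →ₗ[k] M}
    (h : ∀ p, x (Finsupp.single p 1) = y (Finsupp.single p 1)) : x = y :=
  Finsupp.lhom_ext' fun p => LinearMap.ext_ring (h p)

theorem weightedShift_pow_single (w : ι → k) (g : ι → ι) (m : ℕ) (p : ι) :
    (weightedShift w g ^ m) (Finsupp.single p 1)
      = (∏ l ∈ Finset.range m, w (g^[l] p)) • Finsupp.single (g^[m] p) 1 := by
  induction m with
  | zero => simp
  | succ m ih =>
    rw [pow_succ', Module.End.mul_apply, ih, map_smul, weightedShift_single, smul_smul,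
      Finset.prod_range_succ, Function.iterate_succ_apply']

theorem weightedShift_qcomm {c : k} {w w' : ι → k} {g g' : ι → ι}
    (hg : ∀ p, g' (g p) = g (g' p)) (hw : ∀ p, w p * w' (g p) = c * (w' p * w (g' p))) :
    weightedShift w' g' * weightedShift w g = c • (weightedShift w g * weightedShift w' g') := by
  refine finsupp_end_ext fun p => ?_
  rw [LinearMap.smul_apply, Module.End.mul_apply, Module.End.mul_apply, weightedShift_single,
    weightedShift_single, map_smul, map_smul, weightedShift_single, weightedShift_single,
    smul_smul, smul_smul, smul_smul, hg, hw, mul_assoc]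

end WeightedShift

/-! ## Families on a grid -/

theorem shift_pow_apply {k : Type*} [Field k] {n : ℕ} {M : Type*}
    [AddCommGroup M] [Module k M] {κ : Module.End k M} {b : ZMod n → ZMod n → M}
    (h : ∀ i j, κ (b i j) = b (i + 1) (j + 1)) (m : ℕ) (i j : ZMod n) :
    (κ ^ m) (b i j) = b (i + m) (j + m) := by
  induction m with
  | zero => simp
  | succ m ih => rw [pow_succ', Module.End.mul_apply, ih, h]; push_cast; simp only [add_assoc]

theorem shift_pow_pred_apply {k : Type*} [Field k] {n : ℕ} [NeZero n] {M : Type*}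
    [AddCommGroup M] [Module k M] {κ : Module.End k M} {b : ZMod n → ZMod n → M}
    (h : ∀ i j, κ (b i j) = b (i + 1) (j + 1)) (i j : ZMod n) :
    (κ ^ (n - 1)) (b i j) = b (i - 1) (j - 1) := by
  rw [shift_pow_apply h, Nat.cast_sub (NeZero.pos n)]
  simp [sub_eq_add_neg]

/-- A family `b` on which `K`, `E`, `F` act by the formulas for arrows. -/
structure GridFamily {k : Type*} [Field k] {n : ℕ} [NeZero n] (q : k) {M : Type*}
    [AddCommGroup M] [Module k M] (κ e f : Module.End k M) (b : ZMod n → ZMod n → M)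
    (p : ParamsB k n) : Prop where
  hK : ∀ i j, κ (b i j) = b (i + 1) (j + 1)
  hE : ∀ i j, e (b i j) = (p.γEm * (qpow q j)⁻¹) • b i j
    - (p.γEp * ((qpow q i)⁻¹ * (q ^ 2)⁻¹)) • b (i + 1) (j + 1) + p.lE i j • b i (j + 1)
  hF : ∀ i j, f (b i j) = (p.γFm * qpow q j) • b (i - 1) (j - 1)
    - (p.γFp * (qpow q i * q ^ 2)) • b i j + p.lF i j • b (i - 1) j
  lE_shift : ∀ i j, p.lE (i + 1) (j + 1) = (q ^ 2)⁻¹ * p.lE i j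
  lF_shift : ∀ i j, p.lF (i + 1) (j + 1) = q ^ 2 * p.lF i j

namespace GridFamily
variable {k : Type*} [Field k] {n : ℕ} [NeZero n] {q : k} {M : Type*}
    [AddCommGroup M] [Module k M] {κ e f : Module.End k M} {b : ZMod n → ZMod n → M}
    {p : ParamsB k n}

theorem K_pow_card (h : GridFamily q κ e f b p) (i j : ZMod n) : (κ ^ n) (b i j) = b i j := by
  rw [shift_pow_apply h.hK]; simp

theorem K_pow_pred (h : GridFamily q κ e f b p) (i j : ZMod n) :
    (κ ^ (n - 1)) (b i j) = b (i - 1) (j - 1) :=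
  shift_pow_pred_apply h.hK i j

variable (hq : IsPrimitiveRoot q (2 * n))
include hq

theorem lE_sub (h : GridFamily q κ e f b p) (i j : ZMod n) :
    p.lE (i - 1) (j - 1) = q ^ 2 * p.lE i j := by
  have := h.lE_shift (i - 1) (j - 1)
  rw [sub_add_cancel, sub_add_cancel] at this
  rw [this, ← mul_assoc, mul_inv_cancel₀ (pow_ne_zero 2 (Uq.q_ne_zero hq)), one_mul]

theorem lF_sub (h : GridFamily q κ e f b p) (i j : ZMod n) :
    p.lF (i - 1) (j - 1) = (q ^ 2)⁻¹ * p.lF i j := by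
  have := h.lF_shift (i - 1) (j - 1)
  rw [sub_add_cancel, sub_add_cancel] at this
  rw [this, ← mul_assoc, inv_mul_cancel₀ (pow_ne_zero 2 (Uq.q_ne_zero hq)), one_mul]

theorem K_E (h : GridFamily q κ e f b p) (i j : ZMod n) :
    κ (e (b i j)) = q ^ 2 • e (κ (b i j)) := by
  have h0 := Uq.q_ne_zero hq
  have h1 := qpow_ne_zero hq
  simp only [h.hE, h.hK, map_add, map_sub, map_smul, qpow_add_one hq, h.lE_shift]
  match_scalars <;> field_simp

theorem K_F (h : GridFamily q κ e f b p) (i j : ZMod n) :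
    κ (f (b i j)) = (q ^ 2)⁻¹ • f (κ (b i j)) := by
  have h0 := Uq.q_ne_zero hq
  simp only [h.hF, h.hK, map_add, map_sub, map_smul, qpow_add_one hq, h.lF_shift,
    sub_add_cancel, add_sub_cancel_right]
  match_scalars <;> field_simp

/-- The shift rules for `λ` cancel every term with exactly one `λ`. Among the terms without `λ`,
those mixing the source and target scalars cancel, and each pure pair leaves a factor `q ^ 2 - 1` on
a diagonal neighbour. The `λλ` terms meet at the single position `(i - 1, j + 1)`. -/
theorem EF_sub_FE_eq (h : GridFamily q κ e f b p) (i j : ZMod n) :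
    e (f (b i j)) - f (e (b i j))
      = (p.γEm * p.γFm * (q ^ 2 - 1)) • b (i - 1) (j - 1)
        - (p.γEp * p.γFp * (q ^ 2 - 1)) • b (i + 1) (j + 1)
        + (p.lF i j * p.lE (i - 1) j - p.lE i j * p.lF i (j + 1)) • b (i - 1) (j + 1) := by
  have h0 := Uq.q_ne_zero hq
  have h1 := qpow_ne_zero hq i
  have h2 := qpow_ne_zero hq j
  simp only [h.hE, h.hF, map_add, map_sub, map_smul, qpow_add_one hq, qpow_sub_one hq,
    h.lF_shift, h.lE_sub hq, sub_add_cancel, add_sub_cancel_right]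
  match_scalars <;> field_simp <;> ring

theorem EF_sub_FE (h : GridFamily q κ e f b p) (hn : 2 ≤ n) (hp : GammaCond q p.γEp p.γFp)
    (hm : GammaCond q p.γEm p.γFm) (i j : ZMod n)
    (hcomm : p.lF i j * p.lE (i - 1) j = p.lE i j * p.lF i (j + 1)) :
    e (f (b i j)) - f (e (b i j)) = (q - q⁻¹)⁻¹ • (κ (b i j) - (κ ^ (n - 1)) (b i j)) := by
  rw [h.EF_sub_FE_eq hq, h.hK, h.K_pow_pred, (gammaCond_iff hn hq _ _).mp hp,
    (gammaCond_iff hn hq _ _).mp hm, hcomm]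
  module

/-- The three parts of `e` (multiply, move the target, move both ends) q²-commute in pairs, so no
cross term survives in the `n`-th power. Each part raised to the power `n` returns to its starting
position and contributes the product of its weights over one period. -/
theorem E_pow (h : GridFamily q κ e f b p) (i j : ZMod n) :
    (e ^ n) (b i j) = (p.γEm ^ n + ∏ l ∈ Finset.range n, p.lE i (j + (l : ZMod n))
      - p.γEp ^ n) • b i j := by
  have h0 := Uq.q_ne_zero hq
  have h1 := qpow_ne_zero hq
  let X := weightedShift (fun x : ZMod n × ZMod n => p.γEm * (qpow q x.2)⁻¹) id
  let Z := weightedShift (fun x : ZMod n × ZMod n => p.lE x.1 x.2) (fun x => (x.1, x.2 + 1))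
  -- The factor `q⁻²` of the formula is absorbed into the index `i + 1`.
  let Y := weightedShift (fun x : ZMod n × ZMod n => -(p.γEp * (qpow q (x.1 + 1))⁻¹))
    (fun x => (x.1 + 1, x.2 + 1))
  -- The members of `b` may vanish, so `e` itself need not split into three well-defined operators
  -- on `M`. The splitting takes place on the free module over the grid and is transported by `π`.
  let π : (ZMod n × ZMod n →₀ k) →ₗ[k] M := Finsupp.linearCombination k fun x => b x.1 x.2
  have hπ : ∀ i j, π (Finsupp.single (i, j) 1) = b i j := fun i j => by
    simp [π, Finsupp.linearCombination_single]
  have hcomm : e ∘ₗ π = π ∘ₗ (X + Z + Y) := by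
    refine finsupp_end_ext fun x => ?_
    obtain ⟨i, j⟩ := x
    simp only [LinearMap.comp_apply, LinearMap.add_apply, X, Y, Z, weightedShift_single, map_add,
      map_smul, hπ, h.hE, id, qpow_add_one hq]
    match_scalars <;> field_simp
  have hpow : ∀ m, (e ^ m) ∘ₗ π = π ∘ₗ ((X + Z + Y) ^ m) := by
    intro m
    induction m with
    | zero => rfl
    | succ m ih =>
      rw [pow_succ, pow_succ', Module.End.mul_eq_comp, Module.End.mul_eq_comp,
        LinearMap.comp_assoc, hcomm, ← LinearMap.comp_assoc, ih, LinearMap.comp_assoc,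
        ← Module.End.mul_eq_comp, ← Module.End.mul_eq_comp, ← pow_succ, ← pow_succ']
  have hZX : Z * X = q ^ 2 • (X * Z) := weightedShift_qcomm (fun x => rfl) fun x => by
    simp only [id, qpow_add_one hq]
    have := h1 x.2
    field_simp
  have hYX : Y * X = q ^ 2 • (X * Y) := weightedShift_qcomm (fun x => rfl) fun x => by
    simp only [id, qpow_add_one hq]
    have := h1 x.2
    field_simp
  have hYZ : Y * Z = q ^ 2 • (Z * Y) := weightedShift_qcomm (fun x => rfl) fun x => by
    simp only [h.lE_shift]
    field_simp
  have hc := Uq.q_sq_primitive hq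
  have hexp : (X + Z + Y) ^ n = X ^ n + Z ^ n + Y ^ n :=
    add_add_pow_of_qcomm_primitive (q ^ 2) hc X Z Y hZX hYX hYZ
  have hX : (X ^ n) (Finsupp.single (i, j) 1) = p.γEm ^ n • Finsupp.single (i, j) 1 := by
    simp only [X]
    rw [weightedShift_pow_single]
    simp [mul_pow, qpow_pow hq]
  have hZ : (Z ^ n) (Finsupp.single (i, j) 1)
      = (∏ l ∈ Finset.range n, p.lE i (j + (l : ZMod n))) • Finsupp.single (i, j) 1 := by
    have hit : ∀ l : ℕ, (fun x : ZMod n × ZMod n => (x.1, x.2 + 1))^[l] (i, j) = (i, j + l) := by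
      intro l
      induction l with
      | zero => simp
      | succ l ih => rw [Function.iterate_succ_apply', ih]; push_cast; simp only [add_assoc]
    simp only [Z]
    rw [weightedShift_pow_single]
    simp [hit]
  -- The `n` minus signs of the weights combine with the sign `(-1) ^ (n - 1)` of the product of all
  -- values of the character, leaving a single minus sign.
  have hY : (Y ^ n) (Finsupp.single (i, j) 1) = (-p.γEp ^ n) • Finsupp.single (i, j) 1 := by
    have hit : ∀ l : ℕ, (fun x : ZMod n × ZMod n => (x.1 + 1, x.2 + 1))^[l] (i, j)
        = (i + l, j + l) := by
      intro l
      induction l with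
      | zero => simp
      | succ l ih => rw [Function.iterate_succ_apply', ih]; push_cast; simp only [add_assoc]
    simp only [Y]
    rw [weightedShift_pow_single]
    simp only [hit, CharP.cast_eq_zero, add_zero]
    congr 1
    have hs : ∀ l : ℕ, i + l + 1 = i + 1 + l := fun l => by ring
    simp_rw [hs, neg_mul_eq_neg_mul]
    rw [Finset.prod_mul_distrib, Finset.prod_const, Finset.card_range, Finset.prod_inv_distrib,
      prod_qpow_add hq, neg_pow]
    obtain ⟨m, rfl⟩ : ∃ m, n = m + 1 := ⟨n - 1, by have := NeZero.ne n; omega⟩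
    rw [Nat.add_sub_cancel, pow_succ (-1 : k)]
    have : ((-1 : k) ^ m) ≠ 0 := pow_ne_zero _ (neg_ne_zero.mpr one_ne_zero)
    field_simp
  have := LinearMap.congr_fun (hpow n) (Finsupp.single (i, j) 1)
  rw [LinearMap.comp_apply, LinearMap.comp_apply, hπ, hexp, LinearMap.add_apply,
    LinearMap.add_apply, hX, hY, hZ, map_add, map_add, map_smul, map_smul, map_smul, hπ] at this
  rw [this]
  module

/-- The mechanism is that of `E_pow`, with the roles of the ends exchanged: the source scalar now
sits on the multiplication operator and the target scalar on the diagonal shift. All three periods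
carry the common sign `(-1) ^ (n - 1)`. -/
theorem F_pow (h : GridFamily q κ e f b p) (i j : ZMod n) :
    (f ^ n) (b i j) = ((-1) ^ (n - 1) * (p.γFm ^ n
      + ∏ l ∈ Finset.range n, p.lF i (j + (l : ZMod n)) - p.γFp ^ n)) • b i j := by
  have h0 := Uq.q_ne_zero hq
  have h1 := qpow_ne_zero hq
  let X := weightedShift (fun x : ZMod n × ZMod n => -(p.γFp * (qpow q x.1 * q ^ 2))) id
  let Z := weightedShift (fun x : ZMod n × ZMod n => p.lF x.1 x.2) (fun x => (x.1 - 1, x.2))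
  let Y := weightedShift (fun x : ZMod n × ZMod n => p.γFm * qpow q x.2)
    (fun x => (x.1 - 1, x.2 - 1))
  let π : (ZMod n × ZMod n →₀ k) →ₗ[k] M := Finsupp.linearCombination k fun x => b x.1 x.2
  have hπ : ∀ i j, π (Finsupp.single (i, j) 1) = b i j := fun i j => by
    simp [π, Finsupp.linearCombination_single]
  have hcomm : f ∘ₗ π = π ∘ₗ (X + Z + Y) := by
    refine finsupp_end_ext fun x => ?_
    obtain ⟨i, j⟩ := x
    simp only [LinearMap.comp_apply, LinearMap.add_apply, X, Y, Z, weightedShift_single, map_add,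
      map_smul, hπ, h.hF, id]
    module
  have hpow : ∀ m, (f ^ m) ∘ₗ π = π ∘ₗ ((X + Z + Y) ^ m) := by
    intro m
    induction m with
    | zero => rfl
    | succ m ih =>
      rw [pow_succ, pow_succ', Module.End.mul_eq_comp, Module.End.mul_eq_comp,
        LinearMap.comp_assoc, hcomm, ← LinearMap.comp_assoc, ih, LinearMap.comp_assoc,
        ← Module.End.mul_eq_comp, ← Module.End.mul_eq_comp, ← pow_succ, ← pow_succ']
  have hZX : Z * X = q ^ 2 • (X * Z) := weightedShift_qcomm (fun x => rfl) fun x => by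
    simp only [id, qpow_sub_one hq]
    field_simp
  have hYX : Y * X = q ^ 2 • (X * Y) := weightedShift_qcomm (fun x => rfl) fun x => by
    simp only [id, qpow_sub_one hq]
    field_simp
  have hYZ : Y * Z = q ^ 2 • (Z * Y) := weightedShift_qcomm (fun x => rfl) fun x => by
    simp only [h.lF_sub hq]
    field_simp
  have hc := Uq.q_sq_primitive hq
  have hexp : (X + Z + Y) ^ n = X ^ n + Z ^ n + Y ^ n :=
    add_add_pow_of_qcomm_primitive (q ^ 2) hc X Z Y hZX hYX hYZ
  have hsign : ((-1 : k) ^ (n - 1)) * (-1) ^ (n - 1) = 1 := by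
    rw [← mul_pow]; simp
  have hsign' : (-1 : k) ^ n = -(-1) ^ (n - 1) := by
    obtain ⟨m, rfl⟩ : ∃ m, n = m + 1 := ⟨n - 1, by have := NeZero.ne n; omega⟩
    rw [Nat.add_sub_cancel, pow_succ]; ring
  have hprod : ∏ l ∈ Finset.range n, ((q ^ 2)⁻¹) ^ l = (-1) ^ (n - 1) := by
    simp_rw [inv_pow (q ^ 2)]
    rw [Finset.prod_inv_distrib, prod_range_pow hq, inv_eq_of_mul_eq_one_left hsign]
  have hX : (X ^ n) (Finsupp.single (i, j) 1)
      = (-((-1) ^ (n - 1) * p.γFp ^ n)) • Finsupp.single (i, j) 1 := by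
    simp only [X]
    rw [weightedShift_pow_single]
    simp only [Function.iterate_id, id, Finset.prod_const, Finset.card_range]
    rw [neg_pow, mul_pow, mul_pow, qpow_pow hq, hc.pow_eq_one, hsign']
    ring_nf
  have hZ : (Z ^ n) (Finsupp.single (i, j) 1)
      = ((-1) ^ (n - 1) * ∏ l ∈ Finset.range n, p.lF i (j + (l : ZMod n)))
        • Finsupp.single (i, j) 1 := by
    have hit : ∀ l : ℕ, (fun x : ZMod n × ZMod n => (x.1 - 1, x.2))^[l] (i, j) = (i - l, j) := by
      intro l
      induction l with
      | zero => simp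
      | succ l ih => rw [Function.iterate_succ_apply', ih]; push_cast; simp only [sub_sub]
    -- `f` moves the source backwards, while the condition is written along a row. The shift rule
    -- trades `l` steps back in `i` for `l` steps forward in `j`, at the price of `q^{-2l}`.
    have hl : ∀ (l : ℕ) (j : ZMod n), p.lF (i - (l : ZMod n)) j = ((q ^ 2)⁻¹) ^ l * p.lF i (j + (l : ZMod n)) := by
      intro l
      induction l with
      | zero => simp
      | succ l ih =>
        intro j
        have := h.lF_sub hq (i - l) (j + 1)
        rw [add_sub_cancel_right, ih] at this
        push_cast
        rw [← sub_sub, this, pow_succ']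
        ring_nf
    simp only [Z]
    rw [weightedShift_pow_single]
    simp only [hit, CharP.cast_eq_zero, sub_zero, hl]
    rw [Finset.prod_mul_distrib, hprod]
  have hY : (Y ^ n) (Finsupp.single (i, j) 1)
      = ((-1) ^ (n - 1) * p.γFm ^ n) • Finsupp.single (i, j) 1 := by
    have hit : ∀ l : ℕ, (fun x : ZMod n × ZMod n => (x.1 - 1, x.2 - 1))^[l] (i, j)
        = (i - l, j - l) := by
      intro l
      induction l with
      | zero => simp
      | succ l ih => rw [Function.iterate_succ_apply', ih]; push_cast; simp only [sub_sub]
    have hl : ∀ l : ℕ, qpow q (j - (l : ZMod n)) = ((q ^ 2)⁻¹) ^ l * qpow q j := by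
      intro l
      induction l with
      | zero => simp
      | succ l ih =>
        push_cast
        rw [← sub_sub, qpow_sub_one hq, ih, pow_succ' ((q ^ 2)⁻¹), mul_assoc]
    simp only [Y]
    rw [weightedShift_pow_single]
    simp only [hit, CharP.cast_eq_zero, sub_zero, hl]
    rw [Finset.prod_mul_distrib, Finset.prod_mul_distrib, hprod]
    simp only [Finset.prod_const, Finset.card_range, qpow_pow hq, mul_one]
    rw [mul_comm]
  have := LinearMap.congr_fun (hpow n) (Finsupp.single (i, j) 1)
  rw [LinearMap.comp_apply, LinearMap.comp_apply, hπ, hexp, LinearMap.add_apply,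
    LinearMap.add_apply, hX, hY, hZ, map_add, map_add, map_smul, map_smul, map_smul, hπ] at this
  rw [this]
  module

end GridFamily

/-! ## Orbits of vertices -/

namespace PathAlgebra
variable {k : Type*} [Field k] {Q : Quiv}

/-- Detected by the character that is one on `e v` and zero on all other generators. -/
theorem e_ne_zero (v : Q.V) : e k v ≠ 0 := by
  classical
  intro h
  have h1 := lift_e (k := k) (Q := Q) (B := k) (fun x => if x = v then 1 else 0) (fun _ => 0)
    (by simp) (by simp) (by intro x y hxy; simp; intro hx hy; exact hxy (hy.trans hx.symm))
    (by simp) (by simp) v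
  rw [h, map_zero] at h1
  simp at h1

/-- The trivial paths are orthogonal idempotents, so multiplying by one of them reads off a
coordinate, and the same one from either side. -/
theorem exists_e_mul_of_mem_filt_zero (v : Q.V) {x : PathAlgebra k Q} (hx : x ∈ filt k Q 0) :
    ∃ a : k, e k v * x = a • e k v ∧ x * e k v = a • e k v := by
  rw [filt_zero] at hx
  induction hx using Submodule.span_induction with
  | mem x hx =>
    obtain ⟨w, rfl⟩ := hx
    by_cases h : v = w
    · exact ⟨1, by rw [h, e_mul_self, one_smul]; simp⟩
    · exact ⟨0, by rw [e_mul_e_of_ne h, e_mul_e_of_ne (Ne.symm h)]; simp⟩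
  | zero => exact ⟨0, by simp⟩
  | add x y _ _ hx hy =>
    obtain ⟨a, ha, ha'⟩ := hx
    obtain ⟨b, hb, hb'⟩ := hy
    exact ⟨a + b, by rw [mul_add, ha, hb, add_smul], by rw [add_mul, ha', hb', add_smul]⟩
  | smul c x _ hx =>
    obtain ⟨a, ha, ha'⟩ := hx
    exact ⟨c * a, by rw [mul_smul_comm, ha, smul_smul], by rw [smul_mul_assoc, ha', smul_smul]⟩

end PathAlgebra

theorem ZMod.self_ne_add_one {n : ℕ} (hn : 2 ≤ n) (i : ZMod n) : i ≠ i + 1 := by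
  have : Fact (1 < n) := ⟨hn⟩
  simp

theorem ZMod.self_ne_sub_one {n : ℕ} (hn : 2 ≤ n) (i : ZMod n) : i ≠ i - 1 := by
  have h := ZMod.self_ne_add_one hn (i - 1)
  rw [sub_add_cancel] at h
  exact h.symm

/-- This is where `n ≥ 3` matters: it separates the images of a vertex under `K` and `K⁻¹`. -/
theorem ZMod.add_one_ne_sub_one {n : ℕ} (hn : 3 ≤ n) (i : ZMod n) : i + 1 ≠ i - 1 := by
  intro h
  have h2 : ((2 : ℕ) : ZMod n) = 0 := by
    have : (1 : ZMod n) + 1 = 0 := by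
      have := congrArg (fun x => x - i + 1) h
      simpa using this
    push_cast
    rw [← one_add_one_eq_two, this]
  rw [ZMod.natCast_eq_zero_iff] at h2
  exact absurd (Nat.le_of_dvd (by norm_num) h2) (by omega)

theorem ZMod.eq_of_add_one {n : ℕ} [NeZero n] {X : Type*} {g : ZMod n → X}
    (h : ∀ i, g (i + 1) = g i) (i : ZMod n) : g i = g 0 := by
  have : ∀ l : ℕ, g (l : ZMod n) = g 0 := by
    intro l
    induction l with
    | zero => simp
    | succ l ih => push_cast; rw [h, ih]
  simpa using this i.val

namespace HopfAction
open PathAlgebra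
variable {k : Type*} [Field k] {n : ℕ} [NeZero n] {q : k} [hq : Fact (IsPrimitiveRoot q (2 * n))]

section
variable {A : Type*} [Ring A] [Algebra k A] (α : HopfAction k (Uq n q) A)

theorem act_Kinv_of_act_K {m : ℕ} {v : ZMod m → A}
    (hK : ∀ i, α.act (Uq.K n q) (v i) = v (i + 1)) (i : ZMod m) :
    α.act (Uq.Kinv n q) (v i) = v (i - 1) := by
  have h := act_Kinv_act_K α (v (i - 1))
  rwa [hK, sub_add_cancel] at h

end

variable {Q : Quiv} (α : HopfAction k (Uq n q) (PathAlgebra k Q))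

/-- The action on an orbit of at least two trivial paths. -/
theorem exists_vertex_scalars {m : ℕ} (hm : 2 ≤ m) {w : ZMod m → Q.V}
    (hw : Function.Injective w) (hK : ∀ i, α.act (Uq.K n q) (e k (w i)) = e k (w (i + 1)))
    (hE : ∀ i, α.act (Uq.E n q) (e k (w i)) ∈ filt k Q 0)
    (hF : ∀ i, α.act (Uq.F n q) (e k (w i)) ∈ filt k Q 0) :
    ∃ a d : ZMod m → k,
      (∀ i, α.act (Uq.E n q) (e k (w i)) = a i • e k (w i) - a (i + 1) • e k (w (i + 1))) ∧
      (∀ i, α.act (Uq.F n q) (e k (w i)) = d i • e k (w i) - d (i - 1) • e k (w (i - 1))) ∧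
      (∀ i, a i = q ^ 2 * a (i + 1)) ∧ ∀ i, d (i + 1) = q ^ 2 * d i := by
  have hne : ∀ i, w i ≠ w (i + 1) := fun i h => ZMod.self_ne_add_one hm i (hw h)
  have hKi := α.act_Kinv_of_act_K (v := fun i => e k (w i)) hK
  have h0 := Uq.q_ne_zero hq.out
  have hinj : ∀ (x : k) v, x • e k (Q := Q) v = 0 → x = 0 := fun x v h =>
    (smul_eq_zero.mp h).resolve_right (e_ne_zero v)
  choose a ha ha' using fun i => exists_e_mul_of_mem_filt_zero (w i) (hE i)
  choose b hb hb' using fun i => exists_e_mul_of_mem_filt_zero (w (i + 1)) (hE i)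
  choose d hd hd' using fun i => exists_e_mul_of_mem_filt_zero (w i) (hF i)
  choose g hg hg' using fun i => exists_e_mul_of_mem_filt_zero (w (i - 1)) (hF i)
  -- Applying `E` to `e_{i+1} e_i = 0` gives a multiple of `e_{i+1}` whose coefficient is `b i + a
  -- (i + 1)`.
  have hba : ∀ i, b i = -a (i + 1) := by
    intro i
    have h := act_E_mul α (e k (w (i + 1))) (e k (w i))
    rw [e_mul_e_of_ne (hne i).symm, map_zero, hK, hb, ha', ← add_smul] at h
    exact eq_neg_of_add_eq_zero_left (hinj _ _ h.symm)
  have hgd : ∀ i, g i = -d (i - 1) := by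
    intro i
    have h := act_F_mul α (e k (w i)) (e k (w (i - 1)))
    have hne' := hne (i - 1)
    rw [sub_add_cancel] at hne'
    rw [e_mul_e_of_ne hne'.symm, map_zero, hKi, hd, hg', ← add_smul] at h
    exact eq_neg_of_add_eq_zero_right (hinj _ _ h.symm)
  -- Idempotence of `e_i` confines `E e_i` to the coordinates at `e_i` and `K e_i`.
  have hEf : ∀ i, α.act (Uq.E n q) (e k (w i)) = a i • e k (w i) - a (i + 1) • e k (w (i + 1)) := by
    intro i
    have h := act_E_mul α (e k (w i)) (e k (w i))
    rw [e_mul_self, hK, ha, hb', hba, neg_smul, ← sub_eq_add_neg] at h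
    exact h
  have hFf : ∀ i, α.act (Uq.F n q) (e k (w i)) = d i • e k (w i) - d (i - 1) • e k (w (i - 1)) := by
    intro i
    have h := act_F_mul α (e k (w i)) (e k (w i))
    rw [e_mul_self, hKi, hd', hg, hgd, neg_smul, add_comm, ← sub_eq_add_neg] at h
    exact h
  refine ⟨a, d, hEf, hFf, fun i => ?_, fun i => ?_⟩
  -- Multiplication by `e_{i+1}` extracts one coordinate of the relation between `K` and `E`.
  · have h := congrArg (fun x => e k (w (i + 1)) * x) (act_K_act_E α (e k (w i)))
    simp only [hEf, hK, map_sub, map_smul, mul_sub, mul_smul_comm, e_mul_self,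
      e_mul_e_of_ne (hne (i + 1)), smul_zero, sub_zero] at h
    rw [smul_smul, ← sub_eq_zero, ← sub_smul] at h
    exact sub_eq_zero.mp (hinj _ _ h)
  · have h := congrArg (fun x => e k (w (i + 1)) * x) (act_K_act_F α (e k (w i)))
    simp only [hFf, hK, map_sub, map_smul, mul_sub, mul_smul_comm, e_mul_self, sub_add_cancel,
      add_sub_cancel_right, e_mul_e_of_ne (hne i).symm, smul_zero, sub_zero] at h
    rw [smul_smul, ← sub_eq_zero, ← sub_smul] at h
    rw [sub_eq_zero.mp (hinj _ _ h), ← mul_assoc, mul_inv_cancel₀ (pow_ne_zero 2 h0), one_mul]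

/-- `E` and `F` vanish on an orbit of at least two and less than `n` trivial paths. -/
theorem vertex_eq_zero {m : ℕ} (hm : 2 ≤ m) (hmn : m < n) {w : ZMod m → Q.V}
    (hw : Function.Injective w) (hK : ∀ i, α.act (Uq.K n q) (e k (w i)) = e k (w (i + 1)))
    (hE : ∀ i, α.act (Uq.E n q) (e k (w i)) ∈ filt k Q 0)
    (hF : ∀ i, α.act (Uq.F n q) (e k (w i)) ∈ filt k Q 0) (i : ZMod m) :
    α.act (Uq.E n q) (e k (w i)) = 0 ∧ α.act (Uq.F n q) (e k (w i)) = 0 := by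
  obtain ⟨a, d, hEf, hFf, ha, hd⟩ := α.exists_vertex_scalars hm hw hK hE hF
  have hc : (q ^ 2) ^ m ≠ 1 :=
    (Uq.q_sq_primitive hq.out).pow_ne_one_of_pos_of_lt (by omega) hmn
  -- One turn around the orbit brings each scalar back multiplied by a power of `q²` different from
  -- one.
  have key : ∀ x : k, x = (q ^ 2) ^ m * x → x = 0 := by
    intro x hx
    have : ((q ^ 2) ^ m - 1) * x = 0 := by linear_combination -hx
    exact (mul_eq_zero.mp this).resolve_left (sub_ne_zero.mpr hc)
  have ha0 : ∀ i, a i = 0 := by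
    intro i
    have : ∀ l : ℕ, a i = (q ^ 2) ^ l * a (i + l) := by
      intro l
      induction l with
      | zero => simp
      | succ l ih => rw [ih, ha]; push_cast; rw [pow_succ]; ring_nf
    exact key _ (by simpa using this m)
  have hd0 : ∀ i, d i = 0 := by
    intro i
    have : ∀ l : ℕ, d (i + l) = (q ^ 2) ^ l * d i := by
      intro l
      induction l with
      | zero => simp
      | succ l ih => push_cast; rw [← add_assoc, hd, ih, pow_succ']; ring
    exact key _ (by simpa using this m)
  rw [hEf, hFf]
  simp [ha0, hd0]

end HopfAction

/-- The formulas for an orbit of trivial paths. -/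
structure VertexOrbit {k : Type*} [Field k] {n : ℕ} [NeZero n] (q : k) {M : Type*}
    [AddCommGroup M] [Module k M] (κ e f : Module.End k M) (v : ZMod n → M) (γE γF : k) :
    Prop where
  hK : ∀ i, κ (v i) = v (i + 1)
  hE : ∀ i, e (v i) = (γE * (qpow q i)⁻¹) • (v i - (q ^ 2)⁻¹ • v (i + 1))
  hF : ∀ i, f (v i) = (γF * qpow q i) • (v (i - 1) - q ^ 2 • v i)

/-- The family with `v` on the diagonal. -/
def diagFamily {I M : Type*} [DecidableEq I] [Zero M] (v : I → M) (i j : I) : M :=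
  if i = j then v i else 0

namespace VertexOrbit
variable {k : Type*} [Field k] {n : ℕ} [NeZero n] {q : k} {M : Type*}
    [AddCommGroup M] [Module k M] {κ e f : Module.End k M} {v : ZMod n → M} {γE γF : k}

/-- A trivial path behaves like an arrow from a vertex to itself without `λ` terms, so all
computations on grids cover vertices too. -/
theorem gridFamily (h : VertexOrbit q κ e f v γE γF) :
    GridFamily q κ e f (diagFamily v) ⟨γE, γE, γF, γF, 0, 0⟩ where
  hK i j := by
    by_cases hij : i = j <;> simp [diagFamily, hij, h.hK]
  hE i j := by
    by_cases hij : i = j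
    · simp only [diagFamily, hij, if_true, h.hE, Pi.zero_apply, zero_smul, add_zero]
      module
    · simp [diagFamily, hij]
  hF i j := by
    by_cases hij : i = j
    · simp only [diagFamily, hij, if_true, h.hF, Pi.zero_apply, zero_smul, add_zero]
      module
    · simp [diagFamily, hij]
  lE_shift i j := by simp
  lF_shift i j := by simp

end VertexOrbit

namespace HopfAction
open PathAlgebra
variable {k : Type*} [Field k] {n : ℕ} [NeZero n] {q : k} [hq : Fact (IsPrimitiveRoot q (2 * n))]
variable {Q : Quiv} (α : HopfAction k (Uq n q) (PathAlgebra k Q))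

/-- The recursions make `a i` times `q^{2i}` and `d i` times `q^{-2i}` independent of `i`. Condition
(*) is then one coordinate of the commutator relation at a vertex. -/
theorem exists_vertexOrbit (hn : 2 ≤ n) {w : ZMod n → Q.V}
    (hw : Function.Injective w) (hK : ∀ i, α.act (Uq.K n q) (e k (w i)) = e k (w (i + 1)))
    (hE : ∀ i, α.act (Uq.E n q) (e k (w i)) ∈ filt k Q 0)
    (hF : ∀ i, α.act (Uq.F n q) (e k (w i)) ∈ filt k Q 0) :
    ∃ γE γF : k, (3 ≤ n → GammaCond q γE γF) ∧
      VertexOrbit q (α.act (Uq.K n q)) (α.act (Uq.E n q)) (α.act (Uq.F n q))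
        (fun i => e k (w i)) γE γF := by
  obtain ⟨a, d, hEf, hFf, ha, hd⟩ := α.exists_vertex_scalars hn hw hK hE hF
  have h0 := Uq.q_ne_zero hq.out
  have h1 := qpow_ne_zero (n := n) hq.out
  have hq1 : qpow q (0 : ZMod n) = 1 := by simp [qpow]
  have ha0 : ∀ i, a i = a 0 * (qpow q i)⁻¹ := by
    intro i
    have h := ZMod.eq_of_add_one (g := fun i => a i * qpow q i) (fun i => by
      rw [qpow_add_one hq.out, ha i]; ring) i
    simp only [hq1, mul_one] at h
    rw [← h, mul_assoc, mul_inv_cancel₀ (h1 i), mul_one]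
  have hd0 : ∀ i, d i = d 0 * qpow q i := by
    intro i
    have h := ZMod.eq_of_add_one (g := fun i => d i * (qpow q i)⁻¹) (fun i => by
      have := h1 i
      rw [qpow_add_one hq.out, hd i]; field_simp) i
    simp only [hq1, inv_one, mul_one] at h
    rw [← h, mul_assoc, inv_mul_cancel₀ (h1 i), mul_one]
  -- The formula for `F` is normalised by its coefficient at `v (i - 1)`, which is `-d (i - 1) =
  -- -q⁻² d i`; this gives the second scalar.
  have hv : VertexOrbit q (α.act (Uq.K n q)) (α.act (Uq.E n q)) (α.act (Uq.F n q))
      (fun i => e k (w i)) (a 0) (-(q ^ 2)⁻¹ * d 0) := by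
    refine ⟨hK, fun i => ?_, fun i => ?_⟩
    · have := h1 i
      rw [hEf, ha0 i, ha0 (i + 1), qpow_add_one hq.out]
      match_scalars <;> field_simp
    · have := h1 i
      rw [hFf, hd0 i, hd0 (i - 1), qpow_sub_one hq.out]
      match_scalars <;> field_simp
  refine ⟨_, _, fun hn3 => ?_, hv⟩
  rw [gammaCond_iff hn hq.out]
  have h := hv.gridFamily.EF_sub_FE_eq hq.out 0 0
  rw [act_EF_sub_FE] at h
  simp only [diagFamily, if_true, Pi.zero_apply, mul_zero, sub_zero, zero_smul, add_zero] at h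
  rw [hK, act_Kinv_of_act_K α (v := fun i => e k (w i)) hK] at h
  -- Only for `n ≥ 3` can the two sides of the commutator be separated by multiplying with a trivial
  -- path; for `n = 2` they lie at the same vertex.
  have hne : w (0 + 1) ≠ w (0 - 1) := fun h => ZMod.add_one_ne_sub_one hn3 0 (hw h)
  have huu := e_mul_e_of_ne (k := k) hne
  have hu := e_mul_self (k := k) (w (0 + 1))
  have hu0 := e_ne_zero (k := k) (w (0 + 1))
  generalize a 0 * (-(q ^ 2)⁻¹ * d 0) * (q ^ 2 - 1) = C at h ⊢
  generalize e k (w (0 + 1)) = u at h huu hu hu0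
  generalize e k (w (0 - 1)) = u' at h huu
  have h2 := congrArg (fun x => u * x) h
  simp only [mul_sub, mul_smul_comm, huu, hu, smul_zero, sub_zero, zero_sub] at h2
  rw [← neg_smul, ← sub_eq_zero, ← sub_smul] at h2
  linear_combination (smul_eq_zero.mp h2).resolve_right hu0

end HopfAction

/-! ## Families of arrows -/

namespace HopfAction
variable {k : Type*} [Field k] {n : ℕ} [NeZero n] {q : k} [hq : Fact (IsPrimitiveRoot q (2 * n))]
  {A : Type*} [Ring A] [Algebra k A] (α : HopfAction k (Uq n q) A)

/-- The action on a family `b` of arrows with sources `s` and targets `t`. -/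
theorem exists_gridFamily (hn : 2 ≤ n) {s t : ZMod n → A} {b : ZMod n → ZMod n → A}
    {γEp γEm γFp γFm : k}
    (hs : VertexOrbit q (α.act (Uq.K n q)) (α.act (Uq.E n q)) (α.act (Uq.F n q)) s γEp γFp)
    (ht : VertexOrbit q (α.act (Uq.K n q)) (α.act (Uq.E n q)) (α.act (Uq.F n q)) t γEm γFm)
    (hp : GammaCond q γEp γFp) (hm : GammaCond q γEm γFm)
    (hsb : ∀ i j, s i * b i j = b i j) (hsb' : ∀ i i' j, i ≠ i' → s i * b i' j = 0)
    (hbt : ∀ i j, b i j * t j = b i j) (hbt' : ∀ i j j', j ≠ j' → b i j * t j' = 0)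
    (hK : ∀ i j, α.act (Uq.K n q) (b i j) = b (i + 1) (j + 1))
    (hcorner : ∀ h i j i' j', ∃ a : k, s i' * α.act h (b i j) * t j' = a • b i' j') :
    ∃ lE lF : ZMod n → ZMod n → k,
      GridFamily q (α.act (Uq.K n q)) (α.act (Uq.E n q)) (α.act (Uq.F n q)) b
        ⟨γEp, γEm, γFp, γFm, lE, lF⟩ ∧
      (∀ i j, b i j = 0 ∨ b i (j + 1) = 0 → lE i j = 0) ∧
      (∀ i j, b i j = 0 ∨ b (i - 1) j = 0 → lF i j = 0) ∧
      (∀ i j, lF i j * lE (i - 1) j = lE i j * lF i (j + 1)) ∧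
      (∀ i j, b i j ≠ 0 →
        γEp ^ n = γEm ^ n + ∏ l ∈ Finset.range n, lE i (j + (l : ZMod n)) ∧
        γFp ^ n = γFm ^ n + ∏ l ∈ Finset.range n, lF i (j + (l : ZMod n))) ∧
      (∀ i j, s i * α.act (Uq.E n q) (b i j) * t (j + 1) = lE i j • b i (j + 1)) ∧
      (∀ i j, s (i - 1) * α.act (Uq.F n q) (b i j) * t j = lF i j • b (i - 1) j) := by
  classical
  have h0 := Uq.q_ne_zero hq.out
  have h1 := qpow_ne_zero (n := n) hq.out
  have hKi : ∀ i j, α.act (Uq.Kinv n q) (b i j) = b (i - 1) (j - 1) := by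
    intro i j
    have h := act_Kinv_act_K α (b (i - 1) (j - 1))
    rwa [hK, sub_add_cancel, sub_add_cancel] at h
  have hKis := α.act_Kinv_of_act_K hs.hK
  have hzero : ∀ i j, b (i + 1) (j + 1) = 0 → b i j = 0 := by
    intro i j h
    have h' := hKi (i + 1) (j + 1)
    rw [h, map_zero, add_sub_cancel_right, add_sub_cancel_right] at h'
    exact h'.symm
  choose xE hxE using fun i j => hcorner (Uq.E n q) i j i (j + 1)
  choose xF hxF using fun i j => hcorner (Uq.F n q) i j (i - 1) j
  -- The corner scalar is undetermined where an arrow is missing. Choosing zero there makes the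
  -- shift and commutation rules hold on the whole grid.
  let lE : ZMod n → ZMod n → k := fun i j => if b i j = 0 ∨ b i (j + 1) = 0 then 0 else xE i j
  let lF : ZMod n → ZMod n → k := fun i j => if b i j = 0 ∨ b (i - 1) j = 0 then 0 else xF i j
  have hlE : ∀ i j, s i * α.act (Uq.E n q) (b i j) * t (j + 1) = lE i j • b i (j + 1) := by
    intro i j
    by_cases h : b i j = 0 ∨ b i (j + 1) = 0
    · simp only [lE, if_pos h, zero_smul]
      rcases h with h | h
      · rw [h]; simp
      · rw [hxE, h, smul_zero]
    · simp only [lE, if_neg h, hxE]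
  have hlF : ∀ i j, s (i - 1) * α.act (Uq.F n q) (b i j) * t j = lF i j • b (i - 1) j := by
    intro i j
    by_cases h : b i j = 0 ∨ b (i - 1) j = 0
    · simp only [lF, if_pos h, zero_smul]
      rcases h with h | h
      · rw [h]; simp
      · rw [hxF, h, smul_zero]
    · simp only [lF, if_neg h, hxF]
  have zE : ∀ i j, b i j = 0 ∨ b i (j + 1) = 0 → lE i j = 0 := fun i j h => if_pos h
  have zF : ∀ i j, b i j = 0 ∨ b (i - 1) j = 0 → lF i j = 0 := fun i j h => if_pos h
  have hE : ∀ i j, α.act (Uq.E n q) (b i j) = (γEm * (qpow q j)⁻¹) • b i j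
      - (γEp * ((qpow q i)⁻¹ * (q ^ 2)⁻¹)) • b (i + 1) (j + 1) + lE i j • b i (j + 1) := by
    intro i j
    -- From `b = s b`, `E b` is its part starting at `s i` plus a known multiple of `K b`. From `b =
    -- b t`, that part is a known multiple of `b` plus the corner between `s i` and `t (j + 1)`.
    have e1 := act_E_mul α (s i) (b i j)
    rw [hsb, hK, hs.hE, smul_mul_assoc, sub_mul, smul_mul_assoc, hsb,
      hsb' i (i + 1) _ (ZMod.self_ne_add_one hn i), zero_sub] at e1
    have e2 := act_E_mul α (b i j) (t j)
    rw [hbt, ht.hK, ht.hE, mul_smul_comm, mul_sub, mul_smul_comm, hbt,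
      hbt' i j (j + 1) (ZMod.self_ne_add_one hn j), smul_zero, sub_zero] at e2
    have e3 := congrArg (fun x => s i * x) e2
    simp only [mul_add, mul_smul_comm, hsb, ← mul_assoc, hlE] at e3
    rw [e1, e3]
    module
  have hF : ∀ i j, α.act (Uq.F n q) (b i j) = (γFm * qpow q j) • b (i - 1) (j - 1)
      - (γFp * (qpow q i * q ^ 2)) • b i j + lF i j • b (i - 1) j := by
    intro i j
    have e1 := act_F_mul α (s i) (b i j)
    rw [hsb, hKis, hs.hF, smul_mul_assoc, sub_mul, smul_mul_assoc, hsb,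
      hsb' (i - 1) i _ (ZMod.self_ne_sub_one hn i).symm, zero_sub] at e1
    have e2 := act_F_mul α (b i j) (t j)
    rw [hbt, hKi, ht.hF, mul_smul_comm, mul_sub, mul_smul_comm, hbt,
      hbt' (i - 1) (j - 1) j (ZMod.self_ne_sub_one hn j).symm, smul_zero, sub_zero] at e2
    have e3 := congrArg (fun x => s (i - 1) * x) e2
    simp only [mul_add, mul_smul_comm, hsb, ← mul_assoc, hlF] at e3
    rw [e1, e3]
    module
  have sE : ∀ i j, lE (i + 1) (j + 1) = (q ^ 2)⁻¹ * lE i j := by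
    intro i j
    by_cases hb : b (i + 1) (j + 1 + 1) = 0
    · rw [zE _ _ (Or.inr hb), zE _ _ (Or.inr (hzero _ _ hb)), mul_zero]
    · have h := act_K_act_E α (b i j)
      rw [hK, hE, hE, map_add, map_sub, map_smul, map_smul, map_smul, hK, hK, hK,
        qpow_add_one hq.out, qpow_add_one hq.out, ← sub_eq_zero] at h
      -- All other terms cancel identically, so no linear independence of the family is required.
      have h2 : (lE i j - q ^ 2 * lE (i + 1) (j + 1)) • b (i + 1) (j + 1 + 1) = 0 := by
        rw [← h]
        have := h1 i
        have := h1 j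
        match_scalars <;> field_simp <;> ring
      have h3 := (smul_eq_zero.mp h2).resolve_right hb
      rw [sub_eq_zero.mp h3, ← mul_assoc, inv_mul_cancel₀ (pow_ne_zero 2 h0), one_mul]
  have sF : ∀ i j, lF (i + 1) (j + 1) = q ^ 2 * lF i j := by
    intro i j
    by_cases hb : b i (j + 1) = 0
    · have hb' : b (i - 1) j = 0 := hzero _ _ (by rwa [sub_add_cancel])
      rw [zF i j (Or.inr hb'), zF (i + 1) (j + 1) (Or.inr (by rwa [add_sub_cancel_right])),
        mul_zero]
    · have h := act_K_act_F α (b i j)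
      rw [hK, hF, hF, map_add, map_sub, map_smul, map_smul, map_smul, hK, hK, hK,
        qpow_add_one hq.out, qpow_add_one hq.out, ← sub_eq_zero] at h
      simp only [sub_add_cancel, add_sub_cancel_right] at h
      have h2 : (lF i j - (q ^ 2)⁻¹ * lF (i + 1) (j + 1)) • b i (j + 1) = 0 := by
        rw [← h]
        match_scalars <;> field_simp <;> ring
      have h3 := (smul_eq_zero.mp h2).resolve_right hb
      rw [sub_eq_zero.mp h3, ← mul_assoc, mul_inv_cancel₀ (pow_ne_zero 2 h0), one_mul]
  have G : GridFamily q (α.act (Uq.K n q)) (α.act (Uq.E n q)) (α.act (Uq.F n q)) b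
      ⟨γEp, γEm, γFp, γFm, lE, lF⟩ := ⟨hK, hE, hF, sE, sF⟩
  refine ⟨lE, lF, G, zE, zF, fun i j => ?_, fun i j hb => ⟨?_, ?_⟩, hlE, hlF⟩
  -- Both products of `λ` are coefficients at this position; if nothing lives there, the convention
  -- makes both of them zero.
  · by_cases hb : b (i - 1) (j + 1) = 0
    · rw [zE (i - 1) j (Or.inr hb), zF i (j + 1) (Or.inr hb), mul_zero, mul_zero]
    · have h := G.EF_sub_FE_eq hq.out i j
      rw [act_EF_sub_FE, hK, hKi] at h
      simp only [(gammaCond_iff hn hq.out _ _).mp hp, (gammaCond_iff hn hq.out _ _).mp hm] at h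
      have h2 : (lF i j * lE (i - 1) j - lE i j * lF i (j + 1)) • b (i - 1) (j + 1) = 0 := by
        rw [← sub_eq_zero.mpr h.symm]
        module
      exact sub_eq_zero.mp ((smul_eq_zero.mp h2).resolve_right hb)
  · have h := G.E_pow hq.out i j
    rw [← map_pow, Uq.E_pow, map_zero, LinearMap.zero_apply] at h
    exact (sub_eq_zero.mp ((smul_eq_zero.mp h.symm).resolve_right hb)).symm
  · have h := G.F_pow hq.out i j
    rw [← map_pow, Uq.F_pow, map_zero, LinearMap.zero_apply] at h
    have h2 := (smul_eq_zero.mp h.symm).resolve_right hb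
    exact (sub_eq_zero.mp ((mul_eq_zero.mp h2).resolve_left
      (pow_ne_zero _ (neg_ne_zero.mpr one_ne_zero)))).symm

end HopfAction

/-! ## Constructing actions on path algebras -/

/-- The relations of `u_q(sl_2)` at an element of a module with three operators. -/
structure RelationsAt {k : Type*} [Field k] (n : ℕ) (q : k) {M : Type*} [AddCommGroup M]
    [Module k M] (κ e f : Module.End k M) (x : M) : Prop where
  hK : (κ ^ n) x = x
  hKE : κ (e x) = q ^ 2 • e (κ x)
  hKF : κ (f x) = (q ^ 2)⁻¹ • f (κ x)
  hE : (e ^ n) x = 0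
  hF : (f ^ n) x = 0
  hEF : e (f x) - f (e x) = (q - q⁻¹)⁻¹ • (κ x - (κ ^ (n - 1)) x)

namespace RelationsAt
variable {k : Type*} [Field k] {n : ℕ} {q : k} {M : Type*} [AddCommGroup M]
    [Module k M] {κ e f : Module.End k M} {x : M}

/-- Carries the relations from rescaled arrows, where the formulas are uniform, back to the arrows
themselves. -/
theorem smul (h : RelationsAt n q κ e f x) (c : k) : RelationsAt n q κ e f (c • x) where
  hK := by rw [map_smul, h.hK]
  hKE := by rw [map_smul, map_smul, map_smul, map_smul, h.hKE, smul_comm]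
  hKF := by rw [map_smul, map_smul, map_smul, map_smul, h.hKF, smul_comm]
  hE := by rw [map_smul, h.hE, smul_zero]
  hF := by rw [map_smul, h.hF, smul_zero]
  hEF := by
    simp only [map_smul]
    rw [← smul_sub, ← smul_sub, h.hEF, smul_comm]

end RelationsAt

theorem GridFamily.relationsAt {k : Type*} [Field k] {n : ℕ} [NeZero n] {q : k}
    (hq : IsPrimitiveRoot q (2 * n)) {M : Type*} [AddCommGroup M] [Module k M]
    {κ e f : Module.End k M} {b : ZMod n → ZMod n → M} {p : ParamsB k n}
    (h : GridFamily q κ e f b p) {i j : ZMod n}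
    (hE : p.γEp ^ n = p.γEm ^ n + ∏ l ∈ Finset.range n, p.lE i (j + (l : ZMod n)))
    (hF : p.γFp ^ n = p.γFm ^ n + ∏ l ∈ Finset.range n, p.lF i (j + (l : ZMod n)))
    (hEF : e (f (b i j)) - f (e (b i j))
      = (q - q⁻¹)⁻¹ • (κ (b i j) - (κ ^ (n - 1)) (b i j))) :
    RelationsAt n q κ e f (b i j) where
  hK := h.K_pow_card i j
  hKE := h.K_E hq i j
  hKF := h.K_F hq i j
  hE := by rw [h.E_pow hq, hE, sub_self, zero_smul]
  hF := by rw [h.F_pow hq, hF, sub_self, mul_zero, zero_smul]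
  hEF := hEF

theorem VertexOrbit.relationsAt {k : Type*} [Field k] {n : ℕ} [NeZero n] {q : k}
    (hq : IsPrimitiveRoot q (2 * n)) {M : Type*} [AddCommGroup M] [Module k M]
    {κ e f : Module.End k M} {v : ZMod n → M} {γE γF : k}
    (h : VertexOrbit q κ e f v γE γF) (hn : 2 ≤ n) (hγ : 3 ≤ n → GammaCond q γE γF)
    (i : ZMod n) : RelationsAt n q κ e f (v i) := by
  have G := h.gridFamily
  have hv : diagFamily v i i = v i := if_pos rfl
  rw [← hv]
  refine G.relationsAt hq ?_ ?_ ?_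
  · simp [NeZero.ne n]
  · simp [NeZero.ne n]
  · by_cases h3 : 3 ≤ n
    · exact G.EF_sub_FE hq hn (hγ h3) (hγ h3) i i (by simp)
    -- For `n = 2` the operators `K` and `K⁻¹` agree on the orbit, and both sides of the relation
    -- vanish for any scalars.
    · have h2 : i - 1 = i + 1 := by
        obtain rfl : n = 2 := by omega
        exact (by decide : ∀ i : ZMod 2, i - 1 = i + 1) i
      rw [G.EF_sub_FE_eq hq, G.hK, G.K_pow_pred, h2]
      simp

namespace HopfAction
open PathAlgebra
variable {k : Type*} [Field k] {n : ℕ} [NeZero n] {q : k} [hq : Fact (IsPrimitiveRoot q (2 * n))]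
  {Q : Quiv}

theorem exists_of_relationsAt {κ : PathAlgebra k Q →ₐ[k] PathAlgebra k Q}
    {e f : Module.End k (PathAlgebra k Q)}
    (he : ∀ a b, e (a * b) = a * e b + e a * κ b)
    (hf : ∀ a b, f (a * b) = (κ.toLinearMap ^ (n - 1)) a * f b + f a * b)
    (h : ∀ x ∈ gens k Q, RelationsAt n q κ.toLinearMap e f x) :
    ∃ α : HopfAction k (Uq n q) (PathAlgebra k Q), α.act (Uq.K n q) = κ.toLinearMap ∧
      α.act (Uq.E n q) = e ∧ α.act (Uq.F n q) = f :=
  exists_of_gens κ e f he hf (fun x hx => (h x hx).hK) (fun x hx => (h x hx).hKE)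
    (fun x hx => (h x hx).hKF) (fun x hx => (h x hx).hE) (fun x hx => (h x hx).hF)
    (fun x hx => (h x hx).hEF)

end HopfAction

namespace PathAlgebra
variable {k : Type*} [Field k] {Q : Quiv}

/-- Detected by the representation on the space of vertices in which trivial paths are diagonal
matrix units, `a` is the matrix unit from its source to its target, and all other arrows act by
zero. -/
theorem arr_ne_zero (a : Q.A) : arr k a ≠ 0 := by
  classical
  intro h
  have h1 := lift_arr (k := k) (Q := Q) (B := Matrix Q.V Q.V k)
    (fun v => Matrix.single v v 1) (fun b => if b = a then Matrix.single (Q.s a) (Q.t a) 1 else 0)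
    (by
      ext i j
      rw [Matrix.sum_apply]
      by_cases hij : i = j
      · subst hij
        simp [Matrix.single_apply]
      · rw [Matrix.one_apply_ne hij]
        refine Finset.sum_eq_zero fun v _ => ?_
        rw [Matrix.single_apply, if_neg]
        rintro ⟨rfl, rfl⟩
        exact hij rfl)
    (by simp) (fun x y hxy => by simp [hxy])
    (by intro b; by_cases hb : b = a <;> simp [hb])
    (by intro b; by_cases hb : b = a <;> simp [hb]) a
  rw [h, map_zero, if_pos rfl] at h1
  have h2 := congrFun (congrFun h1 (Q.s a)) (Q.t a)
  simp at h2

/-- Algebra endomorphisms that permute the trivial paths. -/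
theorem exists_algHom (σ : Equiv.Perm Q.V) (ka : Q.A → PathAlgebra k Q)
    (hs : ∀ a, e k (σ (Q.s a)) * ka a = ka a) (ht : ∀ a, ka a * e k (σ (Q.t a)) = ka a) :
    ∃ κ : PathAlgebra k Q →ₐ[k] PathAlgebra k Q, (∀ v, κ (e k v) = e k (σ v)) ∧
      ∀ a, κ (arr k a) = ka a :=
  ⟨lift (fun v => e k (σ v)) ka
    (by rw [Equiv.sum_comp σ (fun v => e k v), sum_e]) (fun v => e_mul_self _)
    (fun v w h => e_mul_e_of_ne fun h' => h (σ.injective h')) hs ht,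
    fun v => lift_e .., fun a => lift_arr ..⟩

section skew
variable {n : ℕ} [NeZero n] {q : k} (hq : IsPrimitiveRoot q (2 * n)) (hn : 2 ≤ n)
  (σ : Equiv.Perm Q.V) (ix : Q.V → ZMod n) (hix : ∀ v, ix (σ v) = ix v + 1)
include hq hn hix

/-- Skew derivations of the type of `E`. -/
theorem exists_skew_E (γ : Q.V → k) (hγ : ∀ v, γ (σ v) = γ v)
    (κ : PathAlgebra k Q →ₐ[k] PathAlgebra k Q) (hκ : ∀ v, κ (e k v) = e k (σ v))
    (η : Q.A → PathAlgebra k Q) (hs : ∀ a, e k (Q.s a) * η a = η a)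
    (ht : ∀ a, η a * e k (σ (Q.t a)) = η a) :
    ∃ D : PathAlgebra k Q →ₗ[k] PathAlgebra k Q,
      (∀ a b, D (a * b) = a * D b + D a * κ b) ∧
      (∀ v, D (e k v) = (γ v * (qpow q (ix v))⁻¹) • (e k v - (q ^ 2)⁻¹ • e k (σ v))) ∧
      ∀ a, D (arr k a) = (γ (Q.t a) * (qpow q (ix (Q.t a)))⁻¹) • arr k a
        - (γ (Q.s a) * ((qpow q (ix (Q.s a)))⁻¹ * (q ^ 2)⁻¹)) • κ (arr k a) + η a := by
  have hne : ∀ v, v ≠ σ v := fun v h =>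
    ZMod.self_ne_add_one hn (ix v) ((congrArg ix h).trans (hix v))
  have hsσ : ∀ a, e k (σ (Q.s a)) * κ (arr k a) = κ (arr k a) := fun a => by
    rw [← hκ, ← map_mul, e_src_mul_arr]
  have htσ : ∀ a, κ (arr k a) * e k (σ (Q.t a)) = κ (arr k a) := fun a => by
    rw [← hκ, ← map_mul, arr_mul_e_tgt]
  have hsσ' : ∀ a, e k (Q.s a) * κ (arr k a) = 0 := fun a => by
    rw [← hsσ, ← mul_assoc, e_mul_e_of_ne (hne _), zero_mul]
  refine exists_skew (AlgHom.id k _) κ _ _ ?_ ?_ ?_ ?_ ?_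
  -- Each value has the form `x v - x (σ v)`, so the sum over all vertices telescopes under the
  -- permutation.
  · have h : ∀ v, (γ v * (qpow q (ix v))⁻¹) • (e k v - (q ^ 2)⁻¹ • e k (σ v))
        = (γ v * (qpow q (ix v))⁻¹) • e k v
          - (γ (σ v) * (qpow q (ix (σ v)))⁻¹) • e k (σ v) := by
      intro v
      rw [hγ, hix, qpow_add_one hq, mul_inv]
      module
    simp_rw [h]
    rw [Finset.sum_sub_distrib,
      Equiv.sum_comp σ (fun v => (γ v * (qpow q (ix v))⁻¹) • e k v), sub_self]
  · intro v
    rw [hκ, AlgHom.id_apply]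
    simp only [mul_smul_comm, smul_mul_assoc, mul_sub, sub_mul, e_mul_self,
      e_mul_e_of_ne (hne v)]
    module
  · intro v w hvw
    rw [hκ, AlgHom.id_apply]
    simp only [mul_smul_comm, smul_mul_assoc, mul_sub, sub_mul, e_mul_e_of_ne hvw,
      e_mul_e_of_ne (fun h => hvw (σ.injective h))]
    -- The only pair of distinct vertices where the two terms do not vanish separately; there the
    -- values of the character at neighbouring vertices make them cancel.
    by_cases h : v = σ w
    · rw [h, hγ, hix, qpow_add_one hq, mul_inv]
      module
    · rw [e_mul_e_of_ne h]
      simp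
  · intro a
    rw [AlgHom.id_apply]
    simp only [mul_add, mul_sub, mul_smul_comm, smul_mul_assoc, sub_mul, e_src_mul_arr, hs, hsσ,
      hsσ']
    module
  · intro a
    rw [AlgHom.id_apply, hκ]
    have h1 : arr k a * e k (σ (Q.t a)) = 0 := arr_mul_e_of_ne (hne _)
    simp only [add_mul, mul_sub, mul_smul_comm, smul_mul_assoc, sub_mul, arr_mul_e_tgt, ht, htσ,
      h1]
    module

/-- Skew derivations of the type of `F`. -/
theorem exists_skew_F (γ : Q.V → k) (hγ : ∀ v, γ (σ v) = γ v)
    (κ : PathAlgebra k Q →ₐ[k] PathAlgebra k Q) (hκ : ∀ v, κ (e k v) = e k (σ.symm v))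
    (η : Q.A → PathAlgebra k Q) (hs : ∀ a, e k (σ.symm (Q.s a)) * η a = η a)
    (ht : ∀ a, η a * e k (Q.t a) = η a) :
    ∃ D : PathAlgebra k Q →ₗ[k] PathAlgebra k Q,
      (∀ a b, D (a * b) = κ a * D b + D a * b) ∧
      (∀ v, D (e k v) = (γ v * qpow q (ix v)) • (e k (σ.symm v) - q ^ 2 • e k v)) ∧
      ∀ a, D (arr k a) = (γ (Q.t a) * qpow q (ix (Q.t a))) • κ (arr k a)
        - (γ (Q.s a) * (qpow q (ix (Q.s a)) * q ^ 2)) • arr k a + η a := by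
  have hne : ∀ v, σ.symm v ≠ v := fun v h => by
    have h1 := hix (σ.symm v)
    rw [Equiv.apply_symm_apply, h] at h1
    exact ZMod.self_ne_add_one hn _ h1
  have hsσ : ∀ a, e k (σ.symm (Q.s a)) * κ (arr k a) = κ (arr k a) := fun a => by
    rw [← hκ, ← map_mul, e_src_mul_arr]
  have htσ : ∀ a, κ (arr k a) * e k (σ.symm (Q.t a)) = κ (arr k a) := fun a => by
    rw [← hκ, ← map_mul, arr_mul_e_tgt]
  have htσ' : ∀ a, κ (arr k a) * e k (Q.t a) = 0 := fun a => by
    rw [← htσ, mul_assoc, e_mul_e_of_ne (hne _), mul_zero]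
  refine exists_skew κ (AlgHom.id k _) _ _ ?_ ?_ ?_ ?_ ?_
  · have h : ∀ v, (γ v * qpow q (ix v)) • (e k (σ.symm v) - q ^ 2 • e k v)
        = (γ (σ (σ.symm v)) * qpow q (ix (σ (σ.symm v)))) • e k (σ.symm v)
          - (γ (σ v) * qpow q (ix (σ v))) • e k v := by
      intro v
      rw [Equiv.apply_symm_apply, hγ, hix, qpow_add_one hq]
      module
    simp_rw [h]
    rw [Finset.sum_sub_distrib,
      Equiv.sum_comp σ.symm (fun v => (γ (σ v) * qpow q (ix (σ v))) • e k v), sub_self]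
  · intro v
    rw [hκ, AlgHom.id_apply]
    simp only [mul_smul_comm, smul_mul_assoc, mul_sub, sub_mul, e_mul_self,
      e_mul_e_of_ne (hne v)]
    module
  · intro v w hvw
    rw [hκ, AlgHom.id_apply]
    simp only [mul_smul_comm, smul_mul_assoc, mul_sub, sub_mul, e_mul_e_of_ne hvw,
      e_mul_e_of_ne (fun h => hvw (σ.symm.injective h))]
    by_cases h : v = σ w
    · rw [h, hγ, hix, qpow_add_one hq, Equiv.symm_apply_apply]
      module
    · rw [e_mul_e_of_ne (fun h' => h ((Equiv.symm_apply_eq σ).mp h'))]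
      simp
  · intro a
    rw [AlgHom.id_apply, hκ]
    have h1 : e k (σ.symm (Q.s a)) * arr k a = 0 := e_mul_arr_of_ne (hne _)
    simp only [mul_add, mul_sub, mul_smul_comm, smul_mul_assoc, sub_mul, e_src_mul_arr, hs, hsσ,
      h1]
    module
  · intro a
    rw [AlgHom.id_apply]
    simp only [add_mul, mul_sub, mul_smul_comm, smul_mul_assoc, sub_mul, arr_mul_e_tgt, ht, htσ,
      htσ']
    module

/-- The operators of an action with prescribed values on the trivial paths and the arrows. -/
theorem exists_operators (γE γF : Q.V → k) (hγE : ∀ v, γE (σ v) = γE v)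
    (hγF : ∀ v, γF (σ v) = γF v) (hσ : ∀ v, (σ ^ n) v = v)
    (ka ηE ηF : Q.A → PathAlgebra k Q)
    (hKs : ∀ a, e k (σ (Q.s a)) * ka a = ka a) (hKt : ∀ a, ka a * e k (σ (Q.t a)) = ka a)
    (hEs : ∀ a, e k (Q.s a) * ηE a = ηE a) (hEt : ∀ a, ηE a * e k (σ (Q.t a)) = ηE a)
    (hFs : ∀ a, e k (σ.symm (Q.s a)) * ηF a = ηF a) (hFt : ∀ a, ηF a * e k (Q.t a) = ηF a) :
    ∃ (κ : PathAlgebra k Q →ₐ[k] PathAlgebra k Q) (D D' : Module.End k (PathAlgebra k Q)),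
      (∀ v, κ (e k v) = e k (σ v)) ∧ (∀ a, κ (arr k a) = ka a) ∧
      (∀ a b, D (a * b) = a * D b + D a * κ b) ∧
      (∀ a b, D' (a * b) = (κ.toLinearMap ^ (n - 1)) a * D' b + D' a * b) ∧
      (∀ v, D (e k v) = (γE v * (qpow q (ix v))⁻¹) • (e k v - (q ^ 2)⁻¹ • e k (σ v))) ∧
      (∀ a, D (arr k a) = (γE (Q.t a) * (qpow q (ix (Q.t a)))⁻¹) • arr k a
        - (γE (Q.s a) * ((qpow q (ix (Q.s a)))⁻¹ * (q ^ 2)⁻¹)) • ka a + ηE a) ∧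
      (∀ v, D' (e k v) = (γF v * qpow q (ix v)) • (e k (σ.symm v) - q ^ 2 • e k v)) ∧
      ∀ a, D' (arr k a) = (γF (Q.t a) * qpow q (ix (Q.t a))) • (κ.toLinearMap ^ (n - 1)) (arr k a)
        - (γF (Q.s a) * (qpow q (ix (Q.s a)) * q ^ 2)) • arr k a + ηF a := by
  obtain ⟨κ, hκ, hκa⟩ := exists_algHom σ ka hKs hKt
  have hpow : ∀ (m : ℕ) x, (κ ^ m) x = (κ.toLinearMap ^ m) x := by
    intro m
    induction m with
    | zero => intro x; rfl
    | succ m ih => intro x; rw [pow_succ', pow_succ', AlgHom.mul_apply, ih]; rfl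
  have hpe : ∀ (m : ℕ) v, (κ ^ m) (e k v) = e k ((σ ^ m) v) := by
    intro m
    induction m with
    | zero => intro v; rfl
    | succ m ih => intro v; rw [pow_succ', AlgHom.mul_apply, ih, hκ, pow_succ', Equiv.Perm.mul_apply]
  have hκ' : ∀ v, (κ ^ (n - 1)) (e k v) = e k (σ.symm v) := by
    intro v
    rw [hpe]
    congr 1
    rw [Equiv.eq_symm_apply, ← Equiv.Perm.mul_apply, ← pow_succ',
      Nat.sub_add_cancel (Nat.one_le_iff_ne_zero.mpr (NeZero.ne n)), hσ]
  obtain ⟨D, hD, hDe, hDa⟩ := exists_skew_E hq hn σ ix hix γE hγE κ hκ ηE hEs hEt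
  obtain ⟨D', hD', hDe', hDa'⟩ := exists_skew_F hq hn σ ix hix γF hγF (κ ^ (n - 1)) hκ' ηF hFs hFt
  refine ⟨κ, D, D', hκ, hκa, hD, fun a b => ?_, hDe, fun a => ?_, hDe', fun a => ?_⟩
  · rw [hD', hpow]
  · rw [hDa, hκa]
  · rw [hDa', hpow]

end skew
end PathAlgebra

/-! ## Rescaling a family on which `K` shifts the indices up to scalars -/

section Rescale
variable {k : Type*} [Field k] {n : ℕ} [NeZero n] {M : Type*} [AddCommGroup M] [Module k M]
  {T : Module.End k M} (hT : T ^ n = 1) {b : ZMod n → ZMod n → M}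
include hT

theorem apply_eq_zero_of_pow_eq_one {x : M} (h : T x = 0) : x = 0 := by
  have h1 := LinearMap.congr_fun hT x
  rw [← Nat.sub_add_cancel (Nat.one_le_iff_ne_zero.mpr (NeZero.ne n)), pow_succ,
    Module.End.mul_apply, h, map_zero] at h1
  exact h1.symm

/-- `T` is invertible, so a zero scalar would force `b i j = 0`, and then its shift vanishes as
well. Where `T` already shifts exactly, the scalar one is chosen; this keeps trivial paths
normalised even if they are absent. -/
theorem exists_units_smul (hz : ∀ i j, b i j = 0 → b (i + 1) (j + 1) = 0)
    (h : ∀ i j, ∃ a : k, T (b i j) = a • b (i + 1) (j + 1)) :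
    ∃ μ : ZMod n → ZMod n → kˣ, (∀ i j, T (b i j) = b (i + 1) (j + 1) → μ i j = 1) ∧
      ∀ i j, T (b i j) = (μ i j : k) • b (i + 1) (j + 1) := by
  classical
  choose a ha using h
  have h0 : ∀ i j, ¬ T (b i j) = b (i + 1) (j + 1) → a i j ≠ 0 := by
    intro i j hne h
    have h1 := ha i j
    rw [h, zero_smul] at h1
    rw [h1, hz i j (apply_eq_zero_of_pow_eq_one hT h1)] at hne
    exact hne rfl
  refine ⟨fun i j => if h : T (b i j) = b (i + 1) (j + 1) then 1 else Units.mk0 _ (h0 i j h),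
    fun i j h => dif_pos h, fun i j => ?_⟩
  by_cases h : T (b i j) = b (i + 1) (j + 1)
  · simp [h]
  · simp only [dif_neg h, Units.val_mk0]
    exact ha i j

variable {μ : ZMod n → ZMod n → kˣ} (h : ∀ i j, T (b i j) = (μ i j : k) • b (i + 1) (j + 1))
include h

omit [NeZero n] in
theorem prod_units_eq_one {i j : ZMod n} (hb : b i j ≠ 0) :
    ∏ l ∈ Finset.range n, μ (i + (l : ZMod n)) (j + (l : ZMod n)) = 1 := by
  have key : ∀ m : ℕ, (T ^ m) (b i j)
      = ((∏ l ∈ Finset.range m, μ (i + (l : ZMod n)) (j + (l : ZMod n)) : kˣ) : k)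
        • b (i + m) (j + m) := by
    intro m
    induction m with
    | zero => simp
    | succ m ih =>
      rw [pow_succ', Module.End.mul_apply, ih, map_smul, h, smul_smul, Finset.prod_range_succ,
        Units.val_mul]
      push_cast
      simp only [add_assoc]
  have h1 := key n
  rw [hT, Module.End.one_apply, CharP.cast_eq_zero, add_zero, add_zero] at h1
  have h2 : (((∏ l ∈ Finset.range n, μ (i + (l : ZMod n)) (j + (l : ZMod n)) : kˣ) : k) - 1)
      • b i j = 0 := by rw [sub_smul, ← h1, one_smul, sub_self]
  exact Units.ext (sub_eq_zero.mp ((smul_eq_zero.mp h2).resolve_right hb))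

/-- Each orbit starts at first index zero, and its members are multiplied by the partial products of
`μ`. This works by construction at every step but the last, where the orbit closes because the full
product is one. -/
theorem exists_rescaling : ∃ ν : ZMod n → ZMod n → kˣ,
    ((∀ i, μ i i = 1) → ∀ i, ν i i = 1) ∧
    ∀ i j, T ((ν i j : k) • b i j) = (ν (i + 1) (j + 1) : k) • b (i + 1) (j + 1) := by
  -- The difference `j - i` labels the orbit of `(i, j)`, and `i.val` is the position in it.
  let ν : ZMod n → ZMod n → kˣ := fun i j =>
    ∏ l ∈ Finset.range i.val, μ (l : ZMod n) (j - i + (l : ZMod n))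
  refine ⟨ν, fun hμ i => ?_, fun i j => ?_⟩
  · refine Finset.prod_eq_one fun l _ => ?_
    rw [sub_self, zero_add, hμ]
  · by_cases hb : b i j = 0
    · have h1 := h i j
      rw [hb, map_zero] at h1
      rw [hb, smul_zero, map_zero,
        (smul_eq_zero.mp h1.symm).resolve_left (Units.ne_zero _), smul_zero]
    · rw [map_smul, h, smul_smul]
      congr 1
      rw [← Units.val_mul]
      congr 1
      have hstep : ν i j * μ i j
          = ∏ l ∈ Finset.range (i.val + 1), μ (l : ZMod n) (j - i + (l : ZMod n)) := by
        rw [Finset.prod_range_succ, ZMod.natCast_zmod_val, sub_add_cancel]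
      rw [hstep]
      have hlt := ZMod.val_lt i
      -- At the wrap from the last position to the first, the partial product has become the full
      -- product around a nonzero orbit.
      by_cases hi : i.val + 1 = n
      · have hi0 : i + 1 = 0 := by
          have : ((i.val + 1 : ℕ) : ZMod n) = 0 := by rw [hi]; simp
          simpa using this
        have hν : ν (i + 1) (j + 1) = 1 := by
          simp only [ν, hi0, ZMod.val_zero, Finset.range_zero, Finset.prod_empty]
        rw [hν, hi]
        have hb' : ∀ m : ℕ, b (i + m) (j + m) ≠ 0 := by
          intro m
          induction m with
          | zero => simpa using hb
          | succ m ih =>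
            intro h0
            have h1 := h (i + m) (j + m)
            push_cast at h0
            rw [add_assoc, add_assoc, h0, smul_zero] at h1
            exact ih (apply_eq_zero_of_pow_eq_one hT h1)
        have h1 := prod_units_eq_one hT h (hb' 1)
        rw [Nat.cast_one, hi0] at h1
        have hj : j + 1 = j - i := by
          rw [eq_neg_of_add_eq_zero_left hi0]; ring
        rw [hj] at h1
        simpa using h1
      · have hval : (i + 1).val = i.val + 1 := by
          have h1n : 1 < n := by omega
          have : Fact (1 < n) := ⟨h1n⟩
          rw [ZMod.val_add, ZMod.val_one, Nat.mod_eq_of_lt (by omega)]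
        simp only [ν, hval, add_sub_add_right_eq_sub]

end Rescale

/-! ## Translating the formulas -/

section Formulas
variable {k : Type*} [Field k] {n : ℕ} [NeZero n] {q : k} [hq : Fact (IsPrimitiveRoot q (2 * n))]

theorem formulasVert_iff {Q : Quiv} (α : HopfAction k (Uq n q) (PathAlgebra k Q))
    (v : ZMod n → PathAlgebra k Q) (γE γF : k) (i : ZMod n) :
    FormulasVert α v γE γF i ↔
      α.act (Uq.E n q) (v i) = (γE * (qpow q i)⁻¹) • (v i - (q ^ 2)⁻¹ • v (i + 1)) ∧
      α.act (Uq.F n q) (v i) = (γF * qpow q i) • (v (i - 1) - q ^ 2 • v i) := by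
  rw [FormulasVert, zpow_neg_two_mul_val, zpow_two_mul_val]

theorem formulasA_iff {P : (completeQuiver n).Sub}
    (α : HopfAction k (Uq n q) (PathAlgebra k P.toQuiv))
    (a : ZMod n → ZMod n → PathAlgebra k P.toQuiv) (p : ParamsA k n) :
    FormulasA α a p ↔ ∀ i j, ExA P i j →
      α.act (Uq.E n q) (a i j) = (p.γE * (qpow q j)⁻¹) • a i j
        - (p.γE * ((qpow q i)⁻¹ * (q ^ 2)⁻¹)) • a (i + 1) (j + 1) + p.lE i j • a i (j + 1) ∧
      α.act (Uq.F n q) (a i j) = (p.γF * qpow q j) • a (i - 1) (j - 1)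
        - (p.γF * (qpow q i * q ^ 2)) • a i j + p.lF i j • a (i - 1) j := by
  have h0 := Uq.q_ne_zero hq.out
  simp only [FormulasA, zpow_neg_two_mul_val, zpow_two_mul_val, zpow_neg_two_mul_val_sub h0,
    zpow_two_mul_val_add h0, smul_sub, smul_smul]

theorem formulasB_iff {P : (bipartiteQuiver n).Sub}
    (α : HopfAction k (Uq n q) (PathAlgebra k P.toQuiv))
    (b : ZMod n → ZMod n → PathAlgebra k P.toQuiv) (p : ParamsB k n) :
    FormulasB α b p ↔
      (∀ i : ZMod n, (Sum.inl i : ZMod n ⊕ ZMod n) ∈ P.verts →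
        FormulasVert α (fun l => vertB k P (Sum.inl l)) p.γEp p.γFp i) ∧
      (∀ j : ZMod n, (Sum.inr j : ZMod n ⊕ ZMod n) ∈ P.verts →
        FormulasVert α (fun l => vertB k P (Sum.inr l)) p.γEm p.γFm j) ∧
      ∀ i j, ExB P i j →
        α.act (Uq.E n q) (b i j) = (p.γEm * (qpow q j)⁻¹) • b i j
          - (p.γEp * ((qpow q i)⁻¹ * (q ^ 2)⁻¹)) • b (i + 1) (j + 1) + p.lE i j • b i (j + 1) ∧
        α.act (Uq.F n q) (b i j) = (p.γFm * qpow q j) • b (i - 1) (j - 1)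
          - (p.γFp * (qpow q i * q ^ 2)) • b i j + p.lF i j • b (i - 1) j := by
  have h0 := Uq.q_ne_zero hq.out
  simp only [FormulasB, zpow_neg_two_mul_val, zpow_two_mul_val, zpow_neg_two_mul_val_sub h0,
    zpow_two_mul_val_add h0]

theorem VertexOrbit.formulasVert {Q : Quiv} {α : HopfAction k (Uq n q) (PathAlgebra k Q)}
    {v : ZMod n → PathAlgebra k Q} {γE γF : k}
    (h : VertexOrbit q (α.act (Uq.K n q)) (α.act (Uq.E n q)) (α.act (Uq.F n q)) v γE γF)
    (i : ZMod n) : FormulasVert α v γE γF i :=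
  (formulasVert_iff α v γE γF i).mpr ⟨h.hE i, h.hF i⟩

end Formulas

/-! ### Shift-stable properties of residues -/

theorem ZMod.iff_add_one {n : ℕ} [NeZero n] {p : ZMod n → Prop} (h : ∀ i, p i → p (i + 1))
    (i : ZMod n) : p (i + 1) ↔ p i := by
  refine ⟨fun hi => ?_, h i⟩
  have key : ∀ l : ℕ, p (i + 1 + l) := by
    intro l
    induction l with
    | zero => simpa using hi
    | succ l ih => push_cast; rw [← add_assoc]; exact h _ ih
  have := key (n - 1)
  rw [Nat.cast_sub (NeZero.pos n)] at this
  simpa using this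

/-- Hence a stable subquiver contains an orbit of vertices entirely or not at all. -/
theorem ZMod.forall_of_exists {n : ℕ} [NeZero n] {p : ZMod n → Prop} (h : ∀ i, p i → p (i + 1))
    {i : ZMod n} (hi : p i) (j : ZMod n) : p j := by
  have h0 : ∀ i, p i = p 0 :=
    ZMod.eq_of_add_one (g := p) fun i => propext (ZMod.iff_add_one h i)
  rw [h0, ← h0 i]
  exact hi

theorem ZMod.addRight_one_pow {n : ℕ} (v : ZMod n) (m : ℕ) :
    ((Equiv.addRight (1 : ZMod n)) ^ m) v = v + m := by
  induction m with
  | zero => simp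
  | succ m ih => rw [pow_succ', Equiv.Perm.mul_apply, ih]; simp [add_assoc]

/-! ## Quivers without arrows -/

section Discrete
open PathAlgebra
variable {k : Type*} [Field k] {n : ℕ} [NeZero n] {q : k} [hq : Fact (IsPrimitiveRoot q (2 * n))]

/-- Without arrows the filtration is trivial, so its preservation is no restriction on an action. -/
theorem mem_filt_zero_discrete {m : ℕ} [NeZero m] (x : PathAlgebra k (discreteQuiver m)) :
    x ∈ filt k (discreteQuiver m) 0 := by
  induction x using PathAlgebra.induction with
  | hgen x hx =>
    rcases hx with ⟨v, rfl⟩ | ⟨a, -⟩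
    · exact e_mem_filt v 0
    · exact a.elim
  | halg c =>
    rw [Algebra.algebraMap_eq_smul_one]
    exact Submodule.smul_mem _ _ (one_mem_filt 0)
  | hadd a b ha hb => exact Submodule.add_mem _ ha hb
  | hmul a b ha hb =>
    have h : a * b ∈ filt k (discreteQuiver m) (0 + 0) := mul_mem_filt ha hb
    rwa [add_zero] at h

/-- The vertex `i` of the quiver without arrows. -/
def discreteVertex {m : ℕ} [NeZero m] (i : ZMod m) : (discreteQuiver m).V := i

theorem discreteVertex_injective {m : ℕ} [NeZero m] :
    Function.Injective (discreteVertex : ZMod m → (discreteQuiver m).V) := fun _ _ h => h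

theorem gens_discrete {m : ℕ} [NeZero m] {x : PathAlgebra k (discreteQuiver m)}
    (hx : x ∈ gens k (discreteQuiver m)) : ∃ i : ZMod m, e k (discreteVertex i) = x := by
  rcases hx with ⟨v, rfl⟩ | ⟨a, -⟩
  · exact ⟨v, rfl⟩
  · exact a.elim

theorem PathAlgebra.e_injective {Q : Quiv} : Function.Injective (e k : Q.V → PathAlgebra k Q) := by
  intro v w h
  by_contra hne
  have h1 := e_mul_e_of_ne (k := k) hne
  rw [← h, e_mul_self] at h1
  exact e_ne_zero v h1

/-- `E` and `F` vanish on trivial paths: for one vertex because that path is the unit, otherwise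
because the orbit is too short. The product rule makes them vanish everywhere. The commutator
relation then forces `K` and `K⁻¹` to agree on vertices, so the orbit length divides two. -/
theorem discrete_of_lt (hn : 2 ≤ n) (m : ℕ) [NeZero m] (hmn : m < n)
    (α : HopfAction k (Uq n q) (PathAlgebra k (discreteQuiver m)))
    (hK : ∀ i : ZMod m, α.act (Uq.K n q) (e k (discreteVertex i))
      = e k (discreteVertex (i + 1))) :
    (m = 1 ∨ m = 2) ∧
      ∀ h ∈ TwoSidedIdeal.span ({Uq.E n q, Uq.F n q} : Set (Uq n q)), α.act h = 0 := by
  have h0 : ∀ v : ZMod m, α.act (Uq.E n q) (e k (discreteVertex v)) = 0 ∧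
      α.act (Uq.F n q) (e k (discreteVertex v)) = 0 := by
    by_cases hm : m = 1
    · subst hm
      intro v
      have h1 : e k (discreteVertex v) = 1 := by
        have : Subsingleton (discreteQuiver 1).V := inferInstanceAs (Subsingleton (ZMod 1))
        exact (Fintype.sum_subsingleton _ (discreteVertex v)).symm.trans sum_e
      rw [h1]
      exact ⟨α.act_E_one, α.act_F_one⟩
    · have := NeZero.ne m
      exact α.vertex_eq_zero (m := m) (w := discreteVertex)
        (by omega) hmn discreteVertex_injective hK (fun i => mem_filt_zero_discrete _)
        (fun i => mem_filt_zero_discrete _)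
  have hE : α.act (Uq.E n q) = 0 := by
    refine linearMap_eq_zero _ (fun a b ha hb => ?_) ?_
    · rw [α.act_E_mul, ha, hb, mul_zero, zero_mul, add_zero]
    · intro x hx
      obtain ⟨i, rfl⟩ := gens_discrete hx
      exact (h0 i).1
  have hF : α.act (Uq.F n q) = 0 := by
    refine linearMap_eq_zero _ (fun a b ha hb => ?_) ?_
    · rw [α.act_F_mul, ha, hb, mul_zero, zero_mul, add_zero]
    · intro x hx
      obtain ⟨i, rfl⟩ := gens_discrete hx
      exact (h0 i).2
  constructor
  · have h1 := α.act_EF_sub_FE (e k (discreteVertex (0 : ZMod m)))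
    rw [hE, hF, LinearMap.zero_apply, sub_self, hK,
      α.act_Kinv_of_act_K (v := fun i : ZMod m => e k (discreteVertex i)) hK] at h1
    have hne : (q - q⁻¹)⁻¹ ≠ 0 := by
      rw [sub_inv_eq hq.out]
      exact inv_ne_zero (mul_ne_zero (inv_ne_zero (Uq.q_ne_zero hq.out))
        (sq_sub_one_ne_zero hn hq.out))
    have h2 := sub_eq_zero.mp ((smul_eq_zero.mp h1.symm).resolve_left hne)
    have h3 : (0 + 1 : ZMod m) = 0 - 1 := discreteVertex_injective (e_injective h2)
    have h4 : ((2 : ℕ) : ZMod m) = 0 := by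
      push_cast
      rw [← one_add_one_eq_two]
      rw [zero_add, zero_sub] at h3
      nth_rewrite 1 [h3]
      rw [neg_add_cancel]
    rw [ZMod.natCast_eq_zero_iff] at h4
    exact (Nat.dvd_prime Nat.prime_two).mp h4
  · have h1 : TwoSidedIdeal.span ({Uq.E n q, Uq.F n q} : Set (Uq n q))
        ≤ TwoSidedIdeal.ker α.act := by
      rw [TwoSidedIdeal.span_le]
      rintro x (rfl | rfl)
      · exact (TwoSidedIdeal.mem_ker _).mpr hE
      · exact (TwoSidedIdeal.mem_ker _).mpr hF
    intro h hh
    exact (TwoSidedIdeal.mem_ker _).mp (h1 hh)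

theorem discrete_exists_scalars (hn : 2 ≤ n)
    (α : HopfAction k (Uq n q) (PathAlgebra k (discreteQuiver n)))
    (hK : ∀ i : ZMod n, α.act (Uq.K n q) (e k (discreteVertex i))
      = e k (discreteVertex (i + 1))) :
    ∃ γE γF : k, (3 ≤ n → GammaCond q γE γF) ∧
      ∀ i : ZMod n, FormulasVert α (fun l : ZMod n => e k (discreteVertex l)) γE γF i := by
  obtain ⟨γE, γF, hγ, h⟩ := α.exists_vertexOrbit hn
    (w := discreteVertex) (fun _ _ h => h) hK
    (fun i => mem_filt_zero_discrete _) (fun i => mem_filt_zero_discrete _)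
  exact ⟨γE, γF, hγ, fun i => h.formulasVert i⟩

theorem discrete_existsUnique (hn : 2 ≤ n) (γE γF : k) (hγ : 3 ≤ n → GammaCond q γE γF) :
    ∃! α : HopfAction k (Uq n q) (PathAlgebra k (discreteQuiver n)),
      (∀ i : ZMod n, α.act (Uq.K n q) (e k (discreteVertex i))
        = e k (discreteVertex (i + 1))) ∧
      ∀ i : ZMod n, FormulasVert α (fun l : ZMod n => e k (discreteVertex l)) γE γF i := by
  refine existsUnique_of_exists_of_unique ?_ ?_
  · let σ : Equiv.Perm (discreteQuiver n).V := (Equiv.addRight (1 : ZMod n) : Equiv.Perm (ZMod n))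
    obtain ⟨κ, D, D', hκ, -, hD, hD', hDe, -, hDe', -⟩ :=
      exists_operators (k := k) (Q := discreteQuiver n) hq.out hn σ
        (fun v : ZMod n => v) (fun v => rfl) (fun _ => γE) (fun _ => γF) (fun _ => rfl)
        (fun _ => rfl) (fun v => (ZMod.addRight_one_pow (n := n) v n).trans
          (by rw [CharP.cast_eq_zero]; exact add_zero (M := ZMod n) v))
        (fun a => a.elim) (fun a => a.elim) (fun a => a.elim) (fun a => a.elim) (fun a => a.elim)
        (fun a => a.elim) (fun a => a.elim) (fun a => a.elim) (fun a => a.elim)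
    have hsymm : ∀ i : ZMod n, σ.symm (discreteVertex i) = discreteVertex (i - 1) :=
      fun i => (sub_eq_add_neg i 1).symm
    have hV : VertexOrbit q κ.toLinearMap D D'
        (fun i : ZMod n => e k (discreteVertex i)) γE γF :=
      ⟨fun i => hκ (discreteVertex i), fun i => hDe (discreteVertex i), fun i => by
        rw [← hsymm]; exact hDe' (discreteVertex i)⟩
    obtain ⟨α, hαK, hαE, hαF⟩ := HopfAction.exists_of_relationsAt (n := n) (q := q) hD hD' (by
      intro x hx
      obtain ⟨i, rfl⟩ := gens_discrete hx
      exact hV.relationsAt hq.out hn hγ i)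
    rw [← hαK, ← hαE, ← hαF] at hV
    exact ⟨α, hV.hK, fun i => hV.formulasVert i⟩
  · rintro α β ⟨hαK, hα⟩ ⟨hβK, hβ⟩
    refine HopfAction.ext_gens fun x hx => ?_
    obtain ⟨v, rfl⟩ := gens_discrete hx
    exact ⟨(hαK v).trans (hβK v).symm, (hα v).1.trans (hβ v).1.symm,
        (hα v).2.trans (hβ v).2.symm⟩

end Discrete

/-! ## Filtered actions with prescribed values on generators -/

namespace PathAlgebra
variable {k : Type*} [Field k] {Q : Quiv}

/-- The values of `K`, `E`, `F` on the trivial paths and the arrows. -/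
structure GeneratorValues {n : ℕ} [NeZero n] (q : k) (σ : Equiv.Perm Q.V) (ix : Q.V → ZMod n)
    (γE γF : Q.V → k) (ka ηE ηF : Q.A → PathAlgebra k Q)
    (κ D D' : Module.End k (PathAlgebra k Q)) : Prop where
  Ke : ∀ v, κ (e k v) = e k (σ v)
  Ka : ∀ a, κ (arr k a) = ka a
  Ee : ∀ v, D (e k v) = (γE v * (qpow q (ix v))⁻¹) • (e k v - (q ^ 2)⁻¹ • e k (σ v))
  Ea : ∀ a, D (arr k a) = (γE (Q.t a) * (qpow q (ix (Q.t a)))⁻¹) • arr k a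
    - (γE (Q.s a) * ((qpow q (ix (Q.s a)))⁻¹ * (q ^ 2)⁻¹)) • ka a + ηE a
  Fe : ∀ v, D' (e k v) = (γF v * qpow q (ix v)) • (e k (σ.symm v) - q ^ 2 • e k v)
  Fa : ∀ a, D' (arr k a) = (γF (Q.t a) * qpow q (ix (Q.t a))) • (κ ^ (n - 1)) (arr k a)
    - (γF (Q.s a) * (qpow q (ix (Q.s a)) * q ^ 2)) • arr k a + ηF a

/-- The relations are required of all operators with the prescribed values, because the operators
are only constructed inside the proof. -/
theorem exists_filtered_action {n : ℕ} [NeZero n] {q : k} [hq : Fact (IsPrimitiveRoot q (2 * n))]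
    (hn : 2 ≤ n) (σ : Equiv.Perm Q.V) (ix : Q.V → ZMod n) (hix : ∀ v, ix (σ v) = ix v + 1)
    (γE γF : Q.V → k) (hγE : ∀ v, γE (σ v) = γE v)
    (hγF : ∀ v, γF (σ v) = γF v) (hσ : ∀ v, (σ ^ n) v = v)
    (ka ηE ηF : Q.A → PathAlgebra k Q)
    (hKs : ∀ a, e k (σ (Q.s a)) * ka a = ka a) (hKt : ∀ a, ka a * e k (σ (Q.t a)) = ka a)
    (hEs : ∀ a, e k (Q.s a) * ηE a = ηE a) (hEt : ∀ a, ηE a * e k (σ (Q.t a)) = ηE a)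
    (hFs : ∀ a, e k (σ.symm (Q.s a)) * ηF a = ηF a) (hFt : ∀ a, ηF a * e k (Q.t a) = ηF a)
    (hka : ∀ a, ka a ∈ filt k Q 1) (hηE : ∀ a, ηE a ∈ filt k Q 1) (hηF : ∀ a, ηF a ∈ filt k Q 1)
    (hrel : ∀ κ D D', GeneratorValues q σ ix γE γF ka ηE ηF κ D D' →
      ∀ x ∈ gens k Q, RelationsAt n q κ D D' x) :
    ∃ α : HopfAction k (Uq n q) (PathAlgebra k Q), α.Filtered ∧
      GeneratorValues q σ ix γE γF ka ηE ηF (α.act (Uq.K n q)) (α.act (Uq.E n q))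
        (α.act (Uq.F n q)) := by
  obtain ⟨κ, D, D', hKe, hKa, hD, hD', hEe, hEa, hFe, hFa⟩ :=
    exists_operators hq.out hn σ ix hix γE γF hγE hγF hσ ka ηE ηF hKs hKt hEs hEt hFs hFt
  have V : GeneratorValues q σ ix γE γF ka ηE ηF κ.toLinearMap D D' :=
    ⟨hKe, hKa, hEe, hEa, hFe, hFa⟩
  have hKf : ∀ d, ∀ x ∈ filt k Q d, κ.toLinearMap x ∈ filt k Q d :=
    algHom_mem_filt (fun v => by rw [hKe]; exact e_mem_filt _ _) (fun a => by rw [hKa]; exact hka a)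
  have hKp : ∀ m a, (κ.toLinearMap ^ m) (arr k a) ∈ filt k Q 1 := by
    intro m a
    induction m with
    | zero => exact arr_mem_filt a le_rfl
    | succ m ih => rw [pow_succ', Module.End.mul_apply]; exact hKf 1 _ ih
  obtain ⟨α, hαK, hαE, hαF⟩ := HopfAction.exists_of_relationsAt hD hD' (hrel _ _ _ V)
  rw [← hαK, ← hαE, ← hαF] at V
  refine ⟨α, HopfAction.filtered_of_gens (fun v => ?_) (fun a => ?_) (fun v => ?_) (fun a => ?_)
    (fun v => ?_) (fun a => ?_), V⟩
  · rw [V.Ke]; exact e_mem_filt _ _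
  · rw [V.Ka]; exact hka a
  · rw [V.Ee]
    exact Submodule.smul_mem _ _ (Submodule.sub_mem _ (e_mem_filt _ _)
      (Submodule.smul_mem _ _ (e_mem_filt _ _)))
  · rw [V.Ea]
    exact Submodule.add_mem _ (Submodule.sub_mem _ (Submodule.smul_mem _ _ (arr_mem_filt a le_rfl))
      (Submodule.smul_mem _ _ (hka a))) (hηE a)
  · rw [V.Fe]
    exact Submodule.smul_mem _ _ (Submodule.sub_mem _ (e_mem_filt _ _)
      (Submodule.smul_mem _ _ (e_mem_filt _ _)))
  · rw [V.Fa, hαK]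
    exact Submodule.add_mem _ (Submodule.sub_mem _ (Submodule.smul_mem _ _ (hKp _ a))
      (Submodule.smul_mem _ _ (arr_mem_filt a le_rfl))) (hηF a)

end PathAlgebra

/-- Turns the shift of indices into a permutation of the vertices of a stable subquiver. -/
theorem exists_perm_of_injective {V X : Type*} [Finite V] {ix : V → X}
    (hix : Function.Injective ix) {g : X → X} (hg : Function.Injective g)
    (h : ∀ v, ∃ w, ix w = g (ix v)) : ∃ σ : Equiv.Perm V, ∀ v, ix (σ v) = g (ix v) := by
  choose s hs using h
  have hinj : Function.Injective s := fun v w hvw => by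
    have h1 := congrArg ix hvw
    rw [hs, hs] at h1
    exact hix (hg h1)
  exact ⟨Equiv.ofBijective s (Finite.injective_iff_bijective.mp hinj), hs⟩

/-! ## Extending scalars by zero -/

section ExtendByZero
variable {k : Type*} [Field k] {n : ℕ} {c : k} {Ex : ZMod n → ZMod n → Prop}

open Classical in
/-- The scalars `l`, replaced by zero where the arrow does not exist. -/
noncomputable def restrictScalarsTo (Ex : ZMod n → ZMod n → Prop) (l : ZMod n → ZMod n → k)
    (i j : ZMod n) : k :=
  if Ex i j then l i j else 0

variable {l l' : ZMod n → ZMod n → k}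

theorem restrictScalarsTo_of (h : Ex i j) : restrictScalarsTo Ex l i j = l i j := if_pos h

theorem restrictScalarsTo_of_not (h : ¬ Ex i j) : restrictScalarsTo Ex l i j = 0 := if_neg h

theorem restrictScalarsTo_shift (hEx : ∀ i j, Ex (i + 1) (j + 1) ↔ Ex i j)
    (h : ∀ i j, Ex i j → l (i + 1) (j + 1) = c * l i j) (i j : ZMod n) :
    restrictScalarsTo Ex l (i + 1) (j + 1) = c * restrictScalarsTo Ex l i j := by
  by_cases hij : Ex i j
  · rw [restrictScalarsTo_of hij, restrictScalarsTo_of ((hEx i j).mpr hij), h i j hij]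
  · rw [restrictScalarsTo_of_not hij, restrictScalarsTo_of_not (fun h => hij ((hEx i j).mp h)),
      mul_zero]

/-- Replacing a factor at a missing arrow by zero is harmless: the vanishing conditions make the
other factor zero there. -/
theorem restrictScalarsTo_comm (hE : ∀ i j, Ex i j → ¬ Ex i (j + 1) → l i j = 0)
    (hF : ∀ i j, Ex i j → ¬ Ex (i - 1) j → l' i j = 0)
    (h : ∀ i j, Ex i j → l' i j * l (i - 1) j = l i j * l' i (j + 1)) (i j : ZMod n) :
    restrictScalarsTo Ex l' i j * restrictScalarsTo Ex l (i - 1) j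
      = restrictScalarsTo Ex l i j * restrictScalarsTo Ex l' i (j + 1) := by
  by_cases hij : Ex i j
  · have e1 : l' i j * restrictScalarsTo Ex l (i - 1) j = l' i j * l (i - 1) j := by
      by_cases h1 : Ex (i - 1) j
      · rw [restrictScalarsTo_of h1]
      · rw [hF i j hij h1, zero_mul, zero_mul]
    have e2 : l i j * restrictScalarsTo Ex l' i (j + 1) = l i j * l' i (j + 1) := by
      by_cases h1 : Ex i (j + 1)
      · rw [restrictScalarsTo_of h1]
      · rw [hE i j hij h1, zero_mul, zero_mul]
    rw [restrictScalarsTo_of hij, restrictScalarsTo_of hij, e1, e2, h i j hij]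
  · rw [restrictScalarsTo_of_not hij, restrictScalarsTo_of_not hij, zero_mul, zero_mul]

end ExtendByZero

/-- A product over a full period meets every residue, in particular a zero of `g`. -/
theorem ZMod.prod_range_add_eq_zero {k : Type*} [Field k] {n : ℕ} [NeZero n] {g : ZMod n → k}
    {i : ZMod n} (h : g i = 0) (j : ZMod n) :
    ∏ l ∈ Finset.range n, g (j + (l : ZMod n)) = 0 := by
  refine Finset.prod_eq_zero (Finset.mem_range.mpr (ZMod.val_lt (i - j))) ?_
  rw [ZMod.natCast_zmod_val, add_sub_cancel, h]

/-! ## Subquivers of the complete quiver -/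

section TypeA
open PathAlgebra
variable {k : Type*} [Field k] {n : ℕ} [NeZero n] {P : (completeQuiver n).Sub}

/-- The index of a vertex. -/
def indexA (v : P.toQuiv.V) : ZMod n := v.1

theorem indexA_injective : Function.Injective (indexA : P.toQuiv.V → ZMod n) :=
  Subtype.val_injective

theorem exists_indexA {i : ZMod n} (h : i ∈ P.verts) : ∃ v : P.toQuiv.V, indexA v = i :=
  ⟨⟨i, h⟩, rfl⟩

theorem indexA_mem (v : P.toQuiv.V) : indexA v ∈ P.verts := v.2

theorem e_eq_pathA (v : P.toQuiv.V) : e k v = pathA k P (indexA v) (indexA v) := by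
  rw [pathA, dif_pos rfl, dif_pos (indexA_mem v)]
  rfl

theorem source_ne_target (a : P.toQuiv.A) : indexA (P.toQuiv.s a) ≠ indexA (P.toQuiv.t a) := a.1.2

theorem arr_eq_pathA (a : P.toQuiv.A) :
    arr k a = pathA k P (indexA (P.toQuiv.s a)) (indexA (P.toQuiv.t a)) := by
  have ha : (⟨(indexA (P.toQuiv.s a), indexA (P.toQuiv.t a)), source_ne_target a⟩ :
      {x : ZMod n × ZMod n // x.1 ≠ x.2}) ∈ P.arrows := a.2
  rw [pathA, dif_neg (source_ne_target a), dif_pos ha]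
  rfl

theorem exA_vertex (v : P.toQuiv.V) : ExA P (indexA v) (indexA v) := Or.inl ⟨rfl, indexA_mem v⟩

theorem exA_arrow (a : P.toQuiv.A) : ExA P (indexA (P.toQuiv.s a)) (indexA (P.toQuiv.t a)) :=
  Or.inr ⟨source_ne_target a, a.2⟩

theorem exA_cases {i j : ZMod n} (h : ExA P i j) :
    (∃ v : P.toQuiv.V, indexA v = i ∧ indexA v = j) ∨
      ∃ a : P.toQuiv.A, indexA (P.toQuiv.s a) = i ∧ indexA (P.toQuiv.t a) = j := by
  rcases h with ⟨rfl, hi⟩ | ⟨h, ha⟩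
  · obtain ⟨v, hv⟩ := exists_indexA hi
    exact Or.inl ⟨v, hv, hv⟩
  · exact Or.inr ⟨⟨⟨(i, j), h⟩, ha⟩, rfl, rfl⟩

theorem pathA_of_not {i j : ZMod n} (h : ¬ ExA P i j) : pathA k P i j = 0 := by
  rw [pathA]
  split_ifs with h1 h2 h3
  · exact absurd (Or.inl ⟨h1, h2⟩) h
  · rfl
  · exact absurd (Or.inr ⟨h1, h3⟩) h
  · rfl

theorem pathA_ne_zero_iff {i j : ZMod n} : pathA k P i j ≠ 0 ↔ ExA P i j := by
  refine ⟨fun h => by_contra fun h' => h (pathA_of_not h'), fun h => ?_⟩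
  rcases exA_cases h with ⟨v, rfl, hv⟩ | ⟨a, rfl, rfl⟩
  · rw [← hv, ← e_eq_pathA]
    exact e_ne_zero v
  · rw [← arr_eq_pathA]
    exact arr_ne_zero a

theorem pathA_eq_zero_iff {i j : ZMod n} : pathA k P i j = 0 ↔ ¬ ExA P i j := by
  rw [← pathA_ne_zero_iff (k := k), not_not]

theorem gens_pathA {x : PathAlgebra k P.toQuiv} (hx : x ∈ gens k P.toQuiv) :
    ∃ i j, ExA P i j ∧ x = pathA k P i j := by
  rcases hx with ⟨v, rfl⟩ | ⟨a, rfl⟩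
  · exact ⟨_, _, exA_vertex v, e_eq_pathA v⟩
  · exact ⟨_, _, exA_arrow a, arr_eq_pathA a⟩

theorem pathA_diag_mul (i j : ZMod n) : pathA k P i i * pathA k P i j = pathA k P i j := by
  by_cases h : ExA P i j
  · rcases exA_cases h with ⟨v, rfl, hv⟩ | ⟨a, rfl, rfl⟩
    · rw [← hv, ← e_eq_pathA, e_mul_self]
    · rw [← e_eq_pathA, ← arr_eq_pathA, e_src_mul_arr]
  · rw [pathA_of_not h, mul_zero]

theorem pathA_mul_diag (i j : ZMod n) : pathA k P i j * pathA k P j j = pathA k P i j := by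
  by_cases h : ExA P i j
  · rcases exA_cases h with ⟨v, rfl, hv⟩ | ⟨a, rfl, rfl⟩
    · rw [← hv, ← e_eq_pathA, e_mul_self]
    · rw [← e_eq_pathA, ← arr_eq_pathA, arr_mul_e_tgt]
  · rw [pathA_of_not h, zero_mul]

theorem pathA_diag_mul_diag {i i' : ZMod n} (h : i ≠ i') :
    pathA k P i i * pathA k P i' i' = 0 := by
  by_cases h1 : ExA P i i
  · by_cases h2 : ExA P i' i'
    · have h1' : i ∈ P.verts := h1.elim (fun h => h.2) fun ⟨h, _⟩ => absurd rfl h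
      have h2' : i' ∈ P.verts := h2.elim (fun h => h.2) fun ⟨h, _⟩ => absurd rfl h
      obtain ⟨v, rfl⟩ := exists_indexA h1'
      obtain ⟨w, rfl⟩ := exists_indexA h2'
      rw [← e_eq_pathA, ← e_eq_pathA, e_mul_e_of_ne fun h' => h (congrArg indexA h')]
    · rw [pathA_of_not h2, mul_zero]
  · rw [pathA_of_not h1, zero_mul]

theorem pathA_diag_mul_of_ne {i i' : ZMod n} (j : ZMod n) (h : i ≠ i') :
    pathA k P i i * pathA k P i' j = 0 := by
  rw [← pathA_diag_mul i', ← mul_assoc, pathA_diag_mul_diag h, zero_mul]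

theorem pathA_mul_diag_of_ne (i : ZMod n) {j j' : ZMod n} (h : j ≠ j') :
    pathA k P i j * pathA k P j' j' = 0 := by
  rw [← pathA_mul_diag i j, mul_assoc, pathA_diag_mul_diag h, mul_zero]

/-- Between two vertices there is at most one path of length at most one: an arrow if they differ,
the trivial path if they agree. -/
theorem pathA_corner (i j : ZMod n) {x : PathAlgebra k P.toQuiv} (hx : x ∈ filt k P.toQuiv 1) :
    ∃ a : k, pathA k P i i * x * pathA k P j j = a • pathA k P i j := by
  rw [filt_one] at hx
  induction hx using Submodule.span_induction with
  | mem x hx =>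
    obtain ⟨i', j', -, rfl⟩ := gens_pathA hx
    by_cases hi : i = i'
    · subst hi
      rw [pathA_diag_mul]
      by_cases hj : j' = j
      · subst hj
        exact ⟨1, by rw [pathA_mul_diag, one_smul]⟩
      · exact ⟨0, by rw [pathA_mul_diag_of_ne i hj, zero_smul]⟩
    · exact ⟨0, by rw [pathA_diag_mul_of_ne j' hi, zero_mul, zero_smul]⟩
  | zero => exact ⟨0, by simp⟩
  | add x y _ _ hx hy =>
    obtain ⟨a, ha⟩ := hx
    obtain ⟨b, hb⟩ := hy
    exact ⟨a + b, by rw [mul_add, add_mul, ha, hb, add_smul]⟩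
  | smul c x _ hx =>
    obtain ⟨a, ha⟩ := hx
    exact ⟨c * a, by rw [mul_smul_comm, smul_mul_assoc, ha, smul_smul]⟩

theorem pathA_mem_filt (i j : ZMod n) : pathA k P i j ∈ filt k P.toQuiv 1 := by
  by_cases h : ExA P i j
  · rcases exA_cases h with ⟨v, rfl, hv⟩ | ⟨a, rfl, rfl⟩
    · rw [← hv, ← e_eq_pathA]
      exact e_mem_filt v 1
    · rw [← arr_eq_pathA]
      exact arr_mem_filt a le_rfl
  · rw [pathA_of_not h]
    exact Submodule.zero_mem _

theorem exA_add_one_iff (hP : StableA P) (i j : ZMod n) : ExA P (i + 1) (j + 1) ↔ ExA P i j := by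
  have h : ∀ i j : ZMod n, ExA P i j → ExA P (i + 1) (j + 1) := by
    rintro i j (⟨rfl, hi⟩ | ⟨h, ha⟩)
    · exact Or.inl ⟨rfl, hP.1 i hi⟩
    · exact Or.inr ⟨_, hP.2 i j h ha⟩
  have h1 := ZMod.iff_add_one (p := fun l => ExA P (i + l) (j + l))
    (fun l hl => by rw [← add_assoc, ← add_assoc]; exact h _ _ hl) 0
  simpa using h1

/-! ### Actions on subquivers of the complete quiver -/

section action
variable {q : k} [hq : Fact (IsPrimitiveRoot q (2 * n))]
  (α : HopfAction k (Uq n q) (PathAlgebra k P.toQuiv))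

/-- Either the whole orbit of vertices is present or none of it; in the second case any scalars with
(*) serve. -/
theorem exists_vertexOrbit_A (hn : 3 ≤ n) (hP : StableA P) (hα : α.Filtered)
    (hK : ∀ i, ExA P i i → α.act (Uq.K n q) (pathA k P i i) = pathA k P (i + 1) (i + 1)) :
    ∃ γE γF : k, GammaCond q γE γF ∧
      VertexOrbit q (α.act (Uq.K n q)) (α.act (Uq.E n q)) (α.act (Uq.F n q))
        (fun i => pathA k P i i) γE γF := by
  by_cases h : ∃ i : ZMod n, i ∈ P.verts
  · obtain ⟨i, hi⟩ := h
    have hall := ZMod.forall_of_exists (p := fun i : ZMod n => i ∈ P.verts) hP.1 hi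
    choose w hw using fun i => exists_indexA (hall i)
    have hew : ∀ i, e k (w i) = pathA k P i i := fun i => by rw [e_eq_pathA, hw]
    obtain ⟨γE, γF, hγ, hv⟩ := α.exists_vertexOrbit (w := w) (by omega)
      (fun i j h => by rw [← hw i, h, hw]) (fun i => by
        rw [hew, hew]; exact hK i (Or.inl ⟨rfl, hall i⟩))
      (fun i => hα _ 0 _ (e_mem_filt _ _)) (fun i => hα _ 0 _ (e_mem_filt _ _))
    simp only [hew] at hv
    exact ⟨γE, γF, hγ hn, hv⟩
  · have h0 : ∀ i : ZMod n, pathA k P i i = 0 := fun i => pathA_of_not fun h' =>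
      h'.elim (fun h1 => h ⟨i, h1.2⟩) fun ⟨h1, _⟩ => h1 rfl
    obtain ⟨γE, γF, hγ⟩ := exists_gammaCond (by omega) hq.out
    exact ⟨γE, γF, hγ, ⟨by simp [h0], by simp [h0], by simp [h0]⟩⟩

theorem exists_units_A (hP : StableA P) (hα : α.Filtered)
    (hK : ∀ i, ExA P i i → α.act (Uq.K n q) (pathA k P i i) = pathA k P (i + 1) (i + 1)) :
    (∃ μ : ZMod n → ZMod n → kˣ, (∀ i, μ i i = 1) ∧
      ∀ i j, ExA P i j →
        α.act (Uq.K n q) (pathA k P i j) = (μ i j : k) • pathA k P (i + 1) (j + 1) ∧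
        ∏ l ∈ Finset.range n, μ (i + (l : ZMod n)) (j + (l : ZMod n)) = 1) ∧
    (∃ ν : ZMod n → ZMod n → kˣ, (∀ i, ν i i = 1) ∧
      KShiftsA α (fun i j => (ν i j : k) • pathA k P i j)) := by
  have hz : ∀ i j, pathA k P i j = 0 → pathA k P (i + 1) (j + 1) = 0 := fun i j h => by
    rw [pathA_eq_zero_iff] at h ⊢
    rwa [exA_add_one_iff hP]
  have hK' : ∀ i, α.act (Uq.K n q) (pathA k P i i) = pathA k P (i + 1) (i + 1) := by
    intro i
    by_cases h : ExA P i i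
    · exact hK i h
    · have h0 := pathA_of_not (k := k) h
      rw [h0, map_zero, hz i i h0]
  have hT : α.act (Uq.K n q) ^ n = 1 := by rw [← map_pow, Uq.K_pow, map_one]
  -- `K` respects products and shifts the trivial paths, so the image of an arrow lies in the corner
  -- of the shifted arrow, which is at most one-dimensional.
  obtain ⟨μ, hμ1, hμ⟩ := exists_units_smul hT hz (fun i j => by
    obtain ⟨a, ha⟩ := pathA_corner (k := k) (P := P) (i + 1) (j + 1)
      (hα (Uq.K n q) 1 _ (pathA_mem_filt i j))
    refine ⟨a, ?_⟩
    rw [← ha, ← hK', ← hK', ← α.act_K_mul, ← α.act_K_mul, pathA_diag_mul, pathA_mul_diag])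
  obtain ⟨ν, hν1, hν⟩ := exists_rescaling hT hμ
  refine ⟨⟨μ, fun i => hμ1 i i (hK' i), fun i j h => ⟨hμ i j, ?_⟩⟩,
    ⟨ν, hν1 fun i => hμ1 i i (hK' i), fun i j _ => hν i j⟩⟩
  exact prod_units_eq_one hT hμ (pathA_ne_zero_iff.mpr h)

theorem exists_params_A (hn : 3 ≤ n) (hP : StableA P) (hα : α.Filtered)
    (hK : ∀ i, ExA P i i → α.act (Uq.K n q) (pathA k P i i) = pathA k P (i + 1) (i + 1))
    (ν : ZMod n → ZMod n → kˣ) (hν : ∀ i, ν i i = 1)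
    (hKν : KShiftsA α (fun i j => (ν i j : k) • pathA k P i j)) :
    ∃ p : ParamsA k n, p.Admissible q P ∧
      FormulasA α (fun i j => (ν i j : k) • pathA k P i j) p := by
  obtain ⟨γE, γF, hγ, hv⟩ := exists_vertexOrbit_A α hn hP hα hK
  have hb0 : ∀ i j, (ν i j : k) • pathA k P i j = 0 ↔ ¬ ExA P i j := fun i j => by
    rw [smul_eq_zero_iff_right (Units.ne_zero _), pathA_eq_zero_iff]
  have hs : ∀ i j, pathA k P i i * ((ν i j : k) • pathA k P i j) = (ν i j : k) • pathA k P i j :=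
    fun i j => by rw [mul_smul_comm, pathA_diag_mul]
  obtain ⟨lE, lF, G, zE, zF, hcomm, -, hlE, hlF⟩ :=
    α.exists_gridFamily (b := fun i j => (ν i j : k) • pathA k P i j) (by omega) hv hv hγ hγ
      hs
      (fun i i' j h => by rw [mul_smul_comm, pathA_diag_mul_of_ne j h, smul_zero])
      (fun i j => by rw [smul_mul_assoc, pathA_mul_diag])
      (fun i j j' h => by rw [smul_mul_assoc, pathA_mul_diag_of_ne i h, smul_zero])
      (fun i j => by
        by_cases h : ExA P i j
        · exact hKν i j h
        · rw [(hb0 i j).mpr h, map_zero, (hb0 _ _).mpr fun h' => h ((exA_add_one_iff hP i j).mp h')])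
      (fun h i j i' j' => by
        obtain ⟨a, ha⟩ := pathA_corner (k := k) (P := P) i' j'
          (hα h 1 _ (Submodule.smul_mem _ (ν i j : k) (pathA_mem_filt i j)))
        refine ⟨a * (ν i' j' : k)⁻¹, ?_⟩
        rw [ha, smul_smul, mul_assoc, inv_mul_cancel₀ (Units.ne_zero _), mul_one])
  -- The vertex formula shows that `E e_i` has no component between the distinct vertices `i` and `i
  -- + 1`.
  have dE : ∀ i, lE i i = 0 := by
    intro i
    by_cases h : ExA P i (i + 1)
    · have h1 := hlE i i
      simp only [hν, Units.val_one, one_smul] at h1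
      have hi := ZMod.self_ne_add_one (n := n) (by omega) i
      rw [hv.hE i, mul_smul_comm, mul_sub, mul_smul_comm, pathA_diag_mul,
        pathA_diag_mul_diag hi, smul_zero, sub_zero, smul_mul_assoc, pathA_diag_mul_diag hi,
        smul_zero] at h1
      exact (smul_eq_zero.mp h1.symm).resolve_right fun h' => (hb0 i (i + 1)).mp h' h
    · exact zE i i (Or.inr ((hb0 _ _).mpr h))
  have dF : ∀ i, lF i i = 0 := by
    intro i
    by_cases h : ExA P (i - 1) i
    · have h1 := hlF i i
      simp only [hν, Units.val_one, one_smul] at h1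
      have hi := (ZMod.self_ne_sub_one (n := n) (by omega) i).symm
      rw [hv.hF i, mul_smul_comm, mul_sub, mul_smul_comm, pathA_diag_mul,
        pathA_diag_mul_diag hi, smul_zero, sub_zero, smul_mul_assoc, pathA_diag_mul_diag hi,
        smul_zero] at h1
      exact (smul_eq_zero.mp h1.symm).resolve_right fun h' => (hb0 (i - 1) i).mp h' h
    · exact zF i i (Or.inr ((hb0 _ _).mpr h))
  refine ⟨⟨γE, γF, lE, lF⟩, ⟨hγ, ?_, ?_, fun i j _ => G.lE_shift i j, fun i j _ => G.lF_shift i j,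
    fun i j _ => hcomm i j⟩, (formulasA_iff _ _ _).mpr fun i j _ => ⟨G.hE i j, G.hF i j⟩⟩
  · rintro i j - (rfl | h)
    · exact dE i
    · exact zE i j (Or.inr ((hb0 _ _).mpr h))
  · rintro i j - (rfl | h)
    · exact dF i
    · exact zF i j (Or.inr ((hb0 _ _).mpr h))

theorem unique_A (ν : ZMod n → ZMod n → kˣ) (p : ParamsA k n)
    {α β : HopfAction k (Uq n q) (PathAlgebra k P.toQuiv)}
    (hα : KShiftsA α (fun i j => (ν i j : k) • pathA k P i j))
    (hα' : FormulasA α (fun i j => (ν i j : k) • pathA k P i j) p)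
    (hβ : KShiftsA β (fun i j => (ν i j : k) • pathA k P i j))
    (hβ' : FormulasA β (fun i j => (ν i j : k) • pathA k P i j) p) : α = β := by
  refine HopfAction.ext_gens fun x hx => ?_
  obtain ⟨i, j, h, rfl⟩ := gens_pathA hx
  have key : ∀ u : Uq n q, α.act u ((ν i j : k) • pathA k P i j)
      = β.act u ((ν i j : k) • pathA k P i j) →
      α.act u (pathA k P i j) = β.act u (pathA k P i j) := fun u hu => by
    rw [map_smul, map_smul] at hu
    exact smul_right_injective _ (Units.ne_zero (ν i j)) hu
  exact ⟨key _ ((hα i j h).trans (hβ i j h).symm),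
    key _ ((hα' i j h).1.trans (hβ' i j h).1.symm), key _ ((hα' i j h).2.trans (hβ' i j h).2.symm)⟩

/-- Trivial paths are the diagonal of one grid that also contains all arrows, so a single grid
family controls every generator. -/
theorem exists_action_A (hn : 3 ≤ n) (hP : StableA P) (ν : ZMod n → ZMod n → kˣ)
    (hν : ∀ i, ν i i = 1) (p : ParamsA k n) (hp : p.Admissible q P) :
    ∃ α : HopfAction k (Uq n q) (PathAlgebra k P.toQuiv), α.Filtered ∧
      KShiftsA α (fun i j => (ν i j : k) • pathA k P i j) ∧
      FormulasA α (fun i j => (ν i j : k) • pathA k P i j) p := by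
  have hn2 : 2 ≤ n := by omega
  have hEx := exA_add_one_iff hP
  set b : ZMod n → ZMod n → PathAlgebra k P.toQuiv := fun i j => (ν i j : k) • pathA k P i j with hb
  have hb0 : ∀ i j, ¬ ExA P i j → b i j = 0 := fun i j h => by
    simp only [hb, pathA_of_not h, smul_zero]
  have hbe : ∀ v : P.toQuiv.V, b (indexA v) (indexA v) = e k v := fun v => by
    simp only [hb, hν, Units.val_one, one_smul, e_eq_pathA]
  have hbd : ∀ i, b i i = pathA k P i i := fun i => by
    simp only [hb, hν, Units.val_one, one_smul]
  have hba : ∀ a : P.toQuiv.A, b (indexA (P.toQuiv.s a)) (indexA (P.toQuiv.t a))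
      = (ν (indexA (P.toQuiv.s a)) (indexA (P.toQuiv.t a)) : k) • arr k a := fun a => by
    simp only [hb, arr_eq_pathA]
  have hab : ∀ a : P.toQuiv.A, arr k a
      = (ν (indexA (P.toQuiv.s a)) (indexA (P.toQuiv.t a)) : k)⁻¹
        • b (indexA (P.toQuiv.s a)) (indexA (P.toQuiv.t a)) := fun a => by
    rw [hba, smul_smul, inv_mul_cancel₀ (Units.ne_zero _), one_smul]
  have hbl : ∀ i j, pathA k P i i * b i j = b i j := fun i j => by
    simp only [hb, mul_smul_comm, pathA_diag_mul]
  have hbr : ∀ i j, b i j * pathA k P j j = b i j := fun i j => by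
    simp only [hb, smul_mul_assoc, pathA_mul_diag]
  have hbf : ∀ i j, b i j ∈ filt k P.toQuiv 1 := fun i j =>
    Submodule.smul_mem _ _ (pathA_mem_filt i j)
  obtain ⟨σ, hσ⟩ := exists_perm_of_injective (indexA_injective (P := P))
    (add_left_injective (1 : ZMod n)) fun v => exists_indexA (hP.1 _ (indexA_mem v))
  have hσ' : ∀ v, indexA (σ.symm v) = indexA v - 1 := fun v => by
    rw [eq_sub_iff_add_eq, ← hσ, Equiv.apply_symm_apply]
  have hσn : ∀ v, (σ ^ n) v = v := fun v => indexA_injective (by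
    have h : ∀ m : ℕ, indexA ((σ ^ m) v) = indexA v + m := by
      intro m
      induction m with
      | zero => simp
      | succ m ih =>
        rw [pow_succ', Equiv.Perm.mul_apply, hσ]
        simp only [ih]
        push_cast
        rw [add_assoc]
    rw [h]
    simp)
  let lE := restrictScalarsTo (ExA P) p.lE
  let lF := restrictScalarsTo (ExA P) p.lF
  have sE : ∀ i j, lE (i + 1) (j + 1) = (q ^ 2)⁻¹ * lE i j :=
    restrictScalarsTo_shift hEx hp.lE_shift
  have sF : ∀ i j, lF (i + 1) (j + 1) = q ^ 2 * lF i j :=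
    restrictScalarsTo_shift hEx hp.lF_shift
  have hcomm : ∀ i j, lF i j * lE (i - 1) j = lE i j * lF i (j + 1) :=
    restrictScalarsTo_comm (fun i j h h' => hp.lE_zero i j h (Or.inr h'))
      (fun i j h h' => hp.lF_zero i j h (Or.inr h')) hp.comm
  have dE : ∀ i, lE i i = 0 := fun i => by
    by_cases h : ExA P i i
    · exact (restrictScalarsTo_of h).trans (hp.lE_zero i i h (Or.inl rfl))
    · exact restrictScalarsTo_of_not h
  have dF : ∀ i, lF i i = 0 := fun i => by
    by_cases h : ExA P i i
    · exact (restrictScalarsTo_of h).trans (hp.lF_zero i i h (Or.inl rfl))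
    · exact restrictScalarsTo_of_not h
  let S : P.toQuiv.A → ZMod n := fun a => indexA (P.toQuiv.s a)
  let T : P.toQuiv.A → ZMod n := fun a => indexA (P.toQuiv.t a)
  -- The formulas concern rescaled arrows, whereas the extension theorem asks for values on the
  -- original ones.
  let c : P.toQuiv.A → k := fun a => (ν (S a) (T a) : k)⁻¹
  have hσe : ∀ v, e k (σ v) = pathA k P (indexA v + 1) (indexA v + 1) := fun v => by
    rw [e_eq_pathA, hσ]
  have hσe' : ∀ v, e k (σ.symm v) = pathA k P (indexA v - 1) (indexA v - 1) := fun v => by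
    rw [e_eq_pathA, hσ']
  let ka : P.toQuiv.A → PathAlgebra k P.toQuiv := fun a => c a • b (S a + 1) (T a + 1)
  let ηE : P.toQuiv.A → PathAlgebra k P.toQuiv := fun a => c a • lE (S a) (T a) • b (S a) (T a + 1)
  let ηF : P.toQuiv.A → PathAlgebra k P.toQuiv := fun a => c a • lF (S a) (T a) • b (S a - 1) (T a)
  have key : ∀ κ D D', GeneratorValues q σ indexA (fun _ => p.γE) (fun _ => p.γF) ka ηE ηF κ D D' →
      GridFamily q κ D D' b ⟨p.γE, p.γE, p.γF, p.γF, lE, lF⟩ := by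
    intro κ D D' V
    have hK : ∀ i j, κ (b i j) = b (i + 1) (j + 1) := by
      intro i j
      by_cases h : ExA P i j
      · rcases exA_cases h with ⟨v, rfl, hv⟩ | ⟨a, rfl, rfl⟩
        · rw [← hv, hbe, V.Ke, hσe, hbd]
        · rw [hba, map_smul, V.Ka]
          simp only [ka, c, smul_smul]
          rw [mul_inv_cancel₀ (Units.ne_zero _), one_smul]
      · rw [hb0 i j h, map_zero, hb0 _ _ fun h' => h ((hEx i j).mp h')]
    refine ⟨hK, fun i j => ?_, fun i j => ?_, sE, sF⟩
    · by_cases h : ExA P i j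
      · rcases exA_cases h with ⟨v, rfl, hv⟩ | ⟨a, rfl, rfl⟩
        · rw [← hv]
          dsimp only
          rw [dE, hbe, V.Ee, hσe, hbd]
          module
        · rw [hba, map_smul, V.Ea]
          simp only [ka, ηE, c, S, T]
          have := Units.ne_zero (ν (indexA (P.toQuiv.s a)) (indexA (P.toQuiv.t a)))
          match_scalars <;> field_simp
      · rw [hb0 i j h, map_zero, hb0 _ _ fun h' => h ((hEx i j).mp h')]
        simp only [lE, restrictScalarsTo_of_not h, zero_smul, smul_zero, sub_zero, add_zero]
    · by_cases h : ExA P i j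
      · rcases exA_cases h with ⟨v, rfl, hv⟩ | ⟨a, rfl, rfl⟩
        · rw [← hv]
          dsimp only
          rw [dF, hbe, V.Fe, hσe', hbd]
          module
        · rw [hba, map_smul, V.Fa, hab, map_smul, shift_pow_pred_apply hK]
          simp only [ηF, c, S, T]
          have := Units.ne_zero (ν (indexA (P.toQuiv.s a)) (indexA (P.toQuiv.t a)))
          match_scalars <;> field_simp
      · have h1 : ¬ ExA P (i - 1) (j - 1) := fun h' => h (by
          have := (hEx (i - 1) (j - 1)).mpr h'
          rwa [sub_add_cancel, sub_add_cancel] at this)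
        rw [hb0 i j h, map_zero, hb0 _ _ h1]
        simp only [lF, restrictScalarsTo_of_not h, zero_smul, smul_zero, sub_zero, add_zero]
  obtain ⟨α, hα, V⟩ := exists_filtered_action (k := k) (Q := P.toQuiv) (q := q) hn2 σ indexA hσ
    (fun _ => p.γE) (fun _ => p.γF) (fun _ => rfl) (fun _ => rfl) hσn ka ηE ηF
    (fun a => by simp only [ka]; rw [hσe, mul_smul_comm, hbl])
    (fun a => by simp only [ka]; rw [hσe, smul_mul_assoc, hbr])
    (fun a => by simp only [ηE]; rw [e_eq_pathA, mul_smul_comm, mul_smul_comm, hbl])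
    (fun a => by simp only [ηE]; rw [hσe, smul_mul_assoc, smul_mul_assoc, hbr])
    (fun a => by simp only [ηF]; rw [hσe', mul_smul_comm, mul_smul_comm, hbl])
    (fun a => by simp only [ηF]; rw [e_eq_pathA, smul_mul_assoc, smul_mul_assoc, hbr])
    (fun a => Submodule.smul_mem _ _ (hbf _ _))
    (fun a => Submodule.smul_mem _ _ (Submodule.smul_mem _ _ (hbf _ _)))
    (fun a => Submodule.smul_mem _ _ (Submodule.smul_mem _ _ (hbf _ _)))
    (by
      intro κ D D' V x hx
      have G := key κ D D' V
      have hrel : ∀ i j, RelationsAt n q κ D D' (b i j) := fun i j =>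
        G.relationsAt hq.out
          -- The row product contains the diagonal scalar, which is zero, and both ends carry the
          -- same `γ`; so the power conditions hold for free.
          (by simp only [ZMod.prod_range_add_eq_zero (g := fun j => lE i j) (dE i) j, add_zero])
          (by simp only [ZMod.prod_range_add_eq_zero (g := fun j => lF i j) (dF i) j, add_zero])
          (G.EF_sub_FE hq.out hn2 hp.gamma hp.gamma i j (hcomm i j))
      rcases hx with ⟨v, rfl⟩ | ⟨a, rfl⟩
      · rw [← hbe]
        exact hrel _ _
      · rw [hab]
        exact (hrel _ _).smul _)
  have G := key _ _ _ V
  refine ⟨α, hα, fun i j _ => G.hK i j, (formulasA_iff _ _ _).mpr fun i j h => ⟨?_, ?_⟩⟩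
  · have h1 := G.hE i j
    dsimp only at h1
    rwa [show lE i j = p.lE i j from restrictScalarsTo_of h] at h1
  · have h1 := G.hF i j
    dsimp only at h1
    rwa [show lF i j = p.lF i j from restrictScalarsTo_of h] at h1

end action
end TypeA

/-! ## Subquivers of the complete bipartite quiver -/

section TypeB
open PathAlgebra
variable {k : Type*} [Field k] {n : ℕ} [NeZero n] {P : (bipartiteQuiver n).Sub}

/-- The index of a vertex. -/
def indexB (v : P.toQuiv.V) : ZMod n ⊕ ZMod n := v.1

/-- The membership of a vertex index in the subquiver. -/
def VertexB (P : (bipartiteQuiver n).Sub) (w : ZMod n ⊕ ZMod n) : Prop := w ∈ P.verts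

/-- The upper index of an arrow. -/
def upperB (a : P.toQuiv.A) : ZMod n := a.1.1

/-- The lower index of an arrow. -/
def lowerB (a : P.toQuiv.A) : ZMod n := a.1.2

/-- Adding one to the index of a vertex. -/
def shiftB : ZMod n ⊕ ZMod n → ZMod n ⊕ ZMod n := Sum.map (· + 1) (· + 1)

theorem shiftB_injective : Function.Injective (shiftB (n := n)) :=
  Sum.map_injective.mpr ⟨add_left_injective 1, add_left_injective 1⟩

theorem indexB_injective : Function.Injective (indexB : P.toQuiv.V → ZMod n ⊕ ZMod n) :=
  Subtype.val_injective

theorem exists_indexB {w : ZMod n ⊕ ZMod n} (h : VertexB P w) : ∃ v : P.toQuiv.V, indexB v = w :=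
  ⟨⟨w, h⟩, rfl⟩

theorem vertexB_indexB (v : P.toQuiv.V) : VertexB P (indexB v) := v.2

theorem indexB_source (a : P.toQuiv.A) : indexB (P.toQuiv.s a) = Sum.inl (upperB a) := rfl

theorem indexB_target (a : P.toQuiv.A) : indexB (P.toQuiv.t a) = Sum.inr (lowerB a) := rfl

theorem vertB_of {w : ZMod n ⊕ ZMod n} (h : VertexB P w) :
    vertB k P w = e k (Q := P.toQuiv) ⟨w, h⟩ := dif_pos h

theorem e_eq_vertB (v : P.toQuiv.V) : e k v = vertB k P (indexB v) :=
  (vertB_of (vertexB_indexB v)).symm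

theorem exB_arrow (a : P.toQuiv.A) : ExB P (upperB a) (lowerB a) := a.2

theorem arrB_of {i j : ZMod n} (h : ExB P i j) :
    arrB k P i j = arr k (Q := P.toQuiv) ⟨(i, j), h⟩ := dif_pos h

theorem arr_eq_arrB (a : P.toQuiv.A) : arr k a = arrB k P (upperB a) (lowerB a) :=
  (arrB_of (exB_arrow a)).symm

theorem exists_arrow {i j : ZMod n} (h : ExB P i j) :
    ∃ a : P.toQuiv.A, upperB a = i ∧ lowerB a = j := ⟨⟨(i, j), h⟩, rfl, rfl⟩

theorem vertB_of_not {w : ZMod n ⊕ ZMod n} (h : ¬ VertexB P w) : vertB k P w = 0 := dif_neg h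

theorem arrB_of_not {i j : ZMod n} (h : ¬ ExB P i j) : arrB k P i j = 0 := dif_neg h

theorem arrB_ne_zero_iff {i j : ZMod n} : arrB k P i j ≠ 0 ↔ ExB P i j := by
  refine ⟨fun h => by_contra fun h' => h (arrB_of_not h'), fun h => ?_⟩
  obtain ⟨a, rfl, rfl⟩ := exists_arrow h
  rw [← arr_eq_arrB]
  exact arr_ne_zero a

theorem arrB_eq_zero_iff {i j : ZMod n} : arrB k P i j = 0 ↔ ¬ ExB P i j := by
  rw [← arrB_ne_zero_iff (k := k), not_not]

theorem vertB_mul_vertB_of_ne {w w' : ZMod n ⊕ ZMod n} (h : w ≠ w') :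
    vertB k P w * vertB k P w' = 0 := by
  by_cases h1 : VertexB P w
  · by_cases h2 : VertexB P w'
    · obtain ⟨v, rfl⟩ := exists_indexB h1
      obtain ⟨v', rfl⟩ := exists_indexB h2
      rw [← e_eq_vertB, ← e_eq_vertB, e_mul_e_of_ne fun h' => h (congrArg indexB h')]
    · rw [vertB_of_not h2, mul_zero]
  · rw [vertB_of_not h1, zero_mul]

theorem vertB_mul_arrB (i j : ZMod n) : vertB k P (Sum.inl i) * arrB k P i j = arrB k P i j := by
  by_cases h : ExB P i j
  · obtain ⟨a, rfl, rfl⟩ := exists_arrow h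
    rw [← indexB_source, ← e_eq_vertB, ← arr_eq_arrB, e_src_mul_arr]
  · rw [arrB_of_not h, mul_zero]

theorem arrB_mul_vertB (i j : ZMod n) : arrB k P i j * vertB k P (Sum.inr j) = arrB k P i j := by
  by_cases h : ExB P i j
  · obtain ⟨a, rfl, rfl⟩ := exists_arrow h
    rw [← indexB_target, ← e_eq_vertB, ← arr_eq_arrB, arr_mul_e_tgt]
  · rw [arrB_of_not h, zero_mul]

theorem vertB_mul_arrB_of_ne {i i' : ZMod n} (j : ZMod n) (h : i ≠ i') :
    vertB k P (Sum.inl i) * arrB k P i' j = 0 := by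
  rw [← vertB_mul_arrB i', ← mul_assoc,
    vertB_mul_vertB_of_ne fun h' => h (Sum.inl_injective h'), zero_mul]

theorem arrB_mul_vertB_of_ne (i : ZMod n) {j j' : ZMod n} (h : j ≠ j') :
    arrB k P i j * vertB k P (Sum.inr j') = 0 := by
  rw [← arrB_mul_vertB i j, mul_assoc,
    vertB_mul_vertB_of_ne fun h' => h (Sum.inr_injective h'), mul_zero]

/-- A trivial path cannot start in the upper row and end in the lower one, so only the arrow between
the two vertices contributes. -/
theorem arrB_corner (i j : ZMod n) {x : PathAlgebra k P.toQuiv} (hx : x ∈ filt k P.toQuiv 1) :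
    ∃ a : k, vertB k P (Sum.inl i) * x * vertB k P (Sum.inr j) = a • arrB k P i j := by
  rw [filt_one] at hx
  induction hx using Submodule.span_induction with
  | mem x hx =>
    rcases hx with ⟨v, rfl⟩ | ⟨a, rfl⟩
    · refine ⟨0, ?_⟩
      rw [e_eq_vertB, zero_smul]
      by_cases h : indexB v = Sum.inl i
      · rw [mul_assoc, h, vertB_mul_vertB_of_ne Sum.inl_ne_inr, mul_zero]
      · rw [vertB_mul_vertB_of_ne (Ne.symm h), zero_mul]
    · rw [arr_eq_arrB]
      by_cases hi : i = upperB a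
      · subst hi
        rw [vertB_mul_arrB]
        by_cases hj : lowerB a = j
        · subst hj
          exact ⟨1, by rw [arrB_mul_vertB, one_smul]⟩
        · exact ⟨0, by rw [arrB_mul_vertB_of_ne _ hj, zero_smul]⟩
      · exact ⟨0, by rw [vertB_mul_arrB_of_ne _ hi, zero_mul, zero_smul]⟩
  | zero => exact ⟨0, by simp⟩
  | add x y _ _ hx hy =>
    obtain ⟨a, ha⟩ := hx
    obtain ⟨b, hb⟩ := hy
    exact ⟨a + b, by rw [mul_add, add_mul, ha, hb, add_smul]⟩
  | smul c x _ hx =>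
    obtain ⟨a, ha⟩ := hx
    exact ⟨c * a, by rw [mul_smul_comm, smul_mul_assoc, ha, smul_smul]⟩

theorem arrB_mem_filt (i j : ZMod n) : arrB k P i j ∈ filt k P.toQuiv 1 := by
  by_cases h : ExB P i j
  · obtain ⟨a, rfl, rfl⟩ := exists_arrow h
    rw [← arr_eq_arrB]
    exact arr_mem_filt a le_rfl
  · rw [arrB_of_not h]
    exact Submodule.zero_mem _

theorem exB_add_one_iff (hP : StableB P) (i j : ZMod n) : ExB P (i + 1) (j + 1) ↔ ExB P i j := by
  have h1 := ZMod.iff_add_one (p := fun l => ExB P (i + l) (j + l))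
    (fun l hl => by rw [← add_assoc, ← add_assoc]; exact hP.2.2 _ _ hl) 0
  simpa using h1

theorem vertexB_shiftB (hP : StableB P) {w : ZMod n ⊕ ZMod n} (h : VertexB P w) :
    VertexB P (shiftB w) := by
  cases w with
  | inl i => exact hP.1 i h
  | inr j => exact hP.2.1 j h

/-- In a row that is neither empty nor full, some present arrow is followed by a missing one; there
the vanishing conditions apply. -/
theorem exists_exB_and_not (i : ZMod n) {j j' : ZMod n} (h : ExB P i j) (h' : ¬ ExB P i j') :
    ∃ l, ExB P i l ∧ ¬ ExB P i (l + 1) := by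
  by_contra! hc
  exact h' (ZMod.forall_of_exists (p := fun l => ExB P i l) hc h j')

/-- Unless the row is full, both products contain a zero factor at a present arrow, so the
unconstrained values at missing arrows have no influence. -/
theorem prod_restrictScalarsTo_exB {l : ZMod n → ZMod n → k} {i : ZMod n}
    (j : ZMod n) (hl : ∀ j, ¬ ExB P i j → ∃ j', ExB P i j' ∧ l i j' = 0) :
    ∏ m ∈ Finset.range n, restrictScalarsTo (ExB P) l i (j + (m : ZMod n))
      = ∏ m ∈ Finset.range n, l i (j + (m : ZMod n)) := by
  by_cases hall : ∀ j, ExB P i j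
  · exact Finset.prod_congr rfl fun m _ => restrictScalarsTo_of (hall _)
  · push Not at hall
    obtain ⟨j₀, hj₀⟩ := hall
    obtain ⟨j', hj', h0⟩ := hl j₀ hj₀
    rw [ZMod.prod_range_add_eq_zero (g := fun j => restrictScalarsTo (ExB P) l i j)
        ((restrictScalarsTo_of hj').trans h0) j,
      ZMod.prod_range_add_eq_zero (g := fun j => l i j) h0 j]

/-! ### Actions on subquivers of the complete bipartite quiver -/

section action
variable {q : k} [hq : Fact (IsPrimitiveRoot q (2 * n))]
  (α : HopfAction k (Uq n q) (PathAlgebra k P.toQuiv))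

theorem act_K_vertB (hP : StableB P) (hK : KShiftsVertB α) (w : ZMod n ⊕ ZMod n) :
    α.act (Uq.K n q) (vertB k P w) = vertB k P (shiftB w) := by
  by_cases h : VertexB P w
  · cases w with
    | inl i => exact hK.1 i h
    | inr j => exact hK.2 j h
  · have h' : ¬ VertexB P (shiftB w) := by
      cases w with
      | inl i =>
        exact fun h1 => h ((ZMod.iff_add_one (p := fun i => VertexB P (Sum.inl i)) hP.1 i).mp h1)
      | inr j =>
        exact fun h1 => h ((ZMod.iff_add_one (p := fun i => VertexB P (Sum.inr i)) hP.2.1 j).mp h1)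
    rw [vertB_of_not h, vertB_of_not h', map_zero]

/-- The map `c` stands for the inclusion of either row, so that both are treated at once. -/
theorem exists_vertexOrbit_B (hn : 3 ≤ n) (hP : StableB P) (hα : α.Filtered)
    (hK : KShiftsVertB α) {c : ZMod n → ZMod n ⊕ ZMod n} (hc : Function.Injective c)
    (hc' : ∀ i, c (i + 1) = shiftB (c i)) :
    ∃ γE γF : k, GammaCond q γE γF ∧
      VertexOrbit q (α.act (Uq.K n q)) (α.act (Uq.E n q)) (α.act (Uq.F n q))
        (fun i => vertB k P (c i)) γE γF := by
  by_cases h : ∃ i : ZMod n, VertexB P (c i)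
  · obtain ⟨i, hi⟩ := h
    have hall := ZMod.forall_of_exists (p := fun i : ZMod n => VertexB P (c i))
      (fun i hi => by rw [hc']; exact vertexB_shiftB hP hi) hi
    choose w hw using fun i => exists_indexB (hall i)
    have hew : ∀ i, e k (w i) = vertB k P (c i) := fun i => by rw [e_eq_vertB, hw]
    obtain ⟨γE, γF, hγ, hv⟩ := α.exists_vertexOrbit (w := w) (by omega)
      (fun i j h => hc (by rw [← hw i, h, hw])) (fun i => by
        rw [hew, hew, hc']; exact act_K_vertB α hP hK _)
      (fun i => hα _ 0 _ (e_mem_filt _ _)) (fun i => hα _ 0 _ (e_mem_filt _ _))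
    simp only [hew] at hv
    exact ⟨γE, γF, hγ hn, hv⟩
  · have h0 : ∀ i : ZMod n, vertB k P (c i) = 0 := fun i => vertB_of_not fun h' => h ⟨i, h'⟩
    obtain ⟨γE, γF, hγ⟩ := exists_gammaCond (by omega) hq.out
    exact ⟨γE, γF, hγ, ⟨by simp [h0], by simp [h0], by simp [h0]⟩⟩

theorem exists_units_B (hP : StableB P) (hα : α.Filtered) (hK : KShiftsVertB α) :
    (∃ μ : ZMod n → ZMod n → kˣ,
      ∀ i j, ExB P i j →
        α.act (Uq.K n q) (arrB k P i j) = (μ i j : k) • arrB k P (i + 1) (j + 1) ∧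
        ∏ l ∈ Finset.range n, μ (i + (l : ZMod n)) (j + (l : ZMod n)) = 1) ∧
    (∃ ν : ZMod n → ZMod n → kˣ, KShiftsB α (fun i j => (ν i j : k) • arrB k P i j)) := by
  have hz : ∀ i j, arrB k P i j = 0 → arrB k P (i + 1) (j + 1) = 0 := fun i j h => by
    rw [arrB_eq_zero_iff] at h ⊢
    rwa [exB_add_one_iff hP]
  have hT : α.act (Uq.K n q) ^ n = 1 := by rw [← map_pow, Uq.K_pow, map_one]
  obtain ⟨μ, -, hμ⟩ := exists_units_smul hT hz (fun i j => by
    obtain ⟨a, ha⟩ := arrB_corner (k := k) (P := P) (i + 1) (j + 1)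
      (hα (Uq.K n q) 1 _ (arrB_mem_filt i j))
    refine ⟨a, ?_⟩
    have h1 := act_K_vertB α hP hK (Sum.inl i)
    have h2 := act_K_vertB α hP hK (Sum.inr j)
    simp only [shiftB, Sum.map_inl, Sum.map_inr] at h1 h2
    rw [← ha, ← h1, ← h2, ← α.act_K_mul, ← α.act_K_mul, vertB_mul_arrB, arrB_mul_vertB])
  obtain ⟨ν, -, hν⟩ := exists_rescaling hT hμ
  exact ⟨⟨μ, fun i j h => ⟨hμ i j, prod_units_eq_one hT hμ (arrB_ne_zero_iff.mpr h)⟩⟩,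
    ⟨ν, fun i j _ => hν i j⟩⟩

theorem exists_params_B (hn : 3 ≤ n) (hP : StableB P) (hα : α.Filtered) (hK : KShiftsVertB α)
    (ν : ZMod n → ZMod n → kˣ) (hKν : KShiftsB α (fun i j => (ν i j : k) • arrB k P i j)) :
    ∃ p : ParamsB k n, p.Admissible q P ∧
      FormulasB α (fun i j => (ν i j : k) • arrB k P i j) p := by
  obtain ⟨γEp, γFp, hp, hs⟩ := exists_vertexOrbit_B α hn hP hα hK Sum.inl_injective fun _ => rfl
  obtain ⟨γEm, γFm, hm, ht⟩ := exists_vertexOrbit_B α hn hP hα hK Sum.inr_injective fun _ => rfl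
  have hb0 : ∀ i j, (ν i j : k) • arrB k P i j = 0 ↔ ¬ ExB P i j := fun i j => by
    rw [smul_eq_zero_iff_right (Units.ne_zero _), arrB_eq_zero_iff]
  obtain ⟨lE, lF, G, zE, zF, hcomm, hpow, -, -⟩ :=
    α.exists_gridFamily (b := fun i j => (ν i j : k) • arrB k P i j) (by omega) hs ht hp hm
      (fun i j => by rw [mul_smul_comm, vertB_mul_arrB])
      (fun i i' j h => by rw [mul_smul_comm, vertB_mul_arrB_of_ne j h, smul_zero])
      (fun i j => by rw [smul_mul_assoc, arrB_mul_vertB])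
      (fun i j j' h => by rw [smul_mul_assoc, arrB_mul_vertB_of_ne i h, smul_zero])
      (fun i j => by
        by_cases h : ExB P i j
        · exact hKν i j h
        · rw [(hb0 i j).mpr h, map_zero, (hb0 _ _).mpr fun h' => h ((exB_add_one_iff hP i j).mp h')])
      (fun h i j i' j' => by
        obtain ⟨a, ha⟩ := arrB_corner (k := k) (P := P) i' j'
          (hα h 1 _ (Submodule.smul_mem _ (ν i j : k) (arrB_mem_filt i j)))
        refine ⟨a * (ν i' j' : k)⁻¹, ?_⟩
        rw [ha, smul_smul, mul_assoc, inv_mul_cancel₀ (Units.ne_zero _), mul_one])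
  have hb1 : ∀ i j, ExB P i j → (ν i j : k) • arrB k P i j ≠ 0 := fun i j h h' =>
    (hb0 i j).mp h' h
  exact ⟨⟨γEp, γEm, γFp, γFm, lE, lF⟩,
    ⟨hp, hm, fun i j _ h => zE i j (Or.inr ((hb0 _ _).mpr h)),
      fun i j _ h => zF i j (Or.inr ((hb0 _ _).mpr h)), fun i j _ => G.lE_shift i j,
      fun i j _ => G.lF_shift i j, fun i j _ => hcomm i j, fun i j h => (hpow i j (hb1 i j h)).1,
      fun i j h => (hpow i j (hb1 i j h)).2⟩,
    (formulasB_iff _ _ _).mpr ⟨fun i _ => hs.formulasVert i, fun j _ => ht.formulasVert j,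
      fun i j _ => ⟨G.hE i j, G.hF i j⟩⟩⟩

theorem unique_B (ν : ZMod n → ZMod n → kˣ) (p : ParamsB k n)
    {α β : HopfAction k (Uq n q) (PathAlgebra k P.toQuiv)}
    (hα : KShiftsVertB α ∧ KShiftsB α (fun i j => (ν i j : k) • arrB k P i j) ∧
      FormulasB α (fun i j => (ν i j : k) • arrB k P i j) p)
    (hβ : KShiftsVertB β ∧ KShiftsB β (fun i j => (ν i j : k) • arrB k P i j) ∧
      FormulasB β (fun i j => (ν i j : k) • arrB k P i j) p) : α = β := by
  obtain ⟨⟨α1, α2⟩, α3, α4, α5, α6⟩ := hα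
  obtain ⟨⟨β1, β2⟩, β3, β4, β5, β6⟩ := hβ
  refine HopfAction.ext_gens fun x hx => ?_
  rcases hx with ⟨v, rfl⟩ | ⟨a, rfl⟩
  · rw [e_eq_vertB]
    have hv := vertexB_indexB v
    generalize indexB v = w at hv
    cases w with
    | inl i =>
      exact ⟨(α1 i hv).trans (β1 i hv).symm, (α4 i hv).1.trans (β4 i hv).1.symm,
        (α4 i hv).2.trans (β4 i hv).2.symm⟩
    | inr j =>
      exact ⟨(α2 j hv).trans (β2 j hv).symm, (α5 j hv).1.trans (β5 j hv).1.symm,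
        (α5 j hv).2.trans (β5 j hv).2.symm⟩
  · rw [arr_eq_arrB]
    have h := exB_arrow a
    generalize upperB a = i at h
    generalize lowerB a = j at h
    have key : ∀ u : Uq n q, α.act u ((ν i j : k) • arrB k P i j)
        = β.act u ((ν i j : k) • arrB k P i j) →
        α.act u (arrB k P i j) = β.act u (arrB k P i j) := fun u hu => by
      rw [map_smul, map_smul] at hu
      exact smul_right_injective _ (Units.ne_zero (ν i j)) hu
    exact ⟨key _ ((α3 i j h).trans (β3 i j h).symm), key _ ((α6 i j h).1.trans (β6 i j h).1.symm),
      key _ ((α6 i j h).2.trans (β6 i j h).2.symm)⟩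

/-- The grid consists of arrows only, so vertices are handled by two separate orbits. The power
conditions are genuine here, since the rows carry independent scalars. -/
theorem exists_action_B (hn : 3 ≤ n) (hP : StableB P) (ν : ZMod n → ZMod n → kˣ)
    (p : ParamsB k n) (hp : p.Admissible q P) :
    ∃ α : HopfAction k (Uq n q) (PathAlgebra k P.toQuiv), α.Filtered ∧
      KShiftsVertB α ∧ KShiftsB α (fun i j => (ν i j : k) • arrB k P i j) ∧
      FormulasB α (fun i j => (ν i j : k) • arrB k P i j) p := by
  have hn2 : 2 ≤ n := by omega
  have hEx := exB_add_one_iff hP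
  set b : ZMod n → ZMod n → PathAlgebra k P.toQuiv := fun i j => (ν i j : k) • arrB k P i j with hb
  have hb0 : ∀ i j, ¬ ExB P i j → b i j = 0 := fun i j h => by
    simp only [hb, arrB_of_not h, smul_zero]
  have hba : ∀ a : P.toQuiv.A, b (upperB a) (lowerB a)
      = (ν (upperB a) (lowerB a) : k) • arr k a := fun a => by
    simp only [hb, arr_eq_arrB]
  have hab : ∀ a : P.toQuiv.A, arr k a
      = (ν (upperB a) (lowerB a) : k)⁻¹ • b (upperB a) (lowerB a) := fun a => by
    rw [hba, smul_smul, inv_mul_cancel₀ (Units.ne_zero _), one_smul]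
  have hbl : ∀ i j, vertB k P (Sum.inl i) * b i j = b i j := fun i j => by
    simp only [hb, mul_smul_comm, vertB_mul_arrB]
  have hbr : ∀ i j, b i j * vertB k P (Sum.inr j) = b i j := fun i j => by
    simp only [hb, smul_mul_assoc, arrB_mul_vertB]
  have hbf : ∀ i j, b i j ∈ filt k P.toQuiv 1 := fun i j =>
    Submodule.smul_mem _ _ (arrB_mem_filt i j)
  obtain ⟨σ, hσ⟩ := exists_perm_of_injective (indexB_injective (P := P))
    shiftB_injective fun v => exists_indexB (vertexB_shiftB hP (vertexB_indexB v))
  have hσl : ∀ {v i}, indexB v = Sum.inl i → indexB (σ v) = Sum.inl (i + 1) := fun {v i} h => by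
    rw [hσ, h]; rfl
  have hσr : ∀ {v i}, indexB v = Sum.inr i → indexB (σ v) = Sum.inr (i + 1) := fun {v i} h => by
    rw [hσ, h]; rfl
  have hσl' : ∀ {v i}, indexB v = Sum.inl i → indexB (σ.symm v) = Sum.inl (i - 1) :=
    fun {v i} h => shiftB_injective (by
      rw [← hσ, Equiv.apply_symm_apply, h]
      simp [shiftB])
  have hσr' : ∀ {v i}, indexB v = Sum.inr i → indexB (σ.symm v) = Sum.inr (i - 1) :=
    fun {v i} h => shiftB_injective (by
      rw [← hσ, Equiv.apply_symm_apply, h]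
      simp [shiftB])
  have hσn : ∀ v, (σ ^ n) v = v := fun v => indexB_injective (by
    have h : ∀ m : ℕ, indexB ((σ ^ m) v) = Sum.map (· + (m : ZMod n)) (· + (m : ZMod n))
        (indexB v) := by
      intro m
      induction m with
      | zero => cases h : indexB v <;> simp [h]
      | succ m ih =>
        rw [pow_succ', Equiv.Perm.mul_apply, hσ, ih]
        cases indexB v <;> simp [shiftB, add_assoc]
    rw [h]
    cases indexB v <;> simp)
  let lE := restrictScalarsTo (ExB P) p.lE
  let lF := restrictScalarsTo (ExB P) p.lF
  have sE : ∀ i j, lE (i + 1) (j + 1) = (q ^ 2)⁻¹ * lE i j :=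
    restrictScalarsTo_shift hEx hp.lE_shift
  have sF : ∀ i j, lF (i + 1) (j + 1) = q ^ 2 * lF i j :=
    restrictScalarsTo_shift hEx hp.lF_shift
  have hcomm : ∀ i j, lF i j * lE (i - 1) j = lE i j * lF i (j + 1) :=
    restrictScalarsTo_comm hp.lE_zero hp.lF_zero hp.comm
  have pE : ∀ {i j}, ExB P i j →
      p.γEp ^ n = p.γEm ^ n + ∏ l ∈ Finset.range n, lE i (j + (l : ZMod n)) := fun {i j} h => by
    rw [prod_restrictScalarsTo_exB j fun j' h' => ?_]
    · exact hp.powE i j h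
    · obtain ⟨l, hl, hl'⟩ := exists_exB_and_not i h h'
      exact ⟨l, hl, hp.lE_zero i l hl hl'⟩
  have pF : ∀ {i j}, ExB P i j →
      p.γFp ^ n = p.γFm ^ n + ∏ l ∈ Finset.range n, lF i (j + (l : ZMod n)) := fun {i j} h => by
    rw [prod_restrictScalarsTo_exB j fun j' h' => ?_]
    · exact hp.powF i j h
    -- For `F` the relevant neighbour is `(i - 1, l)`; by stability it is missing exactly when `(i,
    -- l + 1)` is.
    · obtain ⟨l, hl, hl'⟩ := exists_exB_and_not i h h'
      exact ⟨l, hl, hp.lF_zero i l hl fun h1 => hl' (by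
        rwa [← hEx, sub_add_cancel] at h1)⟩
  let c : P.toQuiv.A → k := fun a => (ν (upperB a) (lowerB a) : k)⁻¹
  let ix : P.toQuiv.V → ZMod n := fun v => Sum.elim id id (indexB v)
  let gE : P.toQuiv.V → k := fun v => Sum.elim (fun _ => p.γEp) (fun _ => p.γEm) (indexB v)
  let gF : P.toQuiv.V → k := fun v => Sum.elim (fun _ => p.γFp) (fun _ => p.γFm) (indexB v)
  let ka : P.toQuiv.A → PathAlgebra k P.toQuiv := fun a => c a • b (upperB a + 1) (lowerB a + 1)
  let ηE : P.toQuiv.A → PathAlgebra k P.toQuiv := fun a =>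
    c a • lE (upperB a) (lowerB a) • b (upperB a) (lowerB a + 1)
  let ηF : P.toQuiv.A → PathAlgebra k P.toQuiv := fun a =>
    c a • lF (upperB a) (lowerB a) • b (upperB a - 1) (lowerB a)
  have hs : ∀ a : P.toQuiv.A, e k (σ (P.toQuiv.s a)) = vertB k P (Sum.inl (upperB a + 1)) :=
    fun a => by rw [e_eq_vertB, hσl (indexB_source a)]
  have ht : ∀ a : P.toQuiv.A, e k (σ (P.toQuiv.t a)) = vertB k P (Sum.inr (lowerB a + 1)) :=
    fun a => by rw [e_eq_vertB, hσr (indexB_target a)]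
  have hs' : ∀ a : P.toQuiv.A, e k (σ.symm (P.toQuiv.s a)) = vertB k P (Sum.inl (upperB a - 1)) :=
    fun a => by rw [e_eq_vertB, hσl' (indexB_source a)]
  have key : ∀ κ D D', GeneratorValues q σ ix gE gF ka ηE ηF κ D D' →
      GridFamily q κ D D' b ⟨p.γEp, p.γEm, p.γFp, p.γFm, lE, lF⟩ := by
    intro κ D D' V
    have hK : ∀ i j, κ (b i j) = b (i + 1) (j + 1) := by
      intro i j
      by_cases h : ExB P i j
      · obtain ⟨a, rfl, rfl⟩ := exists_arrow h
        rw [hba, map_smul, V.Ka]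
        simp only [ka, c, smul_smul]
        rw [mul_inv_cancel₀ (Units.ne_zero _), one_smul]
      · rw [hb0 i j h, map_zero, hb0 _ _ fun h' => h ((hEx i j).mp h')]
    refine ⟨hK, fun i j => ?_, fun i j => ?_, sE, sF⟩
    · by_cases h : ExB P i j
      · obtain ⟨a, rfl, rfl⟩ := exists_arrow h
        rw [hba, map_smul, V.Ea]
        simp only [ka, ηE, c, gE, ix, indexB_source, indexB_target, Sum.elim_inl, Sum.elim_inr, id]
        have := Units.ne_zero (ν (upperB a) (lowerB a))
        match_scalars <;> field_simp
      · rw [hb0 i j h, map_zero, hb0 _ _ fun h' => h ((hEx i j).mp h')]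
        simp only [lE, restrictScalarsTo_of_not h, zero_smul, smul_zero, sub_zero, add_zero]
    · by_cases h : ExB P i j
      · obtain ⟨a, rfl, rfl⟩ := exists_arrow h
        rw [hba, map_smul, V.Fa, hab, map_smul, shift_pow_pred_apply hK]
        simp only [ηF, c, gF, ix, indexB_source, indexB_target, Sum.elim_inl, Sum.elim_inr, id]
        have := Units.ne_zero (ν (upperB a) (lowerB a))
        match_scalars <;> field_simp
      · have h1 : ¬ ExB P (i - 1) (j - 1) := fun h' => h (by
          have := (hEx (i - 1) (j - 1)).mpr h'
          rwa [sub_add_cancel, sub_add_cancel] at this)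
        rw [hb0 i j h, map_zero, hb0 _ _ h1]
        simp only [lF, restrictScalarsTo_of_not h, zero_smul, smul_zero, sub_zero, add_zero]
  have key' : ∀ κ D D', GeneratorValues q σ ix gE gF ka ηE ηF κ D D' →
      VertexOrbit q κ D D' (fun i => vertB k P (Sum.inl i)) p.γEp p.γFp ∧
      VertexOrbit q κ D D' (fun i => vertB k P (Sum.inr i)) p.γEm p.γFm := by
    intro κ D D' V
    -- An orbit that is not wholly present is wholly absent, and then all formulas read `0 = 0`.
    have orbit : ∀ (c : ZMod n → ZMod n ⊕ ZMod n) (γE γF : k),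
        (∀ i, c (i + 1) = shiftB (c i)) →
        (∀ v i, indexB v = c i → ix v = i ∧ gE v = γE ∧ gF v = γF) →
        VertexOrbit q κ D D' (fun i => vertB k P (c i)) γE γF := by
      intro c γE γF hc h
      by_cases hall : ∀ i, VertexB P (c i)
      · choose w hw using fun i => exists_indexB (hall i)
        have hσw : ∀ i, σ (w i) = w (i + 1) := fun i => indexB_injective (by
          rw [hσ, hw, hw, hc])
        have hσw' : ∀ i, σ.symm (w i) = w (i - 1) := fun i => by
          rw [Equiv.symm_apply_eq, hσw, sub_add_cancel]
        have hew : ∀ i, vertB k P (c i) = e k (w i) := fun i => by rw [e_eq_vertB, hw]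
        simp only [hew]
        refine ⟨fun i => ?_, fun i => ?_, fun i => ?_⟩ <;> obtain ⟨h1, h2, h3⟩ := h (w i) i (hw i)
        · rw [V.Ke, hσw]
        · rw [V.Ee, hσw, h1, h2]
        · rw [V.Fe, hσw', h1, h3]
      · have h0 : ∀ i, vertB k P (c i) = 0 := fun i => vertB_of_not fun hi =>
          hall (ZMod.forall_of_exists (p := fun i => VertexB P (c i))
            (fun i hi => by rw [hc]; exact vertexB_shiftB hP hi) hi)
        exact ⟨by simp [h0], by simp [h0], by simp [h0]⟩
    exact ⟨orbit Sum.inl p.γEp p.γFp (fun _ => rfl) fun v i h => by simp [ix, gE, gF, h],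
      orbit Sum.inr p.γEm p.γFm (fun _ => rfl) fun v i h => by simp [ix, gE, gF, h]⟩
  obtain ⟨α, hα, V⟩ := exists_filtered_action (k := k) (Q := P.toQuiv) (q := q) hn2 σ ix
    (fun v => by simp only [ix, hσ]; cases indexB v <;> rfl) gE gF
    (fun v => by simp only [gE, hσ]; cases indexB v <;> rfl)
    (fun v => by simp only [gF, hσ]; cases indexB v <;> rfl) hσn ka ηE ηF
    (fun a => by simp only [ka]; rw [hs, mul_smul_comm, hbl])
    (fun a => by simp only [ka]; rw [ht, smul_mul_assoc, hbr])
    (fun a => by simp only [ηE]; rw [e_eq_vertB, indexB_source, mul_smul_comm, mul_smul_comm, hbl])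
    (fun a => by simp only [ηE]; rw [ht, smul_mul_assoc, smul_mul_assoc, hbr])
    (fun a => by simp only [ηF]; rw [hs', mul_smul_comm, mul_smul_comm, hbl])
    (fun a => by
      simp only [ηF]; rw [e_eq_vertB, indexB_target, smul_mul_assoc, smul_mul_assoc, hbr])
    (fun a => Submodule.smul_mem _ _ (hbf _ _))
    (fun a => Submodule.smul_mem _ _ (Submodule.smul_mem _ _ (hbf _ _)))
    (fun a => Submodule.smul_mem _ _ (Submodule.smul_mem _ _ (hbf _ _)))
    (by
      intro κ D D' V x hx
      have G := key κ D D' V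
      have G' := key' κ D D' V
      rcases hx with ⟨v, rfl⟩ | ⟨a, rfl⟩
      · rw [e_eq_vertB]
        cases indexB v with
        | inl i => exact G'.1.relationsAt hq.out hn2 (fun _ => hp.gamma_plus) i
        | inr j => exact G'.2.relationsAt hq.out hn2 (fun _ => hp.gamma_minus) j
      · rw [hab]
        exact (G.relationsAt hq.out (pE (exB_arrow a)) (pF (exB_arrow a))
          (G.EF_sub_FE hq.out hn2 hp.gamma_plus hp.gamma_minus _ _ (hcomm _ _))).smul _)
  have G := key _ _ _ V
  obtain ⟨Gl, Gr⟩ := key' _ _ _ V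
  refine ⟨α, hα, ⟨fun i _ => Gl.hK i, fun j _ => Gr.hK j⟩, fun i j _ => G.hK i j,
    (formulasB_iff _ _ _).mpr ⟨fun i _ => Gl.formulasVert i, fun j _ => Gr.formulasVert j,
      fun i j h => ⟨?_, ?_⟩⟩⟩
  · have h1 := G.hE i j
    dsimp only at h1
    rwa [show lE i j = p.lE i j from restrictScalarsTo_of h] at h1
  · have h1 := G.hF i j
    dsimp only at h1
    rwa [show lF i j = p.lF i j from restrictScalarsTo_of h] at h1

end action
end TypeB

/-! ### The classification -/

theorem mainTheorem8 {k : Type*} [Field k] (n : ℕ) [NeZero n] (hn : 2 ≤ n) (q : k)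
    [Fact (IsPrimitiveRoot q (2 * n))] :
    -- vertices only, orbit of size `m < n`
    (∀ (m : ℕ) [NeZero m], m < n →
      ∀ α : HopfAction k (Uq n q) (PathAlgebra k (discreteQuiver m)),
        (∀ i : ZMod m, α.act (Uq.K n q) (PathAlgebra.e k (Q := discreteQuiver m) i)
          = PathAlgebra.e k (Q := discreteQuiver m) (i + 1 : ZMod m)) →
        (m = 1 ∨ m = 2) ∧
        ∀ h ∈ TwoSidedIdeal.span ({Uq.E n q, Uq.F n q} : Set (Uq n q)), α.act h = 0) ∧
    -- vertices only, orbit of size `n`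
    ((∀ α : HopfAction k (Uq n q) (PathAlgebra k (discreteQuiver n)),
        (∀ i : ZMod n, α.act (Uq.K n q) (PathAlgebra.e k (Q := discreteQuiver n) i)
          = PathAlgebra.e k (Q := discreteQuiver n) (i + 1 : ZMod n)) →
        ∃ γE γF : k, (3 ≤ n → GammaCond q γE γF) ∧
          ∀ i : ZMod n, FormulasVert α (fun l : ZMod n =>
            PathAlgebra.e k (Q := discreteQuiver n) l) γE γF i) ∧
      (∀ γE γF : k, (3 ≤ n → GammaCond q γE γF) →
        ∃! α : HopfAction k (Uq n q) (PathAlgebra k (discreteQuiver n)),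
          (∀ i : ZMod n, α.act (Uq.K n q) (PathAlgebra.e k (Q := discreteQuiver n) i)
            = PathAlgebra.e k (Q := discreteQuiver n) (i + 1 : ZMod n)) ∧
          ∀ i : ZMod n, FormulasVert α (fun l : ZMod n =>
            PathAlgebra.e k (Q := discreteQuiver n) l) γE γF i)) ∧
    -- subquivers of `K_n`
    (3 ≤ n → ∀ P : (completeQuiver n).Sub, StableA P →
      (∀ α : HopfAction k (Uq n q) (PathAlgebra k P.toQuiv), α.Filtered →
        (∀ i, ExA P i i → α.act (Uq.K n q) (pathA k P i i) = pathA k P (i + 1) (i + 1)) →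
        (∃ μ : ZMod n → ZMod n → kˣ, (∀ i, μ i i = 1) ∧
          ∀ i j, ExA P i j →
            α.act (Uq.K n q) (pathA k P i j) = (μ i j : k) • pathA k P (i + 1) (j + 1) ∧
            ∏ l ∈ Finset.range n, μ (i + (l : ZMod n)) (j + (l : ZMod n)) = 1) ∧
        (∃ ν : ZMod n → ZMod n → kˣ, (∀ i, ν i i = 1) ∧
          KShiftsA α (fun i j => (ν i j : k) • pathA k P i j)) ∧
        (∀ ν : ZMod n → ZMod n → kˣ, (∀ i, ν i i = 1) →
          KShiftsA α (fun i j => (ν i j : k) • pathA k P i j) →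
          ∃ p : ParamsA k n, p.Admissible q P ∧
            FormulasA α (fun i j => (ν i j : k) • pathA k P i j) p)) ∧
      (∀ (ν : ZMod n → ZMod n → kˣ), (∀ i, ν i i = 1) →
        ∀ p : ParamsA k n, p.Admissible q P →
          ∃! α : HopfAction k (Uq n q) (PathAlgebra k P.toQuiv), α.Filtered ∧
            KShiftsA α (fun i j => (ν i j : k) • pathA k P i j) ∧
            FormulasA α (fun i j => (ν i j : k) • pathA k P i j) p)) ∧
    -- subquivers of `K_{n,n}`
    (3 ≤ n → ∀ P : (bipartiteQuiver n).Sub, StableB P →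
      (∀ α : HopfAction k (Uq n q) (PathAlgebra k P.toQuiv), α.Filtered → KShiftsVertB α →
        (∃ μ : ZMod n → ZMod n → kˣ,
          ∀ i j, ExB P i j →
            α.act (Uq.K n q) (arrB k P i j) = (μ i j : k) • arrB k P (i + 1) (j + 1) ∧
            ∏ l ∈ Finset.range n, μ (i + (l : ZMod n)) (j + (l : ZMod n)) = 1) ∧
        (∃ ν : ZMod n → ZMod n → kˣ,
          KShiftsB α (fun i j => (ν i j : k) • arrB k P i j)) ∧
        (∀ ν : ZMod n → ZMod n → kˣ,
          KShiftsB α (fun i j => (ν i j : k) • arrB k P i j) →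
          ∃ p : ParamsB k n, p.Admissible q P ∧
            FormulasB α (fun i j => (ν i j : k) • arrB k P i j) p)) ∧
      (∀ (ν : ZMod n → ZMod n → kˣ) (p : ParamsB k n), p.Admissible q P →
          ∃! α : HopfAction k (Uq n q) (PathAlgebra k P.toQuiv), α.Filtered ∧
            KShiftsVertB α ∧ KShiftsB α (fun i j => (ν i j : k) • arrB k P i j) ∧
            FormulasB α (fun i j => (ν i j : k) • arrB k P i j) p)) := by
  refine ⟨fun m _ hmn α hK => discrete_of_lt hn m hmn α hK,
    ⟨fun α hK => discrete_exists_scalars hn α hK,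
      fun γE γF hγ => discrete_existsUnique hn γE γF hγ⟩,
    fun hn3 P hP => ⟨fun α hα hK => ?_, fun ν hν p hp => ?_⟩,
    fun hn3 P hP => ⟨fun α hα hK => ?_, fun ν p hp => ?_⟩⟩
  · exact ⟨(exists_units_A α hP hα hK).1, (exists_units_A α hP hα hK).2,
      fun ν hν hKν => exists_params_A α hn3 hP hα hK ν hν hKν⟩
  · exact existsUnique_of_exists_of_unique (exists_action_A hn3 hP ν hν p hp)
      fun α β hα hβ => unique_A ν p hα.2.1 hα.2.2 hβ.2.1 hβ.2.2
  · exact ⟨(exists_units_B α hP hα hK).1, (exists_units_B α hP hα hK).2,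
      fun ν hKν => exists_params_B α hn3 hP hα hK ν hKν⟩
  · exact existsUnique_of_exists_of_unique (exists_action_B hn3 hP ν p hp)
      fun α β hα hβ => unique_B ν p hα.2 hβ.2
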